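/- Let $R=R_0\oplus R_1$ be a supercommutative $\mathbb Q$-superalgebra: an associative unital $\mathbb Z/2$-graded $\mathbb Q$-algebra with $ab=(-1)^{|a||b|}ba$ for homogeneous $a,b$. Let $p,q\ge 0$ and let $V$ be the $p|q$-dimensional superspace over $R$, i.e. the free right $R$-module with $p$ even and $q$ odd basis vectors. Let $$A=\begin{pmatrix}A_{00}&A_{01}\\A_{10}&A_{11}\end{pmatrix}$$ be an even linear operator in $V$ (the entries of $A_{00},A_{11}$ lie in $R_0$, those of $A_{01},A_{10}$ in $R_1$) such that $A_{11}$ is invertible, and let $$\operatorname{Ber}A=\det(A_{00}-A_{01}A_{11}^{-1}A_{10})\,(\det A_{11})^{-1}$$ be its Berezinian. Let $\Lambda^kV$ be the $k$-th homogeneous part of the quotient of the tensor algebra $T(V)$ by the two-sided ideal generated by the elements $v\otimes u+(-1)^{|u||v|}u\otimes v$ ($u,v\in V$ homogeneous), let $\Lambda^kA$ be the operator induced by $A$ in $\Lambda^kV$, and let $\operatorname{Tr}$ denote the supertrace. Put $c_k=\operatorname{Tr}\Lambda^kA$ for $k\ge 0$ and $c_k=0$ for $k<0$, and denote by $|c_a\ldots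 c_{a+n-1}|_n=\det(c_{a+i+j})_{0\le i,j<n}$ the Hankel determinant of order $n$ (equal to $1$ for $n=0$). For the rectangular Young diagram $D(r,s)$ with $r$ rows and $s$ columns let $V_{D(r,s)}\subset V^{\otimes rs}$ be the image of its Young symmetrizer (row symmetrizer times column antisymmetrizer), where the symmetric group acts on $V^{\otimes rs}$ by the sign rule, and let $A_{D(r,s)}$ be the restriction of $A^{\otimes rs}$ to $V_{D(r,s)}$. **Theorem.** The Berezinian satisfies $$\operatorname{Ber}A\cdot|c_{p-q+2}\ldots c_{p+1}|_q=|c_{p-q}\ldots c_p|_{q+1},\qquad \operatorname{Ber}A\cdot\operatorname{Tr}A_{D(p+1,q)}=(-1)^q\operatorname{Tr}A_{D(p,q+1)}.$$ The element $|c_{p-q+2}\ldots c_{p+1}|_q$ of $R_0$ is invertible if and only if $\operatorname{Tr}A_{D(p+1,q)}$ is, and if they are invertible, then $$\operatorname{Ber}A=\frac{|\operatorname{Tr}\Lambda^{p-q}A\ \ldots\ \operatorname{Tr}\Lambda^{p}A|_{q+1}}{|\operatorname{Tr}\Lambda^{p-q+2}A\ \ldots\ \operatorname{Tr}\Lambda^{p+1}A|_{q}}=(-1)^q\,\frac{\operatorname{Tr}A_{D(p,q+1)}}{\operatorname{Tr}A_{D(p+1,q)}}.$$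 Moreover, for all $R$, $p$, $q$ there is an invertible even operator $A$ with $A_{11}$ invertible for which these denominators are invertible. -/

import Mathlib

open scoped BigOperators MulOpposite

noncomputable section

universe u

namespace SuperLin

/-! Superspaces over a supercommutative ring.

Throughout, `R` is a `ℤ/2`-graded associative unital algebra over `ℚ` with homogeneous
components `𝒜 0` (even) and `𝒜 1` (odd), and it is supercommutative. -/

section Ring

variable {R : Type u} [Ring R] [Algebra ℚ R] (𝒜 : ZMod 2 → Submodule ℚ R) [GradedAlgebra 𝒜]

/-- Supercommutativity: `a b = (-1)^{|a||b|} b a` for homogeneous `a`, `b`. -/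
class SuperCommutative : Prop where
  mul_comm' : ∀ (i j : ZMod 2) (a b : R), a ∈ 𝒜 i → b ∈ 𝒜 j →
    a * b = ((-1 : ℤˣ) ^ (i * j)) • (b * a)

/-- The even part of a supercommutative ring is a commutative ring. -/
instance evenCommRing [SuperCommutative 𝒜] : CommRing (𝒜 0) :=
  { (inferInstance : Ring (𝒜 0)) with
    mul_comm := fun a b => by
      apply Subtype.ext
      have h := SuperCommutative.mul_comm' (𝒜 := 𝒜) 0 0 (a : R) (b : R) a.2 b.2
      simpa using h }

/-- The even component of an element of `R`. -/
def evenPart (x : R) : 𝒜 0 := DirectSum.decompose 𝒜 x 0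

end Ring

/-- Parity of the basis vectors of the standard `p|q`-dimensional superspace: the first `p` are
even, the last `q` are odd. -/
def par {p q : ℕ} : Fin p ⊕ Fin q → ZMod 2 := Sum.elim (fun _ => 0) (fun _ => 1)

/-- An even linear operator on the standard `p|q`-dimensional superspace (the free right
`R`-module with basis `e_j`, `A e_j = ∑ e_i A_{ij}`): a matrix with even entries in the diagonal
blocks and odd entries in the antidiagonal blocks. -/
structure EvenOperator {R : Type u} [Ring R] [Algebra ℚ R] (𝒜 : ZMod 2 → Submodule ℚ R)
    (p q : ℕ) where
  mat : Matrix (Fin p ⊕ Fin q) (Fin p ⊕ Fin q) R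
  mem : ∀ i j, mat i j ∈ 𝒜 (par i + par j)

/-! ### The Berezinian -/

section Ber

variable {R : Type u} [Ring R] [Algebra ℚ R] {𝒜 : ZMod 2 → Submodule ℚ R} [GradedAlgebra 𝒜]
  [SuperCommutative 𝒜] {p q : ℕ}

/-- The block `A₀₀`, a matrix over the even part of `R`. -/
def EvenOperator.block00 (A : EvenOperator 𝒜 p q) : Matrix (Fin p) (Fin p) (𝒜 0) :=
  Matrix.of fun i j => ⟨A.mat (Sum.inl i) (Sum.inl j), by
    simpa [par] using A.mem (Sum.inl i) (Sum.inl j)⟩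

/-- The block `A₁₁`, a matrix over the even part of `R`. -/
def EvenOperator.block11 (A : EvenOperator 𝒜 p q) : Matrix (Fin q) (Fin q) (𝒜 0) :=
  Matrix.of fun i j => ⟨A.mat (Sum.inr i) (Sum.inr j), by
    have h := A.mem (Sum.inr i) (Sum.inr j)
    have e : par (p := p) (Sum.inr i) + par (p := p) (Sum.inr j) = 0 := by
      simp only [par, Sum.elim_inr]; decide
    rwa [e] at h⟩

/-- The product `A₀₁ A₁₁⁻¹ A₁₀`; its entries are even. -/
def EvenOperator.schurTerm (A : EvenOperator 𝒜 p q) : Matrix (Fin p) (Fin p) (𝒜 0) :=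
  Matrix.of fun i j =>
    ⟨∑ k : Fin q, ∑ l : Fin q,
      A.mat (Sum.inl i) (Sum.inr k) * ((A.block11⁻¹ k l : 𝒜 0) : R) *
        A.mat (Sum.inr l) (Sum.inl j), by
      refine Submodule.sum_mem _ fun k _ => Submodule.sum_mem _ fun l _ => ?_
      have h := SetLike.GradedMul.mul_mem (SetLike.GradedMul.mul_mem
        (A.mem (Sum.inl i) (Sum.inr k)) (A.block11⁻¹ k l).2) (A.mem (Sum.inr l) (Sum.inl j))
      have e : par (Sum.inl i : Fin p ⊕ Fin q) + par (Sum.inr k : Fin p ⊕ Fin q) + 0 +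
          (par (Sum.inr l : Fin p ⊕ Fin q) + par (Sum.inl j : Fin p ⊕ Fin q)) = 0 := by
        simp only [par, Sum.elim_inr, Sum.elim_inl]; decide
      rwa [e] at h⟩

/-- The Berezinian `det (A₀₀ - A₀₁ A₁₁⁻¹ A₁₀) · (det A₁₁)⁻¹`, meaningful when `A₁₁` is
invertible. -/
def EvenOperator.ber (A : EvenOperator 𝒜 p q) : 𝒜 0 :=
  (A.block00 - A.schurTerm).det * Ring.inverse A.block11.det

end Ber

/-! ### Supertraces -/

/-- `t` is the supertrace `∑ (-1)^{|b_k|} f_{kk}` of `f` in some finite basis of homogeneous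
elements `b_k` of the right `R`-module `M`; the even and odd parts of `M` are `ℳ 0`, `ℳ 1`. -/
def HasSuperTrace {R : Type u} [Ring R] {M : Type u} [AddCommGroup M] [Module Rᵐᵒᵖ M]
    (ℳ : ZMod 2 → AddSubgroup M) (f : M →ₗ[Rᵐᵒᵖ] M) (t : R) : Prop :=
  ∃ (n : ℕ) (π : Fin n → ZMod 2) (b : Module.Basis (Fin n) Rᵐᵒᵖ M),
    (∀ k, b k ∈ ℳ (π k)) ∧
    t = ∑ k, ((-1 : ℤˣ) ^ (π k)) • MulOpposite.unop (b.repr (f (b k)) k)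

open Classical in
/-- The supertrace of an operator on a right module with a finite homogeneous basis (for an even
operator it does not depend on the basis). -/
def superTrace {R : Type u} [Ring R] {M : Type u} [AddCommGroup M] [Module Rᵐᵒᵖ M]
    (ℳ : ZMod 2 → AddSubgroup M) (f : M →ₗ[Rᵐᵒᵖ] M) : R :=
  if h : ∃ t, HasSuperTrace ℳ f t then h.choose else 0

/-! ### Tensor powers -/

/-- The `k`-th tensor power of the standard `p|q`-dimensional superspace `V`: the free right
`R`-module on the words `e_{w 0} ⊗ ⋯ ⊗ e_{w (k-1)}`; `x w` is the (right) coordinate of `x`. -/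
abbrev TensorPow (R : Type u) (p q k : ℕ) : Type u := (Fin k → Fin p ⊕ Fin q) → R

/-- Parity of a word. -/
def wordPar {p q k : ℕ} (w : Fin k → Fin p ⊕ Fin q) : ZMod 2 := ∑ s, par (w s)

/-- The elements of parity `i` of the tensor power: `e_w a` has parity `|w| + |a|`. -/
def tensorGrading {R : Type u} [Ring R] [Algebra ℚ R] (𝒜 : ZMod 2 → Submodule ℚ R)
    (p q k : ℕ) (i : ZMod 2) : AddSubgroup (TensorPow R p q k) where
  carrier := {x | ∀ w, x w ∈ 𝒜 (i + wordPar w)}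
  add_mem' := fun hx hy w => (𝒜 _).add_mem (hx w) (hy w)
  zero_mem' := fun _ => (𝒜 _).zero_mem
  neg_mem' := fun hx w => (𝒜 _).neg_mem (hx w)

/-- The exponent of the sign in `σ (v₁ ⊗ ⋯ ⊗ v_k)`, for `v_s` of parity `π s`: each pair of
factors whose order is reversed by `σ` contributes the product of their parities. -/
def koszulExp {k : ℕ} (σ : Equiv.Perm (Fin k)) (π : Fin k → ZMod 2) : ZMod 2 :=
  ∑ s, ∑ t, if s < t ∧ σ t < σ s then π s * π t else 0

/-- The action of a permutation on the tensor power by the sign rule: the factor in place `s` is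
moved to place `σ s`. -/
def permAct (R : Type u) [Ring R] (p q : ℕ) {k : ℕ} (σ : Equiv.Perm (Fin k)) :
    TensorPow R p q k →ₗ[Rᵐᵒᵖ] TensorPow R p q k where
  toFun x := fun w => ((-1 : ℤˣ) ^ koszulExp σ (fun s => par (w (σ s)))) • x (w ∘ σ)
  map_add' x y := by ext w; simp
  map_smul' r x := by ext w; simp [Units.smul_def, mul_assoc]

/-- The exponent of the sign in the matrix of `A^{⊗k}`: in
`A e_{j 0} ⊗ ⋯ ⊗ A e_{j (k-1)} = ∑ e_{i 0} A_{i 0, j 0} ⊗ ⋯ ⊗ e_{i (k-1)} A_{i (k-1), j (k-1)}`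
the coefficient `A_{i s, j s}` is moved to the right past `e_{i t}` for all `t > s`. -/
def tensorExp {p q k : ℕ} (i j : Fin k → Fin p ⊕ Fin q) : ZMod 2 :=
  ∑ s, ∑ t, if s < t then (par (i s) + par (j s)) * par (i t) else 0

/-- The operator `A^{⊗k}` on the tensor power. -/
def tensorMap {R : Type u} [Ring R] [Algebra ℚ R] {𝒜 : ZMod 2 → Submodule ℚ R}
    {p q : ℕ} (A : EvenOperator 𝒜 p q) (k : ℕ) :
    TensorPow R p q k →ₗ[Rᵐᵒᵖ] TensorPow R p q k where
  toFun x := fun i => ∑ j : Fin k → Fin p ⊕ Fin q,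
    (((-1 : ℤˣ) ^ tensorExp i j) • (List.ofFn fun s => A.mat (i s) (j s)).prod) * x j
  map_add' x y := by ext w; simp [mul_add, Finset.sum_add_distrib]
  map_smul' r x := by
    ext w
    simp [Finset.sum_mul, mul_assoc]

/-! ### The action of `A` commutes with permutations -/

theorem sum_sum_eq_of_lt {k : ℕ} (f : Fin k → Fin k → ZMod 2) (h0 : ∀ s, f s s = 0) :
    ∑ s, ∑ t, f s t = ∑ s, ∑ t, if s < t then f s t + f t s else 0 := by
  have h1 : ∀ s t : Fin k, f s t =
      (if s < t then f s t else 0) + (if t < s then f s t else 0) := by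
    intro s t
    rcases lt_trichotomy s t with h | h | h
    · simp [h, h.not_gt]
    · subst h; simp [h0]
    · simp [h, h.not_gt]
  calc ∑ s, ∑ t, f s t
      = ∑ s, ∑ t, ((if s < t then f s t else 0) + (if t < s then f s t else 0)) :=
        Finset.sum_congr rfl fun s _ => Finset.sum_congr rfl fun t _ => h1 s t
    _ = (∑ s, ∑ t, if s < t then f s t else 0) + ∑ s, ∑ t, (if t < s then f s t else 0) := by
        simp only [Finset.sum_add_distrib]
    _ = (∑ s, ∑ t, if s < t then f s t else 0) + ∑ s, ∑ t, (if s < t then f t s else 0) := by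
        congr 1; exact Finset.sum_comm
    _ = _ := by
        rw [← Finset.sum_add_distrib]
        refine Finset.sum_congr rfl fun s _ => ?_
        rw [← Finset.sum_add_distrib]
        refine Finset.sum_congr rfl fun t _ => ?_
        split_ifs <;> simp

theorem zmod2_add_self (a : ZMod 2) : a + a = 0 := CharTwo.add_self_eq_zero a

theorem koszulExp_mul {k : ℕ} (σ τ : Equiv.Perm (Fin k)) (π : Fin k → ZMod 2) :
    koszulExp (σ * τ) (fun s => π (σ (τ s))) =
      koszulExp τ (fun s => π (σ (τ s))) + koszulExp σ (fun s => π (σ s)) := by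
  have e : koszulExp σ (fun s => π (σ s)) =
      ∑ s, ∑ t, if τ s < τ t ∧ σ (τ t) < σ (τ s) then π (σ (τ s)) * π (σ (τ t)) else 0 := by
    unfold koszulExp
    rw [← Equiv.sum_comp τ]
    exact Finset.sum_congr rfl fun s _ => (Equiv.sum_comp τ _).symm
  rw [e, sum_sum_eq_of_lt _ (by simp)]
  unfold koszulExp
  rw [← Finset.sum_add_distrib]
  refine Finset.sum_congr rfl fun s _ => ?_
  rw [← Finset.sum_add_distrib]
  refine Finset.sum_congr rfl fun t _ => ?_
  by_cases hst : s < t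
  · have h1 : τ s ≠ τ t := fun h => hst.ne (τ.injective h)
    have h2 : σ (τ s) ≠ σ (τ t) := fun h => h1 (σ.injective h)
    rcases lt_or_gt_of_ne h1 with a | a <;> rcases lt_or_gt_of_ne h2 with b | b <;>
      simp [hst, a, b, a.not_gt, b.not_gt, mul_comm, zmod2_add_self]
  · simp [hst]

theorem koszulExp_one {k : ℕ} (π : Fin k → ZMod 2) : koszulExp 1 π = 0 := by
  unfold koszulExp
  refine Finset.sum_eq_zero fun s _ => Finset.sum_eq_zero fun t _ => ?_
  rw [if_neg]
  rintro ⟨h1, h2⟩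
  exact absurd h1 (not_lt.mpr h2.le)

theorem koszulExp_swap {n : ℕ} (i : Fin n) (π : Fin (n + 1) → ZMod 2) :
    koszulExp (Equiv.swap i.castSucc i.succ) π = π i.castSucc * π i.succ := by
  unfold koszulExp
  rw [Finset.sum_eq_single i.castSucc, Finset.sum_eq_single i.succ]
  · simp
  · intro t _ ht
    rw [if_neg]
    rintro ⟨h1, h2⟩
    rw [Equiv.swap_apply_left, Equiv.swap_apply_def] at h2
    split_ifs at h2 <;>
      simp only [Fin.lt_def, Fin.ext_iff, Fin.val_castSucc, Fin.val_succ] at * <;> omega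
  · simp
  · intro s _ hs
    refine Finset.sum_eq_zero fun t _ => ?_
    rw [if_neg]
    rintro ⟨h1, h2⟩
    rw [Equiv.swap_apply_def, Equiv.swap_apply_def] at h2
    split_ifs at h2 <;>
      simp only [Fin.lt_def, Fin.ext_iff, Fin.val_castSucc, Fin.val_succ] at * <;> omega
  · simp

section Comm

variable {R : Type u} [Ring R] [Algebra ℚ R] {𝒜 : ZMod 2 → Submodule ℚ R} [GradedAlgebra 𝒜]
  [SuperCommutative 𝒜]

theorem prod_swap {n : ℕ} (i : Fin n) (a : Fin (n + 1) → R) (π : Fin (n + 1) → ZMod 2)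
    (ha : ∀ s, a s ∈ 𝒜 (π s)) :
    (List.ofFn fun s => a (Equiv.swap i.castSucc i.succ s)).prod =
      ((-1 : ℤˣ) ^ (π i.castSucc * π i.succ)) • (List.ofFn a).prod := by
  induction n with
  | zero => exact i.elim0
  | succ n ih =>
    refine Fin.cases ?_ (fun i => ?_) i
    · have h2 : ∀ s : Fin n, Equiv.swap (Fin.castSucc (0 : Fin (n + 1))) (Fin.succ 0)
          s.succ.succ = s.succ.succ := by
        intro s
        apply Equiv.swap_apply_of_ne_of_ne
        · simp [Fin.ext_iff]
        · simp [Fin.ext_iff]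
      have h := SuperCommutative.mul_comm' (𝒜 := 𝒜) _ _ _ _ (ha (Fin.succ 0))
        (ha (Fin.castSucc 0))
      simp only [List.ofFn_succ, List.prod_cons, h2]
      have e0 : Equiv.swap (Fin.castSucc (0 : Fin (n + 1))) (Fin.succ 0) 0 = Fin.succ 0 :=
        Equiv.swap_apply_left _ _
      have e1 : Equiv.swap (Fin.castSucc (0 : Fin (n + 1))) (Fin.succ 0) (Fin.succ 0) = 0 :=
        Equiv.swap_apply_right _ _
      rw [e0, e1, ← mul_assoc, ← mul_assoc]
      rw [Fin.castSucc_zero] at h ⊢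
      rw [h, smul_mul_assoc, mul_comm (π 0)]
    · have h := ih i (fun s => a s.succ) (fun s => π s.succ) (fun s => ha s.succ)
      have h2 : ∀ s : Fin (n + 1), Equiv.swap i.succ.castSucc i.succ.succ s.succ =
          (Equiv.swap i.castSucc i.succ s).succ := by
        intro s
        rw [← Fin.succ_castSucc, Fin.succ_injective _ |>.swap_apply]
      have h0 : Equiv.swap i.succ.castSucc i.succ.succ 0 = 0 := by
        apply Equiv.swap_apply_of_ne_of_ne
        · simp [Fin.ext_iff]
        · simp [Fin.ext_iff]
      rw [List.ofFn_succ, List.ofFn_succ (f := a)]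
      simp only [h0, h2, List.prod_cons]
      rw [h, mul_smul_comm]
      rfl

/-- Reordering a product of homogeneous elements. -/
theorem prod_perm {k : ℕ} (σ : Equiv.Perm (Fin k)) (a : Fin k → R) (π : Fin k → ZMod 2)
    (ha : ∀ s, a s ∈ 𝒜 (π s)) :
    (List.ofFn fun s => a (σ s)).prod =
      ((-1 : ℤˣ) ^ koszulExp σ (fun s => π (σ s))) • (List.ofFn a).prod := by
  cases k with
  | zero =>
    have : σ = 1 := Subsingleton.elim _ _
    subst this
    simp [koszulExp_one]
  | succ n =>
    have hσ : σ ∈ Submonoid.closure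
        (Set.range fun i : Fin n => Equiv.swap i.castSucc i.succ) := by
      rw [Equiv.Perm.mclosure_swap_castSucc_succ]; trivial
    revert a π
    induction hσ using Submonoid.closure_induction with
    | mem τ hτ =>
      intro a π ha
      obtain ⟨i, rfl⟩ := hτ
      simp only [koszulExp_swap, Equiv.swap_apply_left, Equiv.swap_apply_right]
      rw [prod_swap i a π ha, mul_comm]
    | one =>
      intro a π ha
      simp [koszulExp_one]
    | mul σ τ _ _ ihσ ihτ =>
      intro a π ha
      have h1 := ihτ (fun s => a (σ s)) (fun s => π (σ s)) (fun s => ha (σ s))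
      have h2 := ihσ a π ha
      simp only [Equiv.Perm.mul_apply]
      rw [h1, h2, koszulExp_mul, uzpow_add, mul_smul]

theorem tensorExp_perm {p q k : ℕ} (σ : Equiv.Perm (Fin k)) (i j : Fin k → Fin p ⊕ Fin q) :
    koszulExp σ (fun s => par (i (σ s))) + tensorExp (i ∘ σ) (j ∘ σ) +
      koszulExp σ (fun s => par (i (σ s)) + par (j (σ s))) =
    koszulExp σ (fun s => par (j (σ s))) + tensorExp i j := by
  have e : tensorExp i j = ∑ s, ∑ t, if σ s < σ t then
      (par (i (σ s)) + par (j (σ s))) * par (i (σ t)) else 0 := by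
    unfold tensorExp
    rw [← Equiv.sum_comp σ]
    exact Finset.sum_congr rfl fun s _ => (Equiv.sum_comp σ _).symm
  rw [e, sum_sum_eq_of_lt _ (by simp)]
  unfold koszulExp tensorExp
  simp only [← Finset.sum_add_distrib]
  refine Finset.sum_congr rfl fun s _ => Finset.sum_congr rfl fun t _ => ?_
  by_cases hst : s < t
  · have h1 : σ s ≠ σ t := fun h => hst.ne (σ.injective h)
    simp only [Function.comp_apply, hst, true_and, if_true]
    generalize par (i (σ s)) = a
    generalize par (i (σ t)) = b
    generalize par (j (σ s)) = c
    generalize par (j (σ t)) = d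
    rcases lt_or_gt_of_ne h1 with h | h <;>
      simp only [h, h.not_gt, if_true, if_false] <;> revert a b c d <;> decide
  · simp [hst]

/-- `A^{⊗k}` commutes with the action of the symmetric group. -/
theorem tensorMap_comp_permAct {p q k : ℕ} (A : EvenOperator 𝒜 p q) (σ : Equiv.Perm (Fin k)) :
    tensorMap A k ∘ₗ permAct R p q σ = permAct R p q σ ∘ₗ tensorMap A k := by
  refine LinearMap.ext fun x => funext fun i => ?_
  simp only [LinearMap.comp_apply, tensorMap, permAct, LinearMap.coe_mk, AddHom.coe_mk]
  rw [Finset.smul_sum]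
  refine Fintype.sum_equiv (Equiv.arrowCongr σ.symm (Equiv.refl _)) _ _ fun j => ?_
  have hj : (Equiv.arrowCongr σ.symm (Equiv.refl (Fin p ⊕ Fin q))) j = j ∘ σ := by
    ext s; simp
  rw [hj]
  have hp := prod_perm σ (fun s => A.mat (i s) (j s)) (fun s => par (i s) + par (j s))
    (fun s => A.mem (i s) (j s))
  simp only [Function.comp_apply]
  rw [hp, smul_mul_assoc, smul_mul_assoc, mul_smul_comm, smul_smul, smul_mul_assoc, smul_smul,
    smul_smul, ← uzpow_add, ← uzpow_add, ← uzpow_add]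
  have := tensorExp_perm σ i j
  rw [add_comm (tensorExp i j), ← this]

end Comm

/-! ### Exterior powers -/

section Ext

variable {R : Type u} [Ring R] [Algebra ℚ R] {𝒜 : ZMod 2 → Submodule ℚ R} [GradedAlgebra 𝒜]
  [SuperCommutative 𝒜] {p q : ℕ}

/-- The degree `k` part of the two-sided ideal of the tensor algebra generated by the elements
`v ⊗ u + (-1)^{|u||v|} u ⊗ v`: it is spanned by the elements `x + τ x`, with `τ` the interchange
(with sign) of two neighbouring factors. -/
def extRel (R : Type u) [Ring R] (p q k : ℕ) : Submodule Rᵐᵒᵖ (TensorPow R p q k) :=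
  ⨆ (s : Fin k) (t : Fin k) (_ : (s : ℕ) + 1 = t),
    LinearMap.range (LinearMap.id + permAct R p q (Equiv.swap s t))

/-- The exterior power `Λ^k V = V^{⊗k} / ⟨v ⊗ u + (-1)^{|u||v|} u ⊗ v⟩`. -/
abbrev ExtPow (R : Type u) [Ring R] (p q k : ℕ) : Type u := TensorPow R p q k ⧸ extRel R p q k

/-- The grading of the exterior power inherited from the tensor power. -/
def extGrading (𝒜 : ZMod 2 → Submodule ℚ R) (p q k : ℕ) (i : ZMod 2) :
    AddSubgroup (ExtPow R p q k) :=
  (tensorGrading 𝒜 p q k i).map (extRel R p q k).mkQ.toAddMonoidHom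

theorem extRel_le_comap (A : EvenOperator 𝒜 p q) (k : ℕ) :
    extRel R p q k ≤ (extRel R p q k).comap (tensorMap A k) := by
  refine iSup_le fun s => iSup_le fun t => iSup_le fun h => ?_
  rintro _ ⟨x, rfl⟩
  rw [Submodule.mem_comap]
  have hc := LinearMap.congr_fun (tensorMap_comp_permAct A (Equiv.swap s t)) x
  have e : tensorMap A k (x + permAct R p q (Equiv.swap s t) x) =
      tensorMap A k x + permAct R p q (Equiv.swap s t) (tensorMap A k x) := by
    rw [map_add]
    exact congrArg _ hc
  have hle : LinearMap.range (LinearMap.id + permAct R p q (Equiv.swap s t)) ≤ extRel R p q k :=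
    le_iSup_of_le s (le_iSup_of_le t (le_iSup_of_le h le_rfl))
  exact hle ⟨tensorMap A k x, e.symm⟩

/-- The operator `Λ^k A` on `Λ^k V` induced by `A`. -/
def extMap (A : EvenOperator 𝒜 p q) (k : ℕ) : ExtPow R p q k →ₗ[Rᵐᵒᵖ] ExtPow R p q k :=
  (extRel R p q k).mapQ (extRel R p q k) (tensorMap A k) (extRel_le_comap A k)

/-- `Tr Λ^k A` for `k ≥ 0`, and zero for `k < 0`. The supertrace of an even operator is even, so
taking the even component only records this fact in the type. -/
def trExt (A : EvenOperator 𝒜 p q) : ℤ → 𝒜 0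
  | Int.ofNat k => evenPart 𝒜 (superTrace (extGrading 𝒜 p q k) (extMap A k))
  | Int.negSucc _ => 0

end Ext

/-- The Hankel determinant `|c_a … c_{a+n-1}|_n` of order `n`, with entries `c_{a+i+j}`,
`0 ≤ i, j < n`. -/
def hankel {S : Type u} [CommRing S] (c : ℤ → S) (a : ℤ) (n : ℕ) : S :=
  (Matrix.of fun i j : Fin n => c (a + (i : ℕ) + (j : ℕ))).det

/-! ### Rectangular Young diagrams -/

section Young

variable {R : Type u} [Ring R] [Algebra ℚ R] {𝒜 : ZMod 2 → Submodule ℚ R} [GradedAlgebra 𝒜]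
  [SuperCommutative 𝒜] {p q : ℕ}

/-- The cell (row, column) of the label `t` in the tableau of rectangular shape with `r` rows and
`s` columns, filled row by row. -/
def rectCell (r s : ℕ) : Fin (r * s) ≃ Fin r × Fin s := finProdFinEquiv.symm

open Classical in
/-- The row symmetrizer `∑ g`, over the permutations `g` of the labels which preserve each row. -/
def rowSymm (R : Type u) [Ring R] (p q r s : ℕ) :
    TensorPow R p q (r * s) →ₗ[Rᵐᵒᵖ] TensorPow R p q (r * s) :=
  ∑ g : Equiv.Perm (Fin (r * s)) with ∀ t, (rectCell r s (g t)).1 = (rectCell r s t).1,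
    permAct R p q g

open Classical in
/-- The column antisymmetrizer `∑ sgn(g) g`, over the permutations `g` of the labels which
preserve each column. -/
def colAntisymm (R : Type u) [Ring R] (p q r s : ℕ) :
    TensorPow R p q (r * s) →ₗ[Rᵐᵒᵖ] TensorPow R p q (r * s) :=
  ∑ g : Equiv.Perm (Fin (r * s)) with ∀ t, (rectCell r s (g t)).2 = (rectCell r s t).2,
    (Equiv.Perm.sign g : ℤ) • permAct R p q g

/-- The subspace `V_D` of the tensor power `V^{⊗N}`, `N = r s`, corresponding to the Young diagram
`D = D(r,s)` with `r` rows and `s` columns: the image of the Young symmetrizer. -/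
def youngSub (R : Type u) [Ring R] (p q r s : ℕ) : Submodule Rᵐᵒᵖ (TensorPow R p q (r * s)) :=
  LinearMap.range (rowSymm R p q r s ∘ₗ colAntisymm R p q r s)

/-- The grading of `V_D` inherited from the tensor power. -/
def youngGrading (𝒜 : ZMod 2 → Submodule ℚ R) (p q r s : ℕ) (i : ZMod 2) :
    AddSubgroup (youngSub R p q r s) :=
  (tensorGrading 𝒜 p q (r * s) i).comap (youngSub R p q r s).subtype.toAddMonoidHom

theorem tensorMap_mem_youngSub (A : EvenOperator 𝒜 p q) (r s : ℕ)
    (x : TensorPow R p q (r * s)) (hx : x ∈ youngSub R p q r s) :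
    tensorMap A (r * s) x ∈ youngSub R p q r s := by
  have hc : ∀ (g : Equiv.Perm (Fin (r * s))) (y : TensorPow R p q (r * s)),
      tensorMap A (r * s) (permAct R p q g y) = permAct R p q g (tensorMap A (r * s) y) :=
    fun g y => LinearMap.congr_fun (tensorMap_comp_permAct A g) y
  obtain ⟨y, rfl⟩ := hx
  refine ⟨tensorMap A (r * s) y, ?_⟩
  simp only [LinearMap.comp_apply, rowSymm, colAntisymm, LinearMap.sum_apply,
    LinearMap.smul_apply, map_sum, map_zsmul, hc]

/-- The representation `A_D` of `A` in `V_D`, `D = D(r,s)`: the restriction of `A^{⊗N}`. -/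
def youngMap (A : EvenOperator 𝒜 p q) (r s : ℕ) :
    youngSub R p q r s →ₗ[Rᵐᵒᵖ] youngSub R p q r s :=
  (tensorMap A (r * s)).restrict (tensorMap_mem_youngSub A r s)

/-- `Tr A_D` for `D = D(r,s)` (an element of the even part of `R`, as for `trExt`). -/
def trYoung (A : EvenOperator 𝒜 p q) (r s : ℕ) : 𝒜 0 :=
  evenPart 𝒜 (superTrace (youngGrading 𝒜 p q r s) (youngMap A r s))

end Young

end SuperLin

end

/-!
The theorem compares three families of elements of `R₀` attached to an even operator `A`: the
Berezinian, Hankel determinants in `c_k = Tr Λ^k A`, and supertraces on rectangular Young modules.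
Everything is expressed through the supertraces of powers `P_k = str A^k` (`strPow`).

**Supertraces on summands of tensor powers.** The supertrace of `A^{⊗k}` composed with a
permutation `σ` is the product of the `P_l` over the lengths `l` of the cycles of `σ`
(`permTrace_eq_cyc`): it is constant on conjugacy classes, multiplicative on block sums, and equal
to `P_k` on a rotation. The exterior powers and the Young modules are direct summands of tensor
powers, cut out by idempotents of the rational group algebra of the symmetric group; such a
summand has a homogeneous basis defined over `ℚ`, and its supertrace is that of `A^{⊗k}` composed
with the idempotent (`superTrace_of_retract`). What remains is symmetric function theory. For the
antisymmetrizer the sum over permutations is `e_k`, so the `c_k` and the `P_k` are related by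
Newton's identities (`trExt_eq`). For a Young symmetrizer it is the Jacobi–Trudi determinant
(`trYoung_eq`). To see this, the class function `ψ` of the Young symmetrizer is compared with the
Frobenius character `χ`, defined by the coefficients of power sums times the Vandermonde
determinant. With `c² = h c`, the three sums `∑ ψ²`, `∑ ψ χ` and `∑ χ²` (`sum_youngClass_sq`,
`sum_coeff_youngElt_frob`, `sum_frob_sq`) show that `∑ (ψ - h χ)² = 0`, hence `ψ = h χ`
(`youngClass_eq`), and `χ` corresponds to the Jacobi–Trudi determinant (`sum_frob_cyc`). Reversing
the order of the columns turns this determinant into a Hankel determinant (`det_jacobiTrudi`). The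
signs for `q` and `q + 1` columns differ by `(-1)^q`, so the assertions about Young modules follow
from those about Hankel determinants.

**The Berezinian.** If `A` can be made block triangular with diagonal blocks `M₀` and `M₁`, then
`∑ c_k t^k = det (1 + t M₀) / det (1 + t M₁)`. Cramer's rule for the recurrence satisfied by the
`c_k` (`coeff_mul_hankel`) then gives `det M₁ · |c_{p-q} … c_p|_{q+1} = det M₀ · |c_{p-q+2} …
c_{p+1}|_q`. Block triangularization requires a solution of a Riccati equation, which need not
exist over `R`. It exists over `R⟦X⟧` for `D + X A`, where `D` is the projector onto the even part
of the superspace (`exists_riccati`). The solution `Y` enters both determinants only through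
factors `det (1 - Y' Y)` with odd matrices `Y`, `Y'`, and these cancel, as `det (1 - Y' Y)` is
inverse to `det (1 - Y Y')` (`det_one_sub_mul_det_one_sub`). What remains is an identity between
polynomials in `X` (`pow_mul_det_mul_hankel`), whose coefficients of the highest power of `X` give
the identity for `A` (`det_block11_mul_hankel`).

**The example.** For `A = diag(1, -1)` the generating function is `(1 + t)^p / (1 - t)^q`. Its
numerator and denominator are coprime, so its coefficients satisfy no recurrence of order less
than `q`, and the rational number `|c_{p-q+2} … c_{p+1}|_q` is not zero (`hankel_parity_ne_zero`).
-/

noncomputable section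

namespace SuperLin

/-! ### Newton's identities and generating series -/

section Newton

open PowerSeries

variable {S : Type*} [CommRing S] [Algebra ℚ S]

/-- The elementary symmetric functions `e_n` determined by the power sums `P 1, P 2, …` through
Newton's identities `n e_n = ∑_{i=1}^n (-1)^{i-1} P_i e_{n-i}`; the value `P 0` plays no role. -/
def newtonE (P : ℕ → S) : ℕ → S
  | 0 => 1
  | n + 1 => ((n : ℚ) + 1)⁻¹ • ∑ i : Fin (n + 1), (-1) ^ (i : ℕ) * P (i + 1) * newtonE P (n - i)
decreasing_by omega

theorem newtonE_zero (P : ℕ → S) : newtonE P 0 = 1 := by rw [newtonE]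

theorem newtonE_succ (P : ℕ → S) (n : ℕ) : newtonE P (n + 1) =
    ((n : ℚ) + 1)⁻¹ • ∑ i : Fin (n + 1), (-1) ^ (i : ℕ) * P (i + 1) * newtonE P (n - i) := by
  rw [newtonE]

theorem newtonE_congr {P Q : ℕ → S} (n : ℕ) (h : ∀ k, 1 ≤ k → k ≤ n → P k = Q k) :
    newtonE P n = newtonE Q n := by
  induction n using Nat.strong_induction_on with
  | _ n ih =>
    cases n with
    | zero => simp only [newtonE_zero]
    | succ n =>
      rw [newtonE_succ, newtonE_succ]
      congr 1
      refine Finset.sum_congr rfl fun i _ => ?_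
      rw [h _ (by omega) (by omega), ih _ (by omega) fun k h1 h2 => h k h1 (by omega)]

theorem map_newtonE {T : Type*} [CommRing T] [Algebra ℚ T] (f : S →+* T) (P : ℕ → S) (n : ℕ) :
    f (newtonE P n) = newtonE (fun k => f (P k)) n := by
  induction n using Nat.strong_induction_on with
  | _ n ih =>
    cases n with
    | zero => simp only [newtonE_zero, map_one]
    | succ n =>
      rw [newtonE_succ, newtonE_succ, map_rat_smul, map_sum]
      congr 1
      refine Finset.sum_congr rfl fun i _ => ?_
      rw [map_mul, map_mul, ih _ (by omega), map_pow, map_neg, map_one]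

theorem newtonE_pow_mul (y : S) (P : ℕ → S) (n : ℕ) :
    newtonE (fun k => y ^ k * P k) n = y ^ n * newtonE P n := by
  induction n using Nat.strong_induction_on with
  | _ n ih =>
    cases n with
    | zero => simp only [newtonE_zero, pow_zero, mul_one]
    | succ n =>
      rw [newtonE_succ, newtonE_succ, mul_smul_comm, Finset.mul_sum]
      congr 1
      refine Finset.sum_congr rfl fun i _ => ?_
      have e : y ^ (n + 1) = y ^ ((i : ℕ) + 1) * y ^ (n - i) := by rw [← pow_add]; congr 1; omega
      rw [ih _ (by omega), e]
      ring

theorem newtonE_eq_of_recursion (P e : ℕ → S) (h0 : e 0 = 1)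
    (h : ∀ n : ℕ, ((n : ℚ) + 1) • e (n + 1) =
      ∑ i : Fin (n + 1), (-1) ^ (i : ℕ) * P (i + 1) * e (n - i)) (n : ℕ) :
    e n = newtonE P n := by
  induction n using Nat.strong_induction_on with
  | _ n ih =>
    cases n with
    | zero => rw [newtonE_zero, h0]
    | succ n =>
      have hn : ((n : ℚ) + 1) ≠ 0 := by positivity
      rw [newtonE_succ, ← inv_smul_smul₀ hn (e (n + 1)), h]
      congr 1
      refine Finset.sum_congr rfl fun i _ => ?_
      rw [ih _ (by omega)]

/-- The generating series `E(P) = ∑ e_n Xⁿ`. -/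
def newtonSeries (P : ℕ → S) : S⟦X⟧ := mk (newtonE P)

/-- The logarithmic derivative `∑ (-1)ⁿ P_{n+1} Xⁿ` of `newtonSeries P`. -/
def newtonLog (P : ℕ → S) : S⟦X⟧ := mk fun n => (-1) ^ n * P (n + 1)

/-- The series `E(P)` is characterized by `E(0) = 1` and `E' = L E`, where `L` is `newtonLog P`;
over `ℚ` this linear differential equation is the recursion defining `newtonE`. -/
theorem newtonSeries_unique (P : ℕ → S) (f : S⟦X⟧) (h0 : coeff 0 f = 1)
    (h : d⁄dX S f = newtonLog P * f) : f = newtonSeries P := by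
  ext n
  rw [newtonSeries, coeff_mk]
  refine newtonE_eq_of_recursion P (fun n => coeff n f) h0 (fun n => ?_) n
  have := congrArg (coeff n) h
  rw [PowerSeries.coeff_derivative, coeff_mul, Finset.Nat.sum_antidiagonal_eq_sum_range_succ
    (fun i j => coeff i (newtonLog P) * coeff j f), Finset.sum_range] at this
  simp only [newtonLog, coeff_mk] at this
  rw [← this, Algebra.smul_def, mul_comm]
  simp

theorem derivative_newtonSeries (P : ℕ → S) :
    d⁄dX S (newtonSeries P) = newtonLog P * newtonSeries P := by
  ext n
  rw [PowerSeries.coeff_derivative, coeff_mul, Finset.Nat.sum_antidiagonal_eq_sum_range_succ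
    (fun i j => coeff i (newtonLog P) * coeff j (newtonSeries P)), Finset.sum_range]
  simp only [newtonLog, newtonSeries, coeff_mk]
  have hn : ((n : ℚ) + 1) ≠ 0 := by positivity
  rw [newtonE_succ, mul_comm]
  have : ((n : S) + 1) = algebraMap ℚ S ((n : ℚ) + 1) := by simp
  rw [this, ← Algebra.smul_def, smul_inv_smul₀ hn]

theorem coeff_zero_newtonSeries (P : ℕ → S) : coeff 0 (newtonSeries P) = 1 := by
  rw [newtonSeries, coeff_mk, newtonE_zero]

theorem newtonSeries_add (P Q : ℕ → S) :
    newtonSeries (fun k => P k + Q k) = newtonSeries P * newtonSeries Q := by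
  symm
  apply newtonSeries_unique
  · have h1 := coeff_zero_newtonSeries P
    have h2 := coeff_zero_newtonSeries Q
    rw [coeff_zero_eq_constantCoeff_apply] at *
    rw [map_mul, h1, h2, one_mul]
  · have : newtonLog (fun k => P k + Q k) = newtonLog P + newtonLog Q := by
      ext n; simp [newtonLog, mul_add]
    rw [Derivation.leibniz, derivative_newtonSeries, derivative_newtonSeries, this]
    simp only [smul_eq_mul]
    ring

theorem newtonSeries_zero : newtonSeries (fun _ => (0 : S)) = 1 := by
  symm
  apply newtonSeries_unique
  · simp
  · have : newtonLog (fun _ => (0 : S)) = 0 := by ext n; simp [newtonLog]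
    rw [this]; simp

theorem newtonSeries_sum {ι : Type*} (s : Finset ι) (P : ι → ℕ → S) :
    newtonSeries (fun k => ∑ i ∈ s, P i k) = ∏ i ∈ s, newtonSeries (P i) := by
  classical
  induction s using Finset.induction_on with
  | empty => simpa using newtonSeries_zero
  | insert a s ha ih =>
    simp only [Finset.sum_insert ha, Finset.prod_insert ha]
    rw [newtonSeries_add, ih]

/-- For `P_k = (-1)^{k-1} y^k` the series `E(P)` is the geometric series. -/
theorem newtonE_geom (y : S) (P : ℕ → S) (hP : ∀ k, P (k + 1) = (-1) ^ k * y ^ (k + 1)) (n : ℕ) :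
    newtonE P n = y ^ n := by
  symm
  refine newtonE_eq_of_recursion P (fun n => y ^ n) (pow_zero y) (fun n => ?_) n
  have : ∀ i : Fin (n + 1), (-1) ^ (i : ℕ) * P (i + 1) * y ^ (n - i) = y ^ (n + 1) := by
    intro i
    have e : y ^ (n + 1) = y ^ ((i : ℕ) + 1) * y ^ (n - i) := by rw [← pow_add]; congr 1; omega
    rw [hP, e, ← mul_assoc, ← pow_add, ← two_mul, pow_mul]
    simp
  rw [Finset.sum_congr rfl fun i _ => this i]
  simp [Algebra.smul_def]

/-- Jacobi's formula for the derivative of a determinant. -/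
theorem derivation_det {T : Type*} [CommRing T] {K : Type*} [CommRing K] [Algebra K T]
    (d : Derivation K T T) {m : Type*} [Fintype m] [DecidableEq m] (M : Matrix m m T) :
    d M.det = (M.adjugate * M.map d).trace := by
  have hprod : ∀ (s : Finset m) (f : m → T),
      d (∏ i ∈ s, f i) = ∑ i ∈ s, (∏ j ∈ s.erase i, f j) * d (f i) := by
    intro s f
    induction s using Finset.induction_on with
    | empty => simp
    | insert a s ha ih =>
      rw [Finset.prod_insert ha, Derivation.leibniz, ih, Finset.sum_insert ha,
        Finset.erase_insert ha, smul_eq_mul, smul_eq_mul, add_comm, Finset.mul_sum]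
      congr 1
      refine Finset.sum_congr rfl fun i hi => ?_
      have : a ≠ i := fun h => ha (h ▸ hi)
      rw [Finset.erase_insert_of_ne this, Finset.prod_insert (by simp [ha]), mul_assoc]
  have h1 : (M.adjugate * M.map d).trace = ∑ i, (M.updateCol i fun k => d (M k i)).det := by
    simp only [Matrix.trace, Matrix.diag]
    refine Finset.sum_congr rfl fun i _ => ?_
    rw [← Matrix.cramer_apply, Matrix.cramer_eq_adjugate_mulVec]
    simp [Matrix.mul_apply, Matrix.mulVec, dotProduct]
  rw [h1, Matrix.det_apply', map_sum]
  simp only [Matrix.det_apply']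
  rw [Finset.sum_comm]
  refine Finset.sum_congr rfl fun σ _ => ?_
  rw [← zsmul_eq_mul, map_zsmul, hprod, zsmul_eq_mul, Finset.mul_sum]
  refine Finset.sum_congr rfl fun i _ => ?_
  congr 1
  rw [← Finset.mul_prod_erase _ _ (Finset.mem_univ i), mul_comm]
  congr 1
  · simp
  · refine Finset.prod_congr rfl fun j hj => ?_
    rw [Matrix.updateCol_ne (Finset.ne_of_mem_erase hj)]

/-- The characteristic series `det (1 + X M)`. -/
def detSeries {m : Type*} [Fintype m] [DecidableEq m] (M : Matrix m m S) : S⟦X⟧ :=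
  (1 + (X : S⟦X⟧) • M.map (C (R := S))).det

/-- For power sums that are traces of powers of a matrix, `E(P)` is the characteristic series: by
Jacobi's formula both satisfy the same differential equation. -/
theorem newtonSeries_trace {m : Type*} [Fintype m] [DecidableEq m] (M : Matrix m m S) :
    newtonSeries (fun k => (M ^ k).trace) = detSeries M := by
  symm
  apply newtonSeries_unique
  · rw [coeff_zero_eq_constantCoeff_apply, detSeries, RingHom.map_det]
    have : (constantCoeff (R := S)).mapMatrix (1 + (X : S⟦X⟧) • M.map (C (R := S))) = 1 := by
      ext i j
      by_cases h : i = j <;> simp [Matrix.one_apply, h]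
    rw [this, Matrix.det_one]
  · set N : Matrix m m S⟦X⟧ := 1 + (X : S⟦X⟧) • M.map (C (R := S)) with hN
    -- the inverse of `1 + X M` is the geometric series in `-X M`
    let G : Matrix m m S⟦X⟧ := Matrix.of fun i j => mk fun n => (-1) ^ n * (M ^ n) i j
    have hG : N * G = 1 := by
      ext i j n
      rw [hN, add_mul, one_mul, Matrix.smul_mul, Matrix.add_apply, Matrix.smul_apply,
        Matrix.mul_apply, map_add, smul_eq_mul]
      cases n with
      | zero =>
        rw [coeff_zero_X_mul]
        by_cases h : i = j <;> simp [G, Matrix.one_apply, h]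
      | succ n =>
        rw [coeff_succ_X_mul, map_sum]
        have : (coeff (n + 1)) ((1 : Matrix m m S⟦X⟧) i j) = 0 := by
          by_cases h : i = j <;> simp [Matrix.one_apply, h, coeff_one]
        rw [this]
        simp only [G, Matrix.of_apply, coeff_mk, Matrix.map_apply, coeff_C_mul]
        rw [pow_succ' M, Matrix.mul_apply, Finset.mul_sum, ← Finset.sum_add_distrib]
        refine Finset.sum_eq_zero fun k _ => ?_
        ring
    have hadj : N.adjugate = N.det • G := by
      calc N.adjugate = N.adjugate * (N * G) := by rw [hG, mul_one]
        _ = N.det • G := by rw [← mul_assoc, Matrix.adjugate_mul, Matrix.smul_mul, one_mul]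
    have hd : N.map (d⁄dX S) = M.map (C (R := S)) := by
      ext1 i j
      simp only [Matrix.map_apply, hN, Matrix.add_apply, Matrix.smul_apply, smul_eq_mul, map_add,
        Derivation.leibniz, derivative_X, derivative_C]
      by_cases h : i = j <;> simp [Matrix.one_apply, h]
    have hL : newtonLog (fun k => (M ^ k).trace) = (G * M.map (C (R := S))).trace := by
      ext n
      simp only [newtonLog, coeff_mk, Matrix.trace, Matrix.diag, map_sum, Finset.mul_sum,
        Matrix.mul_apply]
      refine Finset.sum_congr rfl fun i _ => ?_
      rw [pow_succ, Matrix.mul_apply, Finset.mul_sum]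
      refine Finset.sum_congr rfl fun j _ => ?_
      simp [G, mul_assoc]
    change d⁄dX S N.det = _ * N.det
    rw [derivation_det, hadj, hd, hL, Matrix.smul_mul, Matrix.trace_smul, smul_eq_mul, mul_comm]

end Newton

/-! ### Class functions on symmetric groups that are multiplicative on block sums -/

section Cycles

open Equiv

/-- The permutation of `m + n` letters acting as `σ` on the first `m` and as `τ` on the last `n`. -/
def blockSum {m n : ℕ} (σ : Perm (Fin m)) (τ : Perm (Fin n)) : Perm (Fin (m + n)) :=
  finSumFinEquiv.permCongr (Equiv.sumCongr σ τ)

@[simp] theorem blockSum_castAdd {m n : ℕ} (σ : Perm (Fin m)) (τ : Perm (Fin n)) (i : Fin m) :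
    blockSum σ τ (Fin.castAdd n i) = Fin.castAdd n (σ i) := by
  simp [blockSum, Equiv.permCongr_apply]

@[simp] theorem blockSum_natAdd {m n : ℕ} (σ : Perm (Fin m)) (τ : Perm (Fin n)) (i : Fin n) :
    blockSum σ τ (Fin.natAdd m i) = Fin.natAdd m (τ i) := by
  simp [blockSum, Equiv.permCongr_apply]

theorem castAdd_notMem_range_natAdd {m n : ℕ} (i : Fin m) :
    Fin.castAdd n i ∉ Set.range (Fin.natAddEmb m : Fin n ↪ Fin (m + n)) := by
  rintro ⟨j, hj⟩
  have := congrArg Fin.val hj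
  simp at this
  omega

theorem natAdd_notMem_range_castAdd {m n : ℕ} (i : Fin n) :
    Fin.natAdd m i ∉ Set.range (Fin.castAddEmb n : Fin m ↪ Fin (m + n)) := by
  rintro ⟨j, hj⟩
  have := congrArg Fin.val hj
  simp at this
  omega

theorem cycleType_viaEmbedding {m n : ℕ} (σ : Perm (Fin m)) (e : Fin m ↪ Fin n) :
    (σ.viaEmbedding e).cycleType = σ.cycleType :=
  @Perm.cycleType_extendDomain _ _ _ _ _ _ _ (fun _ => Classical.propDecidable _)
    (Equiv.ofInjective e e.injective) σ

theorem cycleType_blockSum {m n : ℕ} (σ : Perm (Fin m)) (τ : Perm (Fin n)) :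
    (blockSum σ τ).cycleType = σ.cycleType + τ.cycleType := by
  have h1 : blockSum σ τ =
      σ.viaEmbedding (Fin.castAddEmb n) * τ.viaEmbedding (Fin.natAddEmb m) := by
    ext1 i
    refine Fin.addCases (fun i => ?_) (fun i => ?_) i
    · rw [Perm.mul_apply, Perm.viaEmbedding_apply_of_notMem _ _ _ (castAdd_notMem_range_natAdd i),
        blockSum_castAdd]
      exact (Perm.viaEmbedding_apply σ (Fin.castAddEmb n) i).symm
    · have h2 : τ.viaEmbedding (Fin.natAddEmb m) (Fin.natAdd m i) = Fin.natAdd m (τ i) :=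
        Perm.viaEmbedding_apply τ (Fin.natAddEmb m) i
      rw [Perm.mul_apply, h2, Perm.viaEmbedding_apply_of_notMem _ _ _
        (natAdd_notMem_range_castAdd _), blockSum_natAdd]
  have hd : Perm.Disjoint (σ.viaEmbedding (Fin.castAddEmb n))
      (τ.viaEmbedding (Fin.natAddEmb m)) := by
    intro i
    refine Fin.addCases (fun i => Or.inr ?_) (fun i => Or.inl ?_) i
    · exact Perm.viaEmbedding_apply_of_notMem _ _ _ (castAdd_notMem_range_natAdd i)
    · exact Perm.viaEmbedding_apply_of_notMem _ _ _ (natAdd_notMem_range_castAdd i)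
  rw [h1, hd.cycleType_mul]
  congr 1
  · exact cycleType_viaEmbedding _ _
  · exact cycleType_viaEmbedding _ _

/-- The block sum of the inverse rotations of the given lengths. -/
def rotations : (l : List ℕ) → Perm (Fin l.sum)
  | [] => 1
  | k :: l => blockSum (finRotate k)⁻¹ (rotations l)

theorem cycleType_rotations (l : List ℕ) :
    (rotations l).cycleType = (l : Multiset ℕ).filter fun n => 2 ≤ n := by
  induction l with
  | nil => exact Perm.cycleType_one
  | cons k l ih =>
    have e := cycleType_blockSum (finRotate k)⁻¹ (rotations l)
    rw [ih, Perm.cycleType_inv] at e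
    refine e.trans ?_
    rw [← Multiset.cons_coe]
    by_cases hk : 2 ≤ k
    · rw [cycleType_finRotate_of_le hk, Multiset.filter_cons_of_pos _ hk, Multiset.singleton_add]
    · rw [Multiset.filter_cons_of_neg _ hk]
      have : finRotate k = 1 := by
        obtain rfl | rfl : k = 0 ∨ k = 1 := by omega
        · rfl
        · exact Subsingleton.elim _ _
      rw [this, Perm.cycleType_one, zero_add]

variable {S : Type*} [CommRing S]

/-- The product `∏ P k` over the lengths `k` of all cycles (fixed points included) of `σ`. -/
def cyc (P : ℕ → S) {n : ℕ} (σ : Perm (Fin n)) : S := (σ.partition.parts.map P).prod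

theorem cyc_congr {P Q : ℕ → S} {n : ℕ} (σ : Perm (Fin n))
    (h : ∀ k, 1 ≤ k → k ≤ n → P k = Q k) : cyc P σ = cyc Q σ := by
  unfold cyc
  congr 1
  refine Multiset.map_congr rfl fun k hk => h k (σ.partition.parts_pos hk) ?_
  calc k ≤ σ.partition.parts.sum := Multiset.single_le_sum (fun _ _ => Nat.zero_le _) _ hk
    _ = n := σ.partition.parts_sum.trans (Fintype.card_fin n)

theorem cyc_mul (P Q : ℕ → S) {n : ℕ} (σ : Perm (Fin n)) :
    cyc (fun k => P k * Q k) σ = cyc P σ * cyc Q σ := Multiset.prod_map_mul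

theorem map_cyc {T : Type*} [CommRing T] (f : S →+* T) (P : ℕ → S) {n : ℕ} (σ : Perm (Fin n)) :
    f (cyc P σ) = cyc (fun k => f (P k)) σ := by
  rw [cyc, cyc, map_multiset_prod, Multiset.map_map]
  rfl

theorem cyc_conj (P : ℕ → S) {n : ℕ} (σ τ : Perm (Fin n)) : cyc P (τ * σ * τ⁻¹) = cyc P σ := by
  have h : IsConj σ (τ * σ * τ⁻¹) := isConj_iff.2 ⟨τ, rfl⟩
  rw [cyc, cyc, Perm.partition_eq_of_isConj.1 h]

/-- The sign of a permutation as a product over its cycles. -/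
theorem cyc_neg_one_pow {n : ℕ} (σ : Perm (Fin n)) :
    cyc (fun k => (-1 : S) ^ (k + 1)) σ = ((Perm.sign σ : ℤ) : S) := by
  have h : ∀ s : Multiset ℕ,
      (s.map fun k => (-1 : S) ^ (k + 1)).prod = (-1) ^ (s.sum + s.card) := by
    intro s
    induction s using Multiset.induction_on with
    | empty => simp
    | cons a s ih => rw [Multiset.map_cons, Multiset.prod_cons, ih]; simp; ring
  rw [cyc, Perm.parts_partition, Multiset.map_add, Multiset.prod_add, Multiset.map_replicate, h,
    Perm.sign_of_cycleType]
  simp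

/-- A function on symmetric groups that is constant on conjugacy classes and multiplicative on
block sums is the product over the cycles of its values on rotations. -/
theorem eq_cyc (φ : ∀ n, Perm (Fin n) → S) (hconj : ∀ n σ τ, φ n (τ * σ * τ⁻¹) = φ n σ)
    (hmul : ∀ m n (σ : Perm (Fin m)) (τ : Perm (Fin n)),
      φ (m + n) (blockSum σ τ) = φ m σ * φ n τ) (h1 : φ 0 1 = 1) {n : ℕ} (σ : Perm (Fin n)) :
    φ n σ = cyc (fun k => φ k (finRotate k)⁻¹) σ := by
  have hstd : ∀ l : List ℕ, φ l.sum (rotations l) = (l.map fun k => φ k (finRotate k)⁻¹).prod := by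
    intro l
    induction l with
    | nil => exact h1
    | cons k l ih =>
      rw [List.map_cons, List.prod_cons, ← ih]
      exact hmul k l.sum _ _
  have key : ∀ (l : List ℕ) (n : ℕ) (_ : l.sum = n) (σ : Perm (Fin n)),
      σ.partition.parts = l → φ n σ = (l.map fun k => φ k (finRotate k)⁻¹).prod := by
    rintro l _ rfl σ hσ
    have hc : IsConj (rotations l) σ := by
      rw [Perm.isConj_iff_cycleType_eq, cycleType_rotations, ← hσ,
        Perm.filter_parts_partition_eq_cycleType]
    obtain ⟨τ, hτ⟩ := isConj_iff.1 hc
    rw [← hτ, hconj, hstd]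
  have hs : σ.partition.parts.toList.sum = n := by
    rw [Multiset.sum_toList, σ.partition.parts_sum, Fintype.card_fin]
  rw [key _ n hs σ (Multiset.coe_toList _).symm, cyc, ← Multiset.prod_coe, ← Multiset.map_coe,
    Multiset.coe_toList]

/-- The sum of the monomials of the words fixed by `σ` is the product of power sums given by the
cycle type of `σ`, because such a word is constant on each cycle. -/
theorem sum_fixed_words {ι : Type*} [Fintype ι] [DecidableEq ι] (x : ι → S) {n : ℕ}
    (σ : Perm (Fin n)) :
    (∑ f : Fin n → ι, if f ∘ σ = f then ∏ i, x (f i) else 0) = cyc (fun k => ∑ i, x i ^ k) σ := by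
  rw [eq_cyc (fun n (σ : Perm (Fin n)) => ∑ f : Fin n → ι, if f ∘ σ = f then ∏ i, x (f i) else 0)]
  · refine cyc_congr _ fun k hk _ => ?_
    obtain ⟨k, rfl⟩ : ∃ m, k = m + 1 := ⟨k - 1, by omega⟩
    rw [← Finset.sum_filter]
    symm
    refine Finset.sum_bij (fun i _ => fun _ => i) ?_ ?_ ?_ ?_
    · intro i _
      simp only [Finset.mem_filter, Finset.mem_univ, true_and]
      rfl
    · intro i _ j _ h
      exact congrFun h 0
    · intro f hf
      simp only [Finset.mem_filter, Finset.mem_univ, true_and] at hf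
      refine ⟨f 0, Finset.mem_univ _, ?_⟩
      have hstep : ∀ i, f (finRotate (k + 1) i) = f i := by
        intro i
        have := congrFun hf (finRotate (k + 1) i)
        simpa using this.symm
      funext i
      induction i using Fin.induction with
      | zero => rfl
      | succ i ih =>
        rw [ih, ← hstep i.castSucc]
        congr 1
        rw [finRotate_apply, Fin.coeSucc_eq_succ]
    · intro i _
      simp
  · intro n σ τ
    refine Fintype.sum_equiv (Equiv.arrowCongr τ.symm (Equiv.refl ι)) _ _ fun f => ?_
    have hf : Equiv.arrowCongr τ.symm (Equiv.refl ι) f = f ∘ τ := by ext; simp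
    rw [hf]
    have h1 : f ∘ ⇑(τ * σ * τ⁻¹) = f ↔ (f ∘ τ) ∘ σ = f ∘ τ := by
      constructor
      · intro h
        funext i
        have := congrFun h (τ i)
        simpa using this
      · intro h
        funext i
        have := congrFun h (τ⁻¹ i)
        simpa using this
    simp only [h1]
    congr 1
    exact (Equiv.prod_comp τ (fun i => x (f i))).symm
  · intro m n σ τ
    rw [Fintype.sum_mul_sum, ← Fintype.sum_prod_type']
    refine (Fintype.sum_equiv (Fin.appendEquiv m n) _ _ fun f => ?_).symm
    obtain ⟨f, g⟩ := f
    have h1 : Fin.append f g ∘ blockSum σ τ = Fin.append f g ↔ f ∘ σ = f ∧ g ∘ τ = g := by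
      constructor
      · intro h
        constructor
        · funext i
          simpa using congrFun h (Fin.castAdd n i)
        · funext i
          simpa using congrFun h (Fin.natAdd m i)
      · rintro ⟨h, h'⟩
        funext i
        refine Fin.addCases (fun i => ?_) (fun i => ?_) i
        · simpa using congrFun h i
        · simpa using congrFun h' i
    simp only [Fin.appendEquiv, Equiv.coe_fn_mk, h1, Fin.prod_univ_add, Fin.append_left,
      Fin.append_right]
    by_cases ha : f ∘ σ = f <;> by_cases hb : g ∘ τ = g <;> simp [ha, hb]
  · simp

/-- The sum of the signs of the permutations fixing a word is `0` if the word has a repeated letter,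
whose transposition cancels the terms in pairs, and `1` otherwise. -/
theorem sum_sign_fixing {ι : Type*} [DecidableEq ι] {n : ℕ} (f : Fin n → ι) :
    (∑ σ : Perm (Fin n), if f ∘ σ = f then (Perm.sign σ : ℤ) else 0) =
      if Function.Injective f then 1 else 0 := by
  split_ifs with hf
  · rw [Finset.sum_eq_single 1]
    · simp
    · intro σ _ hσ
      rw [if_neg]
      intro h
      exact hσ (Equiv.ext fun i => hf (congrFun h i))
    · simp
  · obtain ⟨a, b, hab, hne⟩ : ∃ a b, f a = f b ∧ a ≠ b := by
      simpa [Function.Injective] using hf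
    have hs : f ∘ swap a b = f := by
      funext i
      rw [Function.comp_apply, swap_apply_def]
      split_ifs with h1 h2
      · rw [h1, hab]
      · rw [h2, hab]
      · rfl
    have h := Fintype.sum_equiv (Equiv.mulLeft (swap a b))
      (fun σ : Perm (Fin n) => if f ∘ σ = f then (Perm.sign σ : ℤ) else 0)
      (fun σ : Perm (Fin n) => -if f ∘ σ = f then (Perm.sign σ : ℤ) else 0) (fun σ => by
        have : f ∘ ⇑(swap a b * σ) = f ∘ σ := by
          rw [Perm.coe_mul, ← Function.comp_assoc, hs]
        simp only [Equiv.coe_mulLeft, this, Perm.sign_mul, Perm.sign_swap hne]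
        split_ifs <;> simp)
    rw [Finset.sum_neg_distrib] at h
    linarith

open MvPolynomial in
/-- Newton's identities: for the power sums of finitely many variables `newtonE` gives the
elementary symmetric polynomials. -/
theorem esymm_eq_newtonE {σ : Type*} [Fintype σ] (k : ℕ) :
    esymm σ ℚ k = newtonE (psum σ ℚ) k := by
  refine newtonE_eq_of_recursion _ _ (esymm_zero σ ℚ) (fun n => ?_) k
  have h := mul_esymm_eq_sum σ ℚ (n + 1)
  have e : ((n : ℚ) + 1) • esymm σ ℚ (n + 1) = ((n + 1 : ℕ) : MvPolynomial σ ℚ) *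
      esymm σ ℚ (n + 1) := by
    rw [MvPolynomial.smul_eq_C_mul]; simp
  rw [e, h, Finset.sum_filter, Finset.Nat.sum_antidiagonal_eq_sum_range_succ_mk,
    Finset.sum_range_succ, if_neg (by simp), add_zero, ← Finset.sum_range_reflect, Finset.mul_sum,
    Finset.sum_range]
  refine Finset.sum_congr rfl fun i _ => ?_
  have hi : n + 1 - 1 - (i : ℕ) = n - i := by omega
  rw [hi, if_pos (by simp only; omega)]
  simp only
  rw [show n + 1 - (n - (i : ℕ)) = i + 1 by omega]
  have hs : (-1 : MvPolynomial σ ℚ) ^ (n + 1 + 1) * (-1) ^ (n - (i : ℕ)) = (-1) ^ (i : ℕ) := by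
    rw [← pow_add, show n + 1 + 1 + (n - (i : ℕ)) = 2 * (n - i + 1) + i by omega, pow_add, pow_mul]
    simp
  rw [← hs]
  ring

open MvPolynomial in
/-- The special case of `sum_sign_cyc` for the power sums of `n` variables: expanding them over
words, only the `n!` words with distinct letters contribute, each with the monomial `e_n`. -/
theorem sum_sign_cyc_psum (n : ℕ) :
    ∑ σ : Perm (Fin n), (Perm.sign σ : ℤ) • cyc (psum (Fin n) ℚ) σ =
      (n.factorial : ℕ) • esymm (Fin n) ℚ n := by
  have h : ∀ σ : Perm (Fin n), cyc (psum (Fin n) ℚ) σ =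
      ∑ f : Fin n → Fin n, if f ∘ σ = f then ∏ i, (X (f i) : MvPolynomial (Fin n) ℚ) else 0 :=
    fun σ => by rw [sum_fixed_words]; rfl
  have h2 : ∑ σ : Perm (Fin n), (Perm.sign σ : ℤ) • cyc (psum (Fin n) ℚ) σ =
      ∑ f : Fin n → Fin n, (∑ σ : Perm (Fin n), if f ∘ σ = f then (Perm.sign σ : ℤ) else 0) •
        ∏ i, (X (f i) : MvPolynomial (Fin n) ℚ) := by
    simp only [h, Finset.smul_sum, Finset.sum_smul]
    rw [Finset.sum_comm]
    refine Finset.sum_congr rfl fun f _ => Finset.sum_congr rfl fun σ _ => ?_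
    split_ifs <;> simp
  have he : esymm (Fin n) ℚ n = ∏ i, (X i : MvPolynomial (Fin n) ℚ) := by
    have : Finset.powersetCard n (Finset.univ : Finset (Fin n)) = {Finset.univ} := by
      have h := Finset.powersetCard_self (Finset.univ : Finset (Fin n))
      rwa [Finset.card_fin] at h
    rw [esymm, this, Finset.sum_singleton]
  rw [h2, he]
  simp only [sum_sign_fixing, ite_smul, one_smul, zero_smul]
  rw [← Finset.sum_filter]
  have h3 : ∀ f ∈ Finset.univ.filter fun f : Fin n → Fin n => Function.Injective f,
      ∏ i, (X (f i) : MvPolynomial (Fin n) ℚ) = ∏ i, X i := by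
    intro f hf
    have hf' : Function.Bijective f :=
      Finite.injective_iff_bijective.1 (Finset.mem_filter.1 hf).2
    exact hf'.prod_comp (fun i => (X i : MvPolynomial (Fin n) ℚ))
  rw [Finset.sum_congr rfl h3, Finset.sum_const]
  congr 1
  have : (Finset.univ.filter fun f : Fin n → Fin n => Function.Injective f).card =
      Fintype.card (Fin n ↪ Fin n) := by
    rw [← Fintype.card_subtype]
    exact Fintype.card_congr (Equiv.subtypeInjectiveEquivEmbedding _ _)
  rw [this, Fintype.card_embedding_eq, Fintype.card_fin, Nat.descFactorial_self]

/-- Newton's identities determine the power sums from the elementary symmetric functions. -/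
theorem eq_of_newtonE_eq [Algebra ℚ S] {P Q : ℕ → S} {n : ℕ}
    (h : ∀ k ≤ n, newtonE P k = newtonE Q k) (k : ℕ) (h1 : 1 ≤ k) (hk : k ≤ n) : P k = Q k := by
  induction k using Nat.strong_induction_on with
  | _ k ih =>
    obtain ⟨k, rfl⟩ : ∃ m, k = m + 1 := ⟨k - 1, by omega⟩
    have hk0 : ((k : ℚ) + 1) ≠ 0 := by positivity
    have h' := congrArg (((k : ℚ) + 1) • ·) (h (k + 1) hk)
    simp only [newtonE_succ, smul_inv_smul₀ hk0] at h'
    rw [Fin.sum_univ_castSucc, Fin.sum_univ_castSucc] at h'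
    have hlt : ∀ i : Fin k, (-1 : S) ^ ((Fin.castSucc i : Fin (k + 1)) : ℕ) *
          P ((Fin.castSucc i : Fin (k + 1)) + 1) *
          newtonE P (k - (Fin.castSucc i : Fin (k + 1))) =
        (-1 : S) ^ ((Fin.castSucc i : Fin (k + 1)) : ℕ) *
          Q ((Fin.castSucc i : Fin (k + 1)) + 1) *
          newtonE Q (k - (Fin.castSucc i : Fin (k + 1))) := by
      intro i
      rw [ih _ (by simp) (by simp) (by simp; omega), h _ (by omega)]
    rw [Finset.sum_congr rfl fun i _ => hlt i] at h'
    have h'' := add_left_cancel h'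
    simp only [Fin.val_last, Nat.sub_self, newtonE_zero, mul_one] at h''
    exact ((isUnit_one.neg).pow k).mul_left_cancel h''

open MvPolynomial in
/-- Any sequence is the specialization of the power sums of `n` variables in degrees `1, …, n`,
since the elementary symmetric polynomials are algebraically independent. -/
theorem exists_specialization [Algebra ℚ S] (P : ℕ → S) (n : ℕ) :
    ∃ φ : symmetricSubalgebra (Fin n) ℚ →+* S,
      (∀ k, 1 ≤ k → k ≤ n → φ ⟨psum (Fin n) ℚ k, psum_isSymmetric _ _ _⟩ = P k) ∧
      φ ⟨esymm (Fin n) ℚ n, esymm_isSymmetric _ _ _⟩ = newtonE P n := by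
  let φ : symmetricSubalgebra (Fin n) ℚ →ₐ[ℚ] S :=
    (aeval fun i : Fin n => newtonE P (i + 1)).comp
      (esymmAlgEquiv (Fin n) ℚ (Fintype.card_fin n)).symm.toAlgHom
  let ps : ℕ → symmetricSubalgebra (Fin n) ℚ := fun k => ⟨psum (Fin n) ℚ k, psum_isSymmetric _ _ _⟩
  have hval : ∀ k, newtonE ps k = ⟨esymm (Fin n) ℚ k, esymm_isSymmetric _ _ _⟩ := by
    intro k
    apply Subtype.ext
    refine (map_newtonE (symmetricSubalgebra (Fin n) ℚ).val.toRingHom ps k).trans ?_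
    exact (esymm_eq_newtonE (σ := Fin n) k).symm
  have he : ∀ k, k ≤ n → φ (newtonE ps k) = newtonE P k := by
    intro k hk
    cases k with
    | zero => rw [newtonE_zero, newtonE_zero, map_one]
    | succ k =>
      have := esymmAlgEquiv_symm_apply (σ := Fin n) ℚ (Fintype.card_fin n) ⟨k, hk⟩
      rw [hval]
      change aeval _ ((esymmAlgEquiv (Fin n) ℚ (Fintype.card_fin n)).symm _) = _
      rw [this, aeval_X]
  refine ⟨φ.toRingHom, fun k h1 hk => ?_, ?_⟩
  · exact eq_of_newtonE_eq (P := fun k => φ.toRingHom (ps k))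
      (fun k hk => (map_newtonE φ.toRingHom ps k).symm.trans (he k hk)) k h1 hk
  · rw [← he n le_rfl, hval]
    rfl

open MvPolynomial in
/-- The cycle index of the sign character: `∑ sgn(σ) ∏ P_{lengths of the cycles} = n! e_n`. -/
theorem sum_sign_cyc [Algebra ℚ S] (P : ℕ → S) (n : ℕ) :
    ∑ σ : Perm (Fin n), (Perm.sign σ : ℤ) • cyc P σ = (n.factorial : ℕ) • newtonE P n := by
  obtain ⟨φ, hφ, he⟩ := exists_specialization P n
  set ps : ℕ → symmetricSubalgebra (Fin n) ℚ :=
    fun k => ⟨psum (Fin n) ℚ k, psum_isSymmetric _ _ _⟩ with hps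
  have hmain : ∑ σ : Perm (Fin n), (Perm.sign σ : ℤ) • cyc ps σ =
      (n.factorial : ℕ) • (⟨esymm (Fin n) ℚ n, esymm_isSymmetric _ _ _⟩ :
        symmetricSubalgebra (Fin n) ℚ) := by
    have hinj : Function.Injective (symmetricSubalgebra (Fin n) ℚ).val.toRingHom :=
      Subtype.val_injective
    apply hinj
    rw [map_sum, map_nsmul]
    refine Eq.trans (Finset.sum_congr rfl fun σ _ => ?_) (sum_sign_cyc_psum n)
    rw [map_zsmul, map_cyc]
    rfl
  have h := congrArg φ hmain
  rw [map_sum, map_nsmul, he] at h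
  rw [← h]
  refine Finset.sum_congr rfl fun σ _ => ?_
  rw [map_zsmul, map_cyc]
  congr 1
  exact cyc_congr σ fun k h1 h2 => (hφ k h1 h2).symm

end Cycles

/-! ### The Frobenius characters of rectangular shape -/

section Frobenius

open Equiv

variable {S : Type*} [CommRing S]

/-- The extension by zero of a sequence to negative indices. -/
def zeroExtend (e : ℕ → S) : ℤ → S
  | Int.ofNat k => e k
  | Int.negSucc _ => 0

theorem zeroExtend_natCast (e : ℕ → S) (k : ℕ) : zeroExtend e k = e k := rfl

theorem zeroExtend_of_neg (e : ℕ → S) {k : ℤ} (hk : k < 0) : zeroExtend e k = 0 := by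
  cases k with
  | ofNat k => exact absurd hk (by simp)
  | negSucc k => rfl

theorem map_zeroExtend {T : Type*} [CommRing T] (f : S →+* T) (e : ℕ → S) (k : ℤ) :
    f (zeroExtend e k) = zeroExtend (fun n => f (e n)) k := by
  cases k with
  | ofNat k => rfl
  | negSucc k => exact map_zero f

/-- The number of occurrences of the letter `i` in the word `f`. -/
def content {N s : ℕ} (f : Fin N → Fin s) (i : Fin s) : ℕ :=
  (Finset.univ.filter fun a => f a = i).card

theorem content_comp {N s : ℕ} (f : Fin N → Fin s) (τ : Perm (Fin N)) :
    content (f ∘ τ) = content f := by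
  funext i
  refine Finset.card_bij (fun a _ => τ a) ?_ ?_ ?_
  · intro a ha
    simpa using ha
  · intro a _ b _ h
    exact τ.injective h
  · intro b hb
    exact ⟨τ⁻¹ b, by simpa using hb, by simp⟩

open MvPolynomial in
theorem prod_X_word {N s : ℕ} (f : Fin N → Fin s) :
    ∏ a, (X (f a) : MvPolynomial (Fin s) S) =
      monomial (Finsupp.equivFunOnFinite.symm (content f)) 1 := by
  rw [monomial_eq, Finsupp.prod_fintype _ _ (by simp), C_1, one_mul,
    ← Finset.prod_fiberwise' Finset.univ f (fun i => (X i : MvPolynomial (Fin s) S))]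
  refine Finset.prod_congr rfl fun i _ => ?_
  rw [Finset.prod_const]
  rfl

/-- The number of words of content `ν` fixed by `σ`. -/
def fixedCount {N s : ℕ} (σ : Perm (Fin N)) (ν : Fin s → ℕ) : ℕ :=
  (Finset.univ.filter fun f : Fin N → Fin s => f ∘ σ = f ∧ content f = ν).card

open MvPolynomial in
theorem coeff_sum_fixed_words {N s : ℕ} (σ : Perm (Fin N)) (ν : Fin s → ℕ) :
    coeff (Finsupp.equivFunOnFinite.symm ν)
      (∑ f : Fin N → Fin s, if f ∘ σ = f then ∏ a, (X (f a) : MvPolynomial (Fin s) S) else 0) =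
      fixedCount σ ν := by
  rw [coeff_sum, fixedCount, Finset.card_filter, Nat.cast_sum]
  refine Finset.sum_congr rfl fun f _ => ?_
  by_cases h : f ∘ σ = f
  · simp only [h, if_true, true_and, prod_X_word, coeff_monomial,
      EmbeddingLike.apply_eq_iff_eq, Nat.cast_ite, Nat.cast_one, Nat.cast_zero]
  · simp [h]

open MvPolynomial PowerSeries in
/-- The character of the symmetric group induced from the sign character of a Young subgroup
corresponds to the product of elementary symmetric functions. -/
theorem sum_sign_cyc_fixedCount [Algebra ℚ S] (P : ℕ → S) {N s : ℕ} (ν : Fin s → ℕ)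
    (hν : ∑ i, ν i = N) :
    ∑ σ : Perm (Fin N), (Perm.sign σ : ℤ) • (cyc P σ * fixedCount σ ν) =
      N.factorial • ∏ i, newtonE P (ν i) := by
  have h := sum_sign_cyc (fun k => (MvPolynomial.C (P k) : MvPolynomial (Fin s) S) *
    ∑ i, MvPolynomial.X i ^ k) N
  have h' := congrArg (MvPolynomial.coeff (Finsupp.equivFunOnFinite.symm ν)) h
  rw [MvPolynomial.coeff_sum] at h'
  have hl : ∀ σ : Perm (Fin N), MvPolynomial.coeff (Finsupp.equivFunOnFinite.symm ν)
      ((Perm.sign σ : ℤ) • cyc (fun k => (MvPolynomial.C (P k) : MvPolynomial (Fin s) S) *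
        ∑ i, MvPolynomial.X i ^ k) σ) = (Perm.sign σ : ℤ) • (cyc P σ * fixedCount σ ν) := by
    intro σ
    rw [cyc_mul, ← map_cyc (MvPolynomial.C (R := S) (σ := Fin s)), ← sum_fixed_words,
      MvPolynomial.coeff_smul, MvPolynomial.coeff_C_mul, coeff_sum_fixed_words]
  rw [Finset.sum_congr rfl fun σ _ => hl σ] at h'
  rw [h', MvPolynomial.coeff_smul]
  congr 1
  have e1 : (fun k => (MvPolynomial.C (P k) : MvPolynomial (Fin s) S) *
      ∑ i, MvPolynomial.X i ^ k) =
      fun k => ∑ i, MvPolynomial.X i ^ k * MvPolynomial.C (P k) := by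
    funext k
    rw [Finset.mul_sum]
    exact Finset.sum_congr rfl fun i _ => mul_comm _ _
  have e2 : ∀ Q : ℕ → MvPolynomial (Fin s) S,
      newtonE Q N = PowerSeries.coeff N (newtonSeries Q) := fun Q => by
    rw [newtonSeries, PowerSeries.coeff_mk]
  rw [e1, e2, newtonSeries_sum, PowerSeries.coeff_prod, MvPolynomial.coeff_sum]
  have e3 : ∀ l : Fin s →₀ ℕ, ∏ i, PowerSeries.coeff (l i) (newtonSeries fun k =>
      (MvPolynomial.X i : MvPolynomial (Fin s) S) ^ k * MvPolynomial.C (P k)) =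
      MvPolynomial.monomial l (∏ i, newtonE P (l i)) := by
    intro l
    rw [MvPolynomial.monomial_eq, Finsupp.prod_fintype _ _ (by simp), map_prod,
      ← Finset.prod_mul_distrib]
    refine Finset.prod_congr rfl fun i _ => ?_
    rw [newtonSeries, PowerSeries.coeff_mk, newtonE_pow_mul, ← map_newtonE, mul_comm]
  simp only [e3, MvPolynomial.coeff_monomial]
  rw [Finset.sum_eq_single (Finsupp.equivFunOnFinite.symm ν)]
  · simp
  · intro l _ hl
    rw [if_neg hl]
  · intro hl
    exact absurd (by simp [Finset.mem_finsuppAntidiag, hν]) hl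

/-- The Frobenius formula for the character of the irreducible representation of the symmetric
group whose Young diagram has `r` rows and `s` columns: up to the sign of `σ` it is the coefficient
of `∏ x_i^{r+i}` in the product of the Vandermonde determinant of `x_0, …, x_{s-1}` and the power
sum corresponding to the cycle type of `σ`. -/
def frob (r s : ℕ) {N : ℕ} (σ : Perm (Fin N)) : ℤ :=
  Perm.sign σ * ∑ w : Perm (Fin s), (Perm.sign w : ℤ) *
    (Finset.univ.filter fun f : Fin N → Fin s =>
      f ∘ σ = f ∧ ∀ i, content f i + (w i : ℕ) = r + i).card

theorem frob_conj (r s : ℕ) {N : ℕ} (σ τ : Perm (Fin N)) :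
    frob r s (τ * σ * τ⁻¹) = frob r s σ := by
  have hs : Perm.sign (τ * σ * τ⁻¹) = Perm.sign σ := by
    rw [map_mul, map_mul, map_inv, mul_right_comm, mul_inv_cancel, one_mul]
  rw [frob, frob, hs]
  congr 1
  refine Finset.sum_congr rfl fun w _ => ?_
  congr 2
  refine Finset.card_bij (fun f _ => f ∘ τ) ?_ ?_ ?_
  · intro f hf
    simp only [Finset.mem_filter, Finset.mem_univ, true_and, content_comp] at hf ⊢
    refine ⟨?_, hf.2⟩
    funext i
    have := congrFun hf.1 (τ i)
    simpa using this
  · intro f _ g _ h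
    funext i
    have := congrFun h (τ⁻¹ i)
    simpa using this
  · intro f hf
    simp only [Finset.mem_filter, Finset.mem_univ, true_and] at hf
    refine ⟨f ∘ ⇑τ⁻¹, ?_, ?_⟩
    · simp only [Finset.mem_filter, Finset.mem_univ, true_and, content_comp]
      refine ⟨?_, hf.2⟩
      funext i
      have := congrFun hf.1 (τ⁻¹ i)
      simpa using this
    · funext i
      simp

/-- The Jacobi–Trudi matrix of the rectangular diagram with `r` rows and `s` columns. -/
def jacobiTrudi (e : ℕ → S) (r s : ℕ) : Matrix (Fin s) (Fin s) S :=
  Matrix.of fun i j => zeroExtend e ((r : ℤ) + i - j)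

/-- The Frobenius character corresponds to the Jacobi–Trudi determinant. The sum over `w` in the
definition of `frob` becomes the expansion of the determinant, by `sum_sign_cyc_fixedCount` for each
`w`. -/
theorem sum_frob_cyc [Algebra ℚ S] (P : ℕ → S) (r s : ℕ) :
    ∑ σ : Perm (Fin (r * s)), frob r s σ • cyc P σ =
      (r * s).factorial • (jacobiTrudi (newtonE P) r s).det := by
  have hw : ∀ w : Perm (Fin s), ∑ σ : Perm (Fin (r * s)), (Perm.sign σ : ℤ) • (cyc P σ *
      ((Finset.univ.filter fun f : Fin (r * s) → Fin s =>
        f ∘ σ = f ∧ ∀ i, content f i + (w i : ℕ) = r + i).card : S)) =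
      (r * s).factorial • ∏ i, zeroExtend (newtonE P) ((r : ℤ) + i - w i) := by
    intro w
    -- if some exponent `r + i - w i` is negative, both sides vanish
    by_cases h : ∀ i, (w i : ℕ) ≤ r + i
    · have h1 : ∀ i, zeroExtend (newtonE P) ((r : ℤ) + i - w i) = newtonE P (r + i - w i) := by
        intro i
        rw [← zeroExtend_natCast (newtonE P)]
        congr 1
        have := h i
        omega
      have hsum : ∑ i : Fin s, (r + (i : ℕ) - (w i : ℕ)) = r * s := by
        have e1 : ∑ i : Fin s, (r + (i : ℕ) - (w i : ℕ)) + ∑ i, (w i : ℕ) =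
            ∑ i : Fin s, (r + (i : ℕ)) := by
          rw [← Finset.sum_add_distrib]
          exact Finset.sum_congr rfl fun i _ => Nat.sub_add_cancel (h i)
        rw [Equiv.sum_comp w (fun i => (i : ℕ)), Finset.sum_add_distrib] at e1
        have e2 := Nat.add_right_cancel e1
        rw [e2]
        simp [mul_comm]
      rw [Finset.prod_congr rfl fun i _ => h1 i, ← sum_sign_cyc_fixedCount P _ hsum]
      refine Finset.sum_congr rfl fun σ _ => ?_
      congr 4
      refine Finset.filter_congr fun f _ => and_congr_right fun _ => ?_
      rw [funext_iff]
      refine forall_congr' fun i => ?_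
      have := h i
      omega
    · push Not at h
      obtain ⟨i, hi⟩ := h
      rw [Finset.prod_eq_zero (Finset.mem_univ i) (zeroExtend_of_neg _ (by omega)), smul_zero]
      refine Finset.sum_eq_zero fun σ _ => ?_
      rw [Finset.card_eq_zero.2]
      · simp
      · refine Finset.filter_eq_empty_iff.2 fun f _ hf => ?_
        have := hf.2 i
        omega
  rw [← Matrix.det_transpose, Matrix.det_apply', Finset.smul_sum]
  have hr : ∀ w : Perm (Fin s), (r * s).factorial • (((Perm.sign w : ℤ) : S) *
      ∏ i, (jacobiTrudi (newtonE P) r s).transpose (w i) i) =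
      ∑ σ : Perm (Fin (r * s)), (Perm.sign w : ℤ) • ((Perm.sign σ : ℤ) • (cyc P σ *
      ((Finset.univ.filter fun f : Fin (r * s) → Fin s =>
        f ∘ σ = f ∧ ∀ i, content f i + (w i : ℕ) = r + i).card : S))) := by
    intro w
    rw [← Finset.smul_sum, hw, ← zsmul_eq_mul, smul_comm]
    rfl
  rw [Finset.sum_congr rfl fun w _ => hr w, Finset.sum_comm]
  refine Finset.sum_congr rfl fun σ _ => ?_
  rw [frob]
  simp only [zsmul_eq_mul, Int.cast_mul, Int.cast_sum, Finset.mul_sum, Finset.sum_mul]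
  refine Finset.sum_congr rfl fun w _ => ?_
  push_cast
  ring

section Orthogonality

open MvPolynomial

/-- The sequence `(-1)^{k-1} p_k`, whose `newtonE` are the complete symmetric polynomials. -/
def signedPsum (s k : ℕ) : MvPolynomial (Fin s) ℚ := (-1) ^ (k + 1) * ∑ i, X i ^ k

/-- The product `∏_{l ≠ k} (1 - X_l t)`. -/
def omitProd (s : ℕ) (k : Fin s) : Polynomial (MvPolynomial (Fin s) ℚ) :=
  ∏ l ∈ Finset.univ.erase k, (1 - Polynomial.C (X l) * Polynomial.X)

theorem omitProd_coeff (s : ℕ) (k : Fin s) (j : ℕ) (hj : s ≤ j) : (omitProd s k).coeff j = 0 := by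
  apply Polynomial.coeff_eq_zero_of_natDegree_lt
  have h1 : (omitProd s k).natDegree ≤ ∑ l ∈ Finset.univ.erase k, 1 := by
    refine (Polynomial.natDegree_prod_le _ _).trans (Finset.sum_le_sum fun l _ => ?_)
    refine (Polynomial.natDegree_sub_le _ _).trans ?_
    rw [Polynomial.natDegree_one]
    exact max_le (Nat.zero_le _)
      ((Polynomial.natDegree_C_mul_le _ _).trans Polynomial.natDegree_X_le)
  have h2 : 0 < s := k.pos
  rw [Finset.sum_const, Finset.card_erase_of_mem (Finset.mem_univ _), Finset.card_univ,
    Fintype.card_fin] at h1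
  simp at h1
  omega

/-- The generating series `∏_l (1 - X_l t)⁻¹` of the complete symmetric polynomials becomes a
geometric series after multiplication by all factors `1 - X_l t` with `l ≠ k`. -/
theorem omitProd_mul_newtonSeries (s : ℕ) (k : Fin s) :
    ((omitProd s k : Polynomial _) : PowerSeries (MvPolynomial (Fin s) ℚ)) *
      newtonSeries (signedPsum s) = PowerSeries.mk fun n => X k ^ n := by
  have h1 : newtonSeries (signedPsum s) =
      ∏ l : Fin s, PowerSeries.mk fun n => (X l : MvPolynomial (Fin s) ℚ) ^ n := by
    have : signedPsum s = fun k => ∑ l : Fin s, (-1) ^ (k + 1) * X l ^ k := by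
      funext k; rw [signedPsum, Finset.mul_sum]
    rw [this, newtonSeries_sum]
    refine Finset.prod_congr rfl fun l _ => ?_
    ext1 n
    rw [newtonSeries, PowerSeries.coeff_mk, PowerSeries.coeff_mk, newtonE_geom (X l)]
    intro k
    rw [pow_add, pow_add]
    simp
  have h2 : ∀ l : Fin s, (1 - PowerSeries.C (X l) * PowerSeries.X) *
      (PowerSeries.mk fun n => (X l : MvPolynomial (Fin s) ℚ) ^ n) = 1 := by
    intro l
    ext1 n
    rw [sub_mul, one_mul, mul_assoc, map_sub, PowerSeries.coeff_C_mul]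
    cases n with
    | zero => simp
    | succ n =>
      rw [PowerSeries.coeff_succ_X_mul, PowerSeries.coeff_mk, PowerSeries.coeff_mk, ← pow_succ',
        sub_self, PowerSeries.coeff_one, if_neg (Nat.succ_ne_zero n)]
  have h3 : ((omitProd s k : Polynomial _) : PowerSeries (MvPolynomial (Fin s) ℚ)) =
      ∏ l ∈ Finset.univ.erase k, (1 - PowerSeries.C (X l) * PowerSeries.X) := by
    have := map_prod (Polynomial.coeToPowerSeries.ringHom (R := MvPolynomial (Fin s) ℚ))
      (fun l => 1 - Polynomial.C (X l) * Polynomial.X) (Finset.univ.erase k)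
    refine this.trans (Finset.prod_congr rfl fun l _ => ?_)
    rw [map_sub, map_mul, map_one]
    congr 2
    · exact Polynomial.coe_C _
    · exact Polynomial.coe_X
  rw [h1, h3, ← Finset.mul_prod_erase _ _ (Finset.mem_univ k), mul_left_comm,
    ← Finset.prod_mul_distrib, Finset.prod_congr rfl fun l _ => h2 l]
  simp

/-- The powers of a variable as combinations of complete symmetric polynomials. -/
theorem X_pow_eq (s : ℕ) (k : Fin s) (n : ℕ) : (X k : MvPolynomial (Fin s) ℚ) ^ n =
    ∑ j : Fin s, zeroExtend (newtonE (signedPsum s)) ((n : ℤ) - j) * (omitProd s k).coeff j := by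
  have h := congrArg (PowerSeries.coeff n) (omitProd_mul_newtonSeries s k)
  rw [PowerSeries.coeff_mk, PowerSeries.coeff_mul,
    Finset.Nat.sum_antidiagonal_eq_sum_range_succ_mk] at h
  rw [← h]
  rw [Fin.sum_univ_eq_sum_range (fun j =>
    zeroExtend (newtonE (signedPsum s)) ((n : ℤ) - j) * (omitProd s k).coeff j) s]
  have e1 : ∑ j ∈ Finset.range s, zeroExtend (newtonE (signedPsum s)) ((n : ℤ) - j) *
      (omitProd s k).coeff j = ∑ j ∈ Finset.range (s + (n + 1)),
      zeroExtend (newtonE (signedPsum s)) ((n : ℤ) - j) * (omitProd s k).coeff j := by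
    refine Finset.sum_subset (Finset.range_mono (by omega)) fun j _ hj => ?_
    rw [omitProd_coeff s k j (by simpa using hj), mul_zero]
  have e2 : ∑ j ∈ Finset.range (n + 1), zeroExtend (newtonE (signedPsum s)) ((n : ℤ) - j) *
      (omitProd s k).coeff j = ∑ j ∈ Finset.range (s + (n + 1)),
      zeroExtend (newtonE (signedPsum s)) ((n : ℤ) - j) * (omitProd s k).coeff j := by
    refine Finset.sum_subset (Finset.range_mono (by omega)) fun j _ hj => ?_
    rw [zeroExtend_of_neg _ (by simp at hj; omega), zero_mul]
  rw [e1, ← e2]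
  refine Finset.sum_congr rfl fun j hj => ?_
  have hj' : j ≤ n := by simpa [Nat.lt_succ_iff] using hj
  have : ((n : ℤ) - j) = ((n - j : ℕ) : ℤ) := by omega
  rw [this, zeroExtend_natCast, newtonSeries, PowerSeries.coeff_mk, Polynomial.coeff_coe, mul_comm]

/-- The bialternant formula for rectangular diagrams. By `X_pow_eq` the matrix of powers of the
variables is the Jacobi–Trudi matrix times a matrix that does not depend on `r`; as the Jacobi–Trudi
matrix for `r = 0` is unitriangular, the latter has the Vandermonde determinant as its determinant.
-/
theorem bialternant (r s : ℕ) :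
    (jacobiTrudi (newtonE (signedPsum s)) r s).det *
      (Matrix.of fun i k : Fin s => (X k : MvPolynomial (Fin s) ℚ) ^ (i : ℕ)).det =
    (Matrix.of fun i k : Fin s => (X k : MvPolynomial (Fin s) ℚ) ^ (r + (i : ℕ))).det := by
  have h : ∀ r, (Matrix.of fun i k : Fin s => (X k : MvPolynomial (Fin s) ℚ) ^ (r + (i : ℕ))) =
      jacobiTrudi (newtonE (signedPsum s)) r s *
        Matrix.of fun j k : Fin s => (omitProd s k).coeff (j : ℕ) := by
    intro r
    ext1 i k
    rw [Matrix.mul_apply, Matrix.of_apply, X_pow_eq]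
    simp [jacobiTrudi]
  have h0 : (jacobiTrudi (newtonE (signedPsum s)) 0 s).det = 1 := by
    rw [Matrix.det_of_isLowerTriangular]
    · refine Finset.prod_eq_one fun i _ => ?_
      simp only [jacobiTrudi, Matrix.of_apply]
      rw [show ((0 : ℕ) : ℤ) + (i : ℕ) - (i : ℕ) = ((0 : ℕ) : ℤ) by omega, zeroExtend_natCast,
        newtonE_zero]
    · intro i j hij
      have hij' : (i : ℕ) < j := hij
      exact zeroExtend_of_neg _ (by omega)
  have h1 := congrArg Matrix.det (h 0)
  rw [Matrix.det_mul, h0, one_mul] at h1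
  simp only [zero_add] at h1
  rw [h1, ← Matrix.det_mul, ← h r]

/-- Only the diagonal term of the alternant contains its leading monomial. -/
theorem coeff_det_X_pow (r s : ℕ) :
    coeff (Finsupp.equivFunOnFinite.symm fun i : Fin s => r + (i : ℕ))
      (Matrix.of fun i k : Fin s => (X k : MvPolynomial (Fin s) ℚ) ^ (r + (i : ℕ))).det = 1 := by
  rw [Matrix.det_apply', coeff_sum, Finset.sum_eq_single 1]
  · simp only [Perm.sign_one, Units.val_one, Int.cast_one, one_mul, Perm.one_apply,
      Matrix.of_apply]
    rw [coeff_prod_X_pow, if_pos]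
    ext i
    simp
  · intro w _ hw
    rw [← zsmul_eq_mul, coeff_smul]
    simp only [Matrix.of_apply]
    rw [coeff_prod_X_pow, if_neg, smul_zero]
    intro h
    refine hw (Equiv.ext fun i => ?_)
    have := DFunLike.congr_fun h i
    simp only [Finsupp.equivFunOnFinite_symm_apply_apply, Finsupp.indicator_apply,
      Finset.mem_univ, dite_true] at this
    exact Fin.ext (by simp; omega)
  · simp

theorem coeff_intCast_mul {s : ℕ} (d : Fin s →₀ ℕ) (z : ℤ) (f : MvPolynomial (Fin s) ℚ) :
    coeff d ((z : MvPolynomial (Fin s) ℚ) * f) = z * coeff d f := by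
  rw [← zsmul_eq_mul, coeff_smul, zsmul_eq_mul]

/-- The Frobenius character has norm one. For `P_k = (-1)^{k-1} p_k`, the formula `sum_frob_cyc`
multiplied by the Vandermonde determinant expresses the alternant of `bialternant` as a combination
of terms in which the coefficient of `∏ x_i^{r+i}` is again the Frobenius character. -/
theorem sum_frob_sq (r s : ℕ) :
    ∑ σ : Perm (Fin (r * s)), ((frob r s σ : ℤ) : ℚ) ^ 2 = (r * s).factorial := by
  have h := sum_frob_cyc (signedPsum s) r s
  have h2 := congrArg (fun z => coeff (Finsupp.equivFunOnFinite.symm fun i : Fin s => r + (i : ℕ))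
    (z * (Matrix.of fun i k : Fin s => (X k : MvPolynomial (Fin s) ℚ) ^ (i : ℕ)).det)) h
  simp only [smul_mul_assoc, bialternant, coeff_smul, coeff_det_X_pow, Finset.sum_mul,
    coeff_sum] at h2
  rw [nsmul_eq_mul, mul_one] at h2
  rw [← h2]
  refine Finset.sum_congr rfl fun σ _ => ?_
  have hc : cyc (signedPsum s) σ = ((Perm.sign σ : ℤ) : MvPolynomial (Fin s) ℚ) *
      ∑ f : Fin (r * s) → Fin s, if f ∘ σ = f then ∏ a, X (f a) else 0 := by
    rw [sum_fixed_words, ← cyc_neg_one_pow, ← cyc_mul]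
    rfl
  rw [hc, ← zsmul_eq_mul, smul_mul_assoc, coeff_smul, smul_smul, pow_two, zsmul_eq_mul,
    Int.cast_mul, mul_assoc]
  congr 1
  rw [frob, Int.cast_mul]
  congr 1
  rw [Matrix.det_apply', Finset.mul_sum, coeff_sum, Int.cast_sum]
  refine Finset.sum_congr rfl fun w _ => ?_
  rw [Int.cast_mul, mul_left_comm, coeff_intCast_mul]
  congr 1
  rw [Finset.sum_mul, coeff_sum, Finset.card_filter, Nat.cast_sum, Int.cast_sum]
  refine Finset.sum_congr rfl fun f _ => ?_
  by_cases hf : f ∘ σ = f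
  · simp only [hf, if_true, true_and, Matrix.of_apply]
    have hp : ∏ i, (X i : MvPolynomial (Fin s) ℚ) ^ ((w i : Fin s) : ℕ) =
        monomial (Finsupp.equivFunOnFinite.symm fun i => ((w i : Fin s) : ℕ)) 1 := by
      rw [monomial_eq, Finsupp.prod_fintype _ _ (by simp), C_1, one_mul]
      rfl
    rw [prod_X_word, hp, monomial_mul, coeff_monomial]
    have : (Finsupp.equivFunOnFinite.symm (content f) +
        Finsupp.equivFunOnFinite.symm (fun i => ((w i : Fin s) : ℕ)) =
        Finsupp.equivFunOnFinite.symm fun i : Fin s => r + (i : ℕ)) ↔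
        ∀ i, content f i + (w i : ℕ) = r + i := by
      rw [Finsupp.ext_iff]
      rfl
    simp only [this]
    split_ifs <;> simp
  · simp [hf]

end Orthogonality

end Frobenius

/-! ### Young symmetrizers of rectangular diagrams -/

section YoungSymmetrizer

open Equiv

variable {r s : ℕ}

/-- The permutations of the labels of the rectangular tableau that preserve each row. -/
def rowGroup (r s : ℕ) : Subgroup (Perm (Fin (r * s))) where
  carrier := {g | ∀ t, (rectCell r s (g t)).1 = (rectCell r s t).1}
  mul_mem' {g h} hg hh t := by rw [Perm.mul_apply, hg, hh]
  one_mem' _ := rfl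
  inv_mem' {g} hg t := by
    have := hg (g⁻¹ t)
    simpa using this.symm

/-- The permutations of the labels of the rectangular tableau that preserve each column. -/
def colGroup (r s : ℕ) : Subgroup (Perm (Fin (r * s))) where
  carrier := {g | ∀ t, (rectCell r s (g t)).2 = (rectCell r s t).2}
  mul_mem' {g h} hg hh t := by rw [Perm.mul_apply, hg, hh]
  one_mem' _ := rfl
  inv_mem' {g} hg t := by
    have := hg (g⁻¹ t)
    simpa using this.symm

theorem mem_rowGroup {g : Perm (Fin (r * s))} :
    g ∈ rowGroup r s ↔ ∀ t, (rectCell r s (g t)).1 = (rectCell r s t).1 := Iff.rfl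

theorem mem_colGroup {g : Perm (Fin (r * s))} :
    g ∈ colGroup r s ↔ ∀ t, (rectCell r s (g t)).2 = (rectCell r s t).2 := Iff.rfl

theorem eq_one_of_mem_rowGroup_of_mem_colGroup {g : Perm (Fin (r * s))} (h1 : g ∈ rowGroup r s)
    (h2 : g ∈ colGroup r s) : g = 1 :=
  Equiv.ext fun t => (rectCell r s).injective (Prod.ext (h1 t) (h2 t))

theorem swap_mem_rowGroup {a b : Fin (r * s)} (h : (rectCell r s a).1 = (rectCell r s b).1) :
    swap a b ∈ rowGroup r s := by
  intro t
  rw [swap_apply_def]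
  split_ifs with h1 h2
  · rw [h1, h]
  · rw [h2, h]
  · rfl

theorem swap_mem_colGroup {a b : Fin (r * s)} (h : (rectCell r s a).2 = (rectCell r s b).2) :
    swap a b ∈ colGroup r s := by
  intro t
  rw [swap_apply_def]
  split_ifs with h1 h2
  · rw [h1, h]
  · rw [h2, h]
  · rfl

/-- A word in the alphabet of columns is injective on each row of the rectangle. -/
def RowInjective (f : Fin (r * s) → Fin s) : Prop :=
  ∀ a b, (rectCell r s a).1 = (rectCell r s b).1 → f a = f b → a = b

/-- A filling of the rectangle by column indices, with distinct entries in each row, arises from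
the standard one by a permutation preserving the rows. -/
theorem exists_rowGroup_of_rowInjective {f : Fin (r * s) → Fin s} (hf : RowInjective f) :
    ∃ g ∈ rowGroup r s, ∀ t, (rectCell r s (g t)).2 = f t := by
  have hb : ∀ i : Fin r, Function.Bijective fun j : Fin s => f ((rectCell r s).symm (i, j)) := by
    intro i
    refine Finite.injective_iff_bijective.1 fun j k hjk => ?_
    have := hf _ _ (by simp) hjk
    simpa using this
  let g : Perm (Fin (r * s)) := (rectCell r s).symm.permCongr
    (Equiv.prodShear (Equiv.refl (Fin r)) fun i => Equiv.ofBijective _ (hb i))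
  have hg : ∀ t, rectCell r s (g t) = ((rectCell r s t).1, f t) := by
    intro t
    simp [g, Equiv.permCongr_apply, Equiv.prodShear]
  exact ⟨g, fun t => by rw [hg], fun t => by rw [hg]⟩

theorem rowInjective_of_mem_rowGroup {g : Perm (Fin (r * s))} (hg : g ∈ rowGroup r s) :
    RowInjective fun t => (rectCell r s (g t)).2 := fun a b h1 h2 =>
  g.injective ((rectCell r s).injective (Prod.ext ((hg a).trans (h1.trans (hg b).symm)) h2))

/-- Every column index occurs once in each of the `r` rows. -/
theorem content_of_rowInjective {f : Fin (r * s) → Fin s} (hf : RowInjective f) (j : Fin s) :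
    content f j = r := by
  obtain ⟨g, _, hg⟩ := exists_rowGroup_of_rowInjective hf
  have : f = (fun t => (rectCell r s t).2) ∘ g := funext fun t => (hg t).symm
  rw [this, content_comp, content, ← Fintype.card_subtype]
  let e : {t : Fin (r * s) // (rectCell r s t).2 = j} ≃ Fin r :=
    { toFun := fun t => (rectCell r s t.1).1
      invFun := fun i => ⟨(rectCell r s).symm (i, j), by simp⟩
      left_inv := fun t => Subtype.ext ((Equiv.symm_apply_eq _).2 (Prod.ext rfl t.2.symm))
      right_inv := fun i => by simp }
  exact (Fintype.card_congr e).trans (Fintype.card_fin r)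

open Classical in
/-- The row symmetrizer in the group algebra. -/
def rowElt (r s : ℕ) : MonoidAlgebra ℚ (Perm (Fin (r * s))) :=
  ∑ g : Perm (Fin (r * s)) with g ∈ rowGroup r s, MonoidAlgebra.of ℚ _ g

open Classical in
/-- The column antisymmetrizer in the group algebra. -/
def colElt (r s : ℕ) : MonoidAlgebra ℚ (Perm (Fin (r * s))) :=
  ∑ g : Perm (Fin (r * s)) with g ∈ colGroup r s,
    ((Perm.sign g : ℤ) : ℚ) • MonoidAlgebra.of ℚ _ g

/-- The Young symmetrizer in the group algebra. -/
def youngElt (r s : ℕ) : MonoidAlgebra ℚ (Perm (Fin (r * s))) := rowElt r s * colElt r s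

theorem rowElt_mul_of {g : Perm (Fin (r * s))} (hg : g ∈ rowGroup r s) :
    rowElt r s * MonoidAlgebra.of ℚ _ g = rowElt r s := by
  classical
  rw [rowElt, Finset.sum_mul]
  simp only [← map_mul]
  rw [Finset.sum_filter, Finset.sum_filter]
  refine Fintype.sum_equiv (Equiv.mulRight g) _ _ fun h => ?_
  simp only [Equiv.coe_mulRight, (rowGroup r s).mul_mem_cancel_right hg]

theorem of_mul_colElt {h : Perm (Fin (r * s))} (hh : h ∈ colGroup r s) :
    MonoidAlgebra.of ℚ _ h * colElt r s = ((Perm.sign h : ℤ) : ℚ) • colElt r s := by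
  classical
  rw [colElt, Finset.mul_sum, Finset.smul_sum, Finset.sum_filter, Finset.sum_filter]
  refine Fintype.sum_equiv (Equiv.mulLeft h) _ _ fun g => ?_
  simp only [Equiv.coe_mulLeft, (colGroup r s).mul_mem_cancel_left hh, mul_smul_comm, ← map_mul,
    smul_smul]
  congr 2
  rw [Perm.sign_mul, Units.val_mul, Int.cast_mul, ← mul_assoc, ← Int.cast_mul, ← Units.val_mul,
    Int.units_mul_self]
  simp

/-- Von Neumann's lemma: `a x b` is a multiple of `a b`, for the row symmetrizer `a` and the column
antisymmetrizer `b`. -/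
theorem exists_rowElt_mul_of_mul_colElt (x : Perm (Fin (r * s))) :
    ∃ k : ℚ, rowElt r s * MonoidAlgebra.of ℚ _ x * colElt r s = k • youngElt r s := by
  by_cases hx : RowInjective fun t => (rectCell r s (x⁻¹ t)).2
  · obtain ⟨g, hg, hgx⟩ := exists_rowGroup_of_rowInjective hx
    have hh : g * x ∈ colGroup r s := by
      intro t
      have := hgx (x t)
      simpa using this
    refine ⟨((Perm.sign (g * x) : ℤ) : ℚ), ?_⟩
    have e : x = g⁻¹ * (g * x) := by group
    conv_lhs => rw [e]
    rw [map_mul, ← mul_assoc, rowElt_mul_of ((rowGroup r s).inv_mem hg), mul_assoc,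
      of_mul_colElt hh, mul_smul_comm]
    rfl
  · simp only [RowInjective, not_forall] at hx
    obtain ⟨a, b, hrow, hcol, hab⟩ := hx
    refine ⟨0, ?_⟩
    -- A transposition within a row is turned by `x` into one within a column.
    have e : swap a b * x = x * swap (x⁻¹ a) (x⁻¹ b) := by
      rw [Equiv.swap_apply_apply]
      group
    have h1 : rowElt r s * MonoidAlgebra.of ℚ _ x * colElt r s =
        -(rowElt r s * MonoidAlgebra.of ℚ _ x * colElt r s) := by
      conv_lhs => rw [← rowElt_mul_of (swap_mem_rowGroup hrow)]
      rw [mul_assoc (rowElt r s), ← map_mul, e, map_mul, mul_assoc, mul_assoc,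
        of_mul_colElt (swap_mem_colGroup hcol), Perm.sign_swap (by simpa using hab), mul_assoc]
      simp
    have h2 := eq_neg_iff_add_eq_zero.1 h1
    rw [← two_smul ℚ] at h2
    rw [zero_smul, ← inv_smul_smul₀ (two_ne_zero (α := ℚ)) (rowElt r s * _ * _), h2, smul_zero]

theorem sum_coeff_smul_of {G : Type*} [Fintype G] [Monoid G] (y : MonoidAlgebra ℚ G) :
    ∑ g, y.coeff g • MonoidAlgebra.of ℚ G g = y := by
  have h := MonoidAlgebra.sum_coeff_single y
  rw [Finsupp.sum_fintype _ _ fun _ => MonoidAlgebra.single_zero _] at h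
  rw [← h]
  refine Finset.sum_congr rfl fun g _ => ?_
  simp [h]

theorem exists_rowElt_mul_mul_colElt (y : MonoidAlgebra ℚ (Perm (Fin (r * s)))) :
    ∃ k : ℚ, rowElt r s * y * colElt r s = k • youngElt r s := by
  choose k hk using exists_rowElt_mul_of_mul_colElt (r := r) (s := s)
  refine ⟨∑ x, y.coeff x * k x, ?_⟩
  conv_lhs => rw [← sum_coeff_smul_of y]
  rw [Finset.mul_sum, Finset.sum_mul, Finset.sum_smul]
  refine Finset.sum_congr rfl fun x _ => ?_
  rw [mul_smul_comm, smul_mul_assoc, hk, smul_smul]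

open Classical in
theorem coeff_youngElt (σ : Perm (Fin (r * s))) : (youngElt r s).coeff σ =
    ∑ g : Perm (Fin (r * s)) with g ∈ rowGroup r s, ∑ h : Perm (Fin (r * s)) with h ∈ colGroup r s,
      if g * h = σ then ((Perm.sign h : ℤ) : ℚ) else 0 := by
  rw [youngElt, rowElt, colElt, Finset.sum_mul_sum, MonoidAlgebra.coeff_sum,
    Finsupp.finsetSum_apply]
  refine Finset.sum_congr rfl fun g _ => ?_
  rw [MonoidAlgebra.coeff_sum, Finsupp.finsetSum_apply]
  refine Finset.sum_congr rfl fun h _ => ?_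
  rw [mul_smul_comm, ← map_mul, MonoidAlgebra.coeff_smul, MonoidAlgebra.of_apply,
    MonoidAlgebra.coeff_single, Finsupp.smul_apply, Finsupp.single_apply]
  split_ifs <;> simp

theorem coeff_youngElt_one : (youngElt r s).coeff 1 = 1 := by
  classical
  rw [coeff_youngElt, Finset.sum_eq_single 1, Finset.sum_eq_single 1]
  · simp
  · intro h _ hh
    simpa using hh
  · intro h
    exact absurd (Finset.mem_filter.2 ⟨Finset.mem_univ _, (colGroup r s).one_mem⟩) h
  · intro g hg hg1
    refine Finset.sum_eq_zero fun h hh => if_neg fun e => hg1 ?_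
    have hg' := (Finset.mem_filter.1 hg).2
    refine eq_one_of_mem_rowGroup_of_mem_colGroup hg' ?_
    rw [eq_inv_of_mul_eq_one_left e]
    exact (colGroup r s).inv_mem (Finset.mem_filter.1 hh).2
  · intro h
    exact absurd (Finset.mem_filter.2 ⟨Finset.mem_univ _, (rowGroup r s).one_mem⟩) h

/-- The ratio `h` in `c² = h c`, for the Young symmetrizer `c`. -/
def hookProd (r s : ℕ) : ℚ := (youngElt r s * youngElt r s).coeff 1

theorem youngElt_mul_mul_youngElt (y : MonoidAlgebra ℚ (Perm (Fin (r * s)))) :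
    youngElt r s * y * youngElt r s = (youngElt r s * y * youngElt r s).coeff 1 • youngElt r s := by
  obtain ⟨k, hk⟩ := exists_rowElt_mul_mul_colElt (colElt r s * y * rowElt r s)
  have e : youngElt r s * y * youngElt r s = k • youngElt r s := by
    rw [← hk]; simp only [youngElt, mul_assoc]
  have : (youngElt r s * y * youngElt r s).coeff 1 = k := by
    rw [e, MonoidAlgebra.coeff_smul, Finsupp.smul_apply, coeff_youngElt_one, smul_eq_mul, mul_one]
  rw [this, e]

theorem youngElt_mul_self : youngElt r s * youngElt r s = hookProd r s • youngElt r s := by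
  have h := youngElt_mul_mul_youngElt (r := r) (s := s) 1
  rwa [mul_one] at h

theorem coeff_one_mul {G : Type*} [Fintype G] [Group G] (x y : MonoidAlgebra ℚ G) :
    (x * y).coeff 1 = ∑ g, x.coeff g * y.coeff g⁻¹ := by
  classical
  conv_lhs => rw [← sum_coeff_smul_of x, Finset.sum_mul]
  rw [MonoidAlgebra.coeff_sum, Finsupp.finsetSum_apply]
  refine Finset.sum_congr rfl fun g _ => ?_
  rw [smul_mul_assoc, MonoidAlgebra.coeff_smul, Finsupp.smul_apply, smul_eq_mul,
    MonoidAlgebra.of_apply, MonoidAlgebra.coeff_single_mul_eq_mul_coeff g⁻¹, one_mul]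
  intro a _
  exact ⟨fun h => eq_inv_of_mul_eq_one_right h, fun h => by rw [h, mul_inv_cancel]⟩

theorem coeff_of_mul {G : Type*} [Group G] (x : MonoidAlgebra ℚ G) (g h : G) :
    (MonoidAlgebra.of ℚ G g * x).coeff h = x.coeff (g⁻¹ * h) := by
  rw [MonoidAlgebra.of_apply, MonoidAlgebra.coeff_single_mul_eq_mul_coeff (g⁻¹ * h), one_mul]
  intro a _
  exact ⟨fun h => by rw [← h]; group, fun h => by rw [h]; group⟩

theorem coeff_mul_of {G : Type*} [Group G] (x : MonoidAlgebra ℚ G) (g h : G) :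
    (x * MonoidAlgebra.of ℚ G g).coeff h = x.coeff (h * g⁻¹) := by
  rw [MonoidAlgebra.of_apply, MonoidAlgebra.coeff_mul_single_eq_coeff_mul (h * g⁻¹), mul_one]
  intro a _
  exact ⟨fun h => by rw [← h]; group, fun h => by rw [h]; group⟩

/-- The class function `∑ c(τ σ τ⁻¹)` obtained from the Young symmetrizer; it is `hookProd` times
the character of the irreducible representation. -/
def youngClass (r s : ℕ) (σ : Perm (Fin (r * s))) : ℚ :=
  ∑ τ : Perm (Fin (r * s)), (youngElt r s).coeff (τ * σ * τ⁻¹)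

theorem youngClass_conj (σ τ : Perm (Fin (r * s))) :
    youngClass r s (τ * σ * τ⁻¹) = youngClass r s σ := by
  refine Fintype.sum_equiv (Equiv.mulRight τ) _ _ fun ρ => ?_
  have e : ρ * (τ * σ * τ⁻¹) * ρ⁻¹ = ρ * τ * σ * (ρ * τ)⁻¹ := by group
  rw [Equiv.coe_mulRight, e]

/-- Permutations are conjugate to their inverses. -/
theorem youngClass_inv (σ : Perm (Fin (r * s))) : youngClass r s σ⁻¹ = youngClass r s σ := by
  have h : IsConj σ σ⁻¹ := by
    rw [Perm.isConj_iff_cycleType_eq, Perm.cycleType_inv]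
  obtain ⟨τ, hτ⟩ := isConj_iff.1 h
  rw [← hτ, youngClass_conj]

/-- Pairing a class function with the class function of the Young symmetrizer. -/
theorem sum_youngClass_mul {S : Type*} [CommRing S] [Algebra ℚ S] (φ : Perm (Fin (r * s)) → S)
    (hφ : ∀ σ τ, φ (τ * σ * τ⁻¹) = φ σ) :
    ∑ σ, youngClass r s σ • φ σ =
      (r * s).factorial • ∑ σ, (youngElt r s).coeff σ • φ σ := by
  simp only [youngClass, Finset.sum_smul]
  rw [Finset.sum_comm]
  have : ∀ τ : Perm (Fin (r * s)), ∑ σ, (youngElt r s).coeff (τ * σ * τ⁻¹) • φ σ =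
      ∑ σ, (youngElt r s).coeff σ • φ σ := by
    intro τ
    refine Fintype.sum_equiv (MulAut.conj τ).toEquiv _ _ fun σ => ?_
    have e : (MulAut.conj τ).toEquiv σ = τ * σ * τ⁻¹ := rfl
    rw [e, hφ]
  rw [Finset.sum_congr rfl fun τ _ => this τ, Finset.sum_const, Finset.card_univ,
    Fintype.card_perm, Fintype.card_fin]

/-- The norm of the class function of the Young symmetrizer `c`, computed from `c x c ∈ ℚ c` and `c³
= h² c`. -/
theorem sum_youngClass_sq (r s : ℕ) :
    ∑ σ, youngClass r s σ ^ 2 = (r * s).factorial * hookProd r s ^ 2 := by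
  have h := sum_youngClass_mul (r := r) (s := s) (youngClass r s) youngClass_conj
  simp only [smul_eq_mul, nsmul_eq_mul] at h
  simp only [pow_two]
  rw [h]
  congr 1
  set c := youngElt r s with hc
  -- `c τ⁻¹ c = ℓ(τ) c` with `ℓ(τ)` the coefficient of `1`
  set ℓ : Perm (Fin (r * s)) → ℚ := fun τ => (c * MonoidAlgebra.of ℚ _ τ * c).coeff 1 with hℓ
  have h1 : ∑ σ, c.coeff σ * youngClass r s σ = ∑ τ, ℓ τ⁻¹ * c.coeff τ⁻¹ := by
    have e : ∀ τ : Perm (Fin (r * s)), ℓ τ⁻¹ * c.coeff τ⁻¹ =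
        ∑ σ, c.coeff σ * c.coeff (τ * σ⁻¹ * τ⁻¹) := by
      intro τ
      have e1 : (c * (MonoidAlgebra.of ℚ _ τ⁻¹ * c * MonoidAlgebra.of ℚ _ τ)).coeff 1 =
          ℓ τ⁻¹ * c.coeff τ⁻¹ := by
        rw [← mul_assoc, ← mul_assoc, youngElt_mul_mul_youngElt, smul_mul_assoc,
          MonoidAlgebra.coeff_smul, Finsupp.smul_apply, coeff_mul_of, one_mul, smul_eq_mul]
      rw [← e1, coeff_one_mul]
      refine Finset.sum_congr rfl fun σ _ => ?_
      have e2 : τ⁻¹⁻¹ * (σ⁻¹ * τ⁻¹) = τ * σ⁻¹ * τ⁻¹ := by group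
      rw [coeff_mul_of, coeff_of_mul, e2]
    rw [Finset.sum_congr rfl fun τ _ => e τ, Finset.sum_comm]
    refine Finset.sum_congr rfl fun σ _ => ?_
    rw [← Finset.mul_sum, ← youngClass_inv]
    rfl
  have h2 : ∑ τ, ℓ τ⁻¹ * c.coeff τ⁻¹ = ∑ τ, c.coeff τ * ℓ τ := by
    rw [← Equiv.sum_comp (Equiv.inv (Perm (Fin (r * s)))) fun τ => c.coeff τ * ℓ τ]
    refine Finset.sum_congr rfl fun τ _ => mul_comm _ _
  have h3 : (c * c * c).coeff 1 = ∑ τ, c.coeff τ * ℓ τ := by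
    have : c * c * c = ∑ τ, c.coeff τ • (c * MonoidAlgebra.of ℚ _ τ * c) := by
      conv_lhs => rw [← sum_coeff_smul_of c]
      conv_lhs => rw [sum_coeff_smul_of c, mul_assoc]
      conv_lhs => rw [← mul_assoc]
      conv_lhs => enter [1, 2]; rw [← sum_coeff_smul_of c]
      rw [Finset.mul_sum, Finset.sum_mul]
      refine Finset.sum_congr rfl fun τ _ => ?_
      rw [mul_smul_comm, smul_mul_assoc]
    rw [this, MonoidAlgebra.coeff_sum, Finsupp.finsetSum_apply]
    rfl
  rw [h1, h2, ← h3, hc, youngElt_mul_self, smul_mul_assoc, youngElt_mul_self, smul_smul,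
    MonoidAlgebra.coeff_smul, Finsupp.smul_apply, coeff_youngElt_one]
  simp

/-- If `h` vanished, then so would `youngClass`, by `sum_youngClass_sq`; but its value at the
identity is `(r s)!`. -/
theorem hookProd_ne_zero (r s : ℕ) : hookProd r s ≠ 0 := by
  intro h
  have h1 := sum_youngClass_sq r s
  rw [h, zero_pow two_ne_zero, mul_zero,
    Finset.sum_eq_zero_iff_of_nonneg fun _ _ => sq_nonneg _] at h1
  have h2 := h1 1 (Finset.mem_univ _)
  simp only [youngClass, mul_one, mul_inv_cancel, coeff_youngElt_one, Finset.sum_const,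
    Finset.card_univ, Fintype.card_perm, Fintype.card_fin, nsmul_eq_mul] at h2
  exact (Nat.factorial_ne_zero _) (by simpa using h2)

open Classical in
/-- Summation against the coefficients of the Young symmetrizer, expanded over pairs of a row and a
column permutation. -/
theorem sum_coeff_youngElt_smul {M : Type*} [AddCommGroup M] [Module ℚ M]
    (φ : Perm (Fin (r * s)) → M) : ∑ σ, (youngElt r s).coeff σ • φ σ =
    ∑ g : Perm (Fin (r * s)) with g ∈ rowGroup r s, ∑ h : Perm (Fin (r * s)) with h ∈ colGroup r s,
      ((Perm.sign h : ℤ) : ℚ) • φ (g * h) := by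
  simp only [coeff_youngElt, Finset.sum_smul]
  rw [Finset.sum_comm]
  refine Finset.sum_congr rfl fun g _ => ?_
  rw [Finset.sum_comm]
  refine Finset.sum_congr rfl fun h _ => ?_
  simp [ite_smul]

open Classical in
/-- The number of pairs of a row and a column permutation whose product fixes the word `f`, each
pair counted with the sign of the row permutation. -/
def pairCount (f : Fin (r * s) → Fin s) : ℚ :=
  ∑ g : Perm (Fin (r * s)) with g ∈ rowGroup r s, ∑ h : Perm (Fin (r * s)) with h ∈ colGroup r s,
    if f ∘ ⇑(g * h) = f then ((Perm.sign g : ℤ) : ℚ) else 0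

/-- Multiplication of the row permutation by the transposition of two equal letters in a row
reverses the sign. -/
theorem pairCount_eq_zero {f : Fin (r * s) → Fin s} (hf : ¬RowInjective f) : pairCount f = 0 := by
  classical
  simp only [RowInjective, not_forall] at hf
  obtain ⟨a, b, hrow, hcol, hab⟩ := hf
  have hs : f ∘ swap a b = f := by
    funext i
    rw [Function.comp_apply, swap_apply_def]
    split_ifs with h1 h2
    · rw [h1, hcol]
    · rw [h2, hcol]
    · rfl
  have h : pairCount f = -pairCount f := by
    rw [pairCount, Finset.sum_filter, ← Finset.sum_neg_distrib]
    refine Fintype.sum_equiv (Equiv.mulLeft (swap a b)) _ _ fun g => ?_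
    simp only [Equiv.coe_mulLeft, (rowGroup r s).mul_mem_cancel_left (swap_mem_rowGroup hrow)]
    split_ifs with hg
    · rw [← Finset.sum_neg_distrib]
      refine Finset.sum_congr rfl fun h _ => ?_
      have e : f ∘ ⇑(swap a b * g * h) = f ∘ ⇑(g * h) := by
        rw [mul_assoc, Perm.coe_mul (swap a b), ← Function.comp_assoc, hs]
      simp only [e, Perm.sign_mul, Perm.sign_swap hab]
      split_ifs <;> simp
    · simp
  linarith

open Classical in
/-- For the word of column indices moved by a row permutation `γ`, a product `g h` fixes the word
when `γ g h γ⁻¹` is a column permutation `h'⁻¹`. The sum over `γ` thus counts the solutions of `g h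
γ⁻¹ h' = 1` with the sign of `h h'`, which is the coefficient of `1` in the square of the Young
symmetrizer. -/
theorem sum_pairCount_rowGroup (r s : ℕ) :
    ∑ γ : Perm (Fin (r * s)) with γ ∈ rowGroup r s,
      pairCount (fun t => (rectCell r s (γ t)).2) = hookProd r s := by
  have hterm : ∀ γ ∈ rowGroup r s, ∀ g ∈ rowGroup r s, ∀ h ∈ colGroup r s,
      (if (fun t => (rectCell r s (γ t)).2) ∘ ⇑(g * h) = (fun t => (rectCell r s (γ t)).2) then
        ((Perm.sign g : ℤ) : ℚ) else 0) = ∑ h' : Perm (Fin (r * s)) with h' ∈ colGroup r s,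
        if (γ * g) * h * (γ⁻¹ * h') = 1 then
          ((Perm.sign h : ℤ) : ℚ) * ((Perm.sign h' : ℤ) : ℚ) else 0 := by
    intro γ hγ g hg h hh
    have h1 : ((fun t => (rectCell r s (γ t)).2) ∘ ⇑(g * h) =
        fun t => (rectCell r s (γ t)).2) ↔ γ * g * h * γ⁻¹ ∈ colGroup r s := by
      rw [mem_colGroup, funext_iff]
      constructor
      · intro H t
        have := H (γ⁻¹ t)
        simpa using this
      · intro H t
        have := H (γ t)
        simpa using this
    by_cases hc : γ * g * h * γ⁻¹ ∈ colGroup r s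
    · rw [if_pos (h1.2 hc), Finset.sum_eq_single (γ * g * h * γ⁻¹)⁻¹]
      · rw [if_pos (by group)]
        rw [← Int.cast_mul, ← Units.val_mul, ← Perm.sign_mul]
        congr 2
        rw [Perm.sign_mul, Perm.sign_inv]
        simp only [Perm.sign_mul, Perm.sign_inv]
        rcases Int.units_eq_one_or (Perm.sign γ) with e | e <;>
          rcases Int.units_eq_one_or (Perm.sign h) with e' | e' <;> rw [e, e'] <;> simp
      · intro h' _ hne
        rw [if_neg]
        intro H
        rw [← mul_assoc] at H
        exact hne (eq_inv_of_mul_eq_one_right H)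
      · intro hn
        exact absurd (Finset.mem_filter.2 ⟨Finset.mem_univ _, (colGroup r s).inv_mem hc⟩) hn
    · rw [if_neg fun H => hc (h1.1 H), Finset.sum_eq_zero]
      intro h' hh'
      rw [if_neg]
      intro H
      rw [← mul_assoc] at H
      apply hc
      rw [eq_inv_of_mul_eq_one_left H]
      exact (colGroup r s).inv_mem (Finset.mem_filter.1 hh').2
  have h2 : hookProd r s = ∑ γ : Perm (Fin (r * s)) with γ ∈ rowGroup r s,
      ∑ g : Perm (Fin (r * s)) with g ∈ rowGroup r s,
      ∑ h : Perm (Fin (r * s)) with h ∈ colGroup r s,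
      ∑ h' : Perm (Fin (r * s)) with h' ∈ colGroup r s,
        if g * h * (γ⁻¹ * h') = 1 then
          ((Perm.sign h : ℤ) : ℚ) * ((Perm.sign h' : ℤ) : ℚ) else 0 := by
    have e : hookProd r s = ∑ σ, (youngElt r s).coeff σ • (youngElt r s).coeff σ⁻¹ := by
      rw [hookProd, coeff_one_mul]; rfl
    rw [e, sum_coeff_youngElt_smul]
    simp only [coeff_youngElt, smul_eq_mul, Finset.mul_sum]
    rw [Finset.sum_congr rfl fun g _ => Finset.sum_comm, Finset.sum_comm, Finset.sum_filter,
      Finset.sum_filter]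
    refine Fintype.sum_equiv (Equiv.inv _) _ _ fun γ => ?_
    simp only [Equiv.inv_apply, (rowGroup r s).inv_mem_iff]
    split_ifs with hγ
    · refine Finset.sum_congr rfl fun g _ => Finset.sum_congr rfl fun h _ =>
        Finset.sum_congr rfl fun h' _ => ?_
      have : γ * h' = (g * h)⁻¹ ↔ g * h * (γ⁻¹⁻¹ * h') = 1 := by
        rw [inv_inv, mul_eq_one_iff_eq_inv', eq_comm]
      simp only [this, mul_ite, mul_zero]
    · rfl
  rw [h2]
  refine Finset.sum_congr rfl fun γ hγ => ?_
  have hγ' := (Finset.mem_filter.1 hγ).2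
  have h3 : pairCount (fun t => (rectCell r s (γ t)).2) =
      ∑ g : Perm (Fin (r * s)) with g ∈ rowGroup r s,
      ∑ h : Perm (Fin (r * s)) with h ∈ colGroup r s,
      ∑ h' : Perm (Fin (r * s)) with h' ∈ colGroup r s,
        if γ * g * h * (γ⁻¹ * h') = 1 then
          ((Perm.sign h : ℤ) : ℚ) * ((Perm.sign h' : ℤ) : ℚ) else 0 :=
    Finset.sum_congr rfl fun g hg => Finset.sum_congr rfl fun h hh =>
      hterm γ hγ' g (Finset.mem_filter.1 hg).2 h (Finset.mem_filter.1 hh).2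
  rw [h3, Finset.sum_filter, Finset.sum_filter]
  refine Fintype.sum_equiv (Equiv.mulLeft γ) _ _ fun g => ?_
  simp only [Equiv.coe_mulLeft, (rowGroup r s).mul_mem_cancel_left hγ']
  congr!

/-- Pairing the Young symmetrizer with the Frobenius character: words with a repeated letter in some
row cancel, and on the other words every letter occurs `r` times, so that only the trivial
permutation of the exponents contributes. -/
theorem sum_coeff_youngElt_frob (r s : ℕ) :
    ∑ σ, (youngElt r s).coeff σ * (frob r s σ : ℚ) = hookProd r s := by
  classical
  have h1 : ∑ σ, (youngElt r s).coeff σ * (frob r s σ : ℚ) =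
      ∑ w : Perm (Fin s), ((Perm.sign w : ℤ) : ℚ) * ∑ f : Fin (r * s) → Fin s,
        if ∀ i, content f i + (w i : ℕ) = r + i then pairCount f else 0 := by
    have e := sum_coeff_youngElt_smul (r := r) (s := s) fun σ => (frob r s σ : ℚ)
    simp only [smul_eq_mul] at e
    rw [e]
    have e2 : ∀ g h : Perm (Fin (r * s)), ((Perm.sign h : ℤ) : ℚ) * (frob r s (g * h) : ℚ) =
        ∑ w : Perm (Fin s), ((Perm.sign w : ℤ) : ℚ) * ∑ f : Fin (r * s) → Fin s,
          if ∀ i, content f i + (w i : ℕ) = r + i then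
            (if f ∘ ⇑(g * h) = f then ((Perm.sign g : ℤ) : ℚ) else 0) else 0 := by
      intro g h
      rw [frob, Int.cast_mul, ← mul_assoc, Int.cast_sum, Finset.mul_sum]
      refine Finset.sum_congr rfl fun w _ => ?_
      have hs : ((Perm.sign h : ℤ) : ℚ) * ((Perm.sign (g * h) : ℤ) : ℚ) =
          ((Perm.sign g : ℤ) : ℚ) := by
        rw [Perm.sign_mul, ← Int.cast_mul, ← Units.val_mul, mul_left_comm, Int.units_mul_self,
          mul_one]
      rw [hs, Int.cast_mul, mul_left_comm]
      congr 1
      rw [Finset.card_filter, Nat.cast_sum, Int.cast_sum, Finset.mul_sum]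
      refine Finset.sum_congr rfl fun f _ => ?_
      by_cases hb : ∀ i, content f i + (w i : ℕ) = r + i
      · simp only [hb, implies_true, and_true, if_true, Nat.cast_ite, Nat.cast_one, Nat.cast_zero,
          Int.cast_ite, Int.cast_one, Int.cast_zero, mul_ite, mul_one, mul_zero]
      · simp [hb]
    simp only [e2]
    rw [Finset.sum_congr rfl fun g _ => Finset.sum_comm, Finset.sum_comm]
    refine Finset.sum_congr rfl fun w _ => ?_
    simp only [← Finset.mul_sum]
    congr 1
    rw [Finset.sum_congr rfl fun g _ => Finset.sum_comm, Finset.sum_comm]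
    refine Finset.sum_congr rfl fun f _ => ?_
    split_ifs
    · rfl
    · simp
  rw [h1, Finset.sum_eq_single 1]
  · rw [Perm.sign_one, Units.val_one, Int.cast_one, one_mul, ← sum_pairCount_rowGroup]
    symm
    have h2 : ∀ f : Fin (r * s) → Fin s, (if ∀ i, content f i + ((1 : Perm (Fin s)) i : ℕ) = r + i
        then pairCount f else 0) = if RowInjective f then pairCount f else 0 := by
      intro f
      by_cases hf : RowInjective f
      · rw [if_pos hf, if_pos fun i => by rw [content_of_rowInjective hf, Perm.one_apply]]
      · rw [if_neg hf, pairCount_eq_zero hf, ite_self]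
    simp only [h2]
    rw [← Finset.sum_filter]
    refine Finset.sum_bij (fun γ _ => fun t => (rectCell r s (γ t)).2) ?_ ?_ ?_ ?_
    · intro γ hγ
      exact Finset.mem_filter.2
        ⟨Finset.mem_univ _, rowInjective_of_mem_rowGroup (Finset.mem_filter.1 hγ).2⟩
    · intro γ hγ γ' hγ' h
      refine Equiv.ext fun t => (rectCell r s).injective (Prod.ext ?_ (congrFun h t))
      exact ((Finset.mem_filter.1 hγ).2 t).trans ((Finset.mem_filter.1 hγ').2 t).symm
    · intro f hf
      obtain ⟨g, hg, hgf⟩ := exists_rowGroup_of_rowInjective (Finset.mem_filter.1 hf).2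
      exact ⟨g, Finset.mem_filter.2 ⟨Finset.mem_univ _, hg⟩, funext hgf⟩
    · intro γ _
      rfl
  · intro w _ hw
    rw [Finset.sum_eq_zero, mul_zero]
    intro f _
    split_ifs with hc
    · refine pairCount_eq_zero fun hf => hw (Equiv.ext fun i => Fin.ext ?_)
      have := hc i
      rw [content_of_rowInjective hf] at this
      simpa using this
    · rfl
  · simp

/-- The class function of the Young symmetrizer is a multiple of the Frobenius character, since
the sum of the squares of the values of the difference vanishes. -/
theorem youngClass_eq (r s : ℕ) (σ : Perm (Fin (r * s))) :
    youngClass r s σ = hookProd r s * frob r s σ := by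
  have h1 := sum_youngClass_sq r s
  have h2 := sum_frob_sq r s
  have h3 := sum_youngClass_mul (r := r) (s := s) (fun σ => (frob r s σ : ℚ))
    fun σ τ => by rw [frob_conj]
  simp only [smul_eq_mul, nsmul_eq_mul] at h3
  rw [sum_coeff_youngElt_frob] at h3
  have h4 : ∑ σ, (youngClass r s σ - hookProd r s * frob r s σ) ^ 2 = 0 := by
    have : ∀ σ : Perm (Fin (r * s)), (youngClass r s σ - hookProd r s * frob r s σ) ^ 2 =
        youngClass r s σ ^ 2 - 2 * hookProd r s * (youngClass r s σ * frob r s σ) +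
          hookProd r s ^ 2 * (frob r s σ : ℚ) ^ 2 := fun σ => by ring
    rw [Finset.sum_congr rfl fun σ _ => this σ, Finset.sum_add_distrib, Finset.sum_sub_distrib,
      ← Finset.mul_sum, ← Finset.mul_sum, h1, h2, h3]
    ring
  rw [Finset.sum_eq_zero_iff_of_nonneg fun _ _ => sq_nonneg _] at h4
  have := h4 σ (Finset.mem_univ _)
  exact sub_eq_zero.1 (pow_eq_zero_iff two_ne_zero |>.1 this)

/-- The Jacobi–Trudi formula for the value of a multiplicative class function on the Young
symmetrizer of a rectangular diagram. -/
theorem sum_coeff_youngElt_cyc {S : Type*} [CommRing S] [Algebra ℚ S] (P : ℕ → S) (r s : ℕ) :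
    ∑ σ, (youngElt r s).coeff σ • cyc P σ =
      hookProd r s • (jacobiTrudi (newtonE P) r s).det := by
  have h := sum_youngClass_mul (r := r) (s := s) (cyc P) (cyc_conj P)
  have h2 := sum_frob_cyc P r s
  have h3 : ∀ σ : Perm (Fin (r * s)), youngClass r s σ • cyc P σ =
      hookProd r s • frob r s σ • cyc P σ := by
    intro σ
    rw [youngClass_eq, mul_smul, Int.cast_smul_eq_zsmul]
  rw [Finset.sum_congr rfl fun σ _ => h3 σ, ← Finset.smul_sum, h2, smul_comm,
    ← Nat.cast_smul_eq_nsmul ℚ, ← Nat.cast_smul_eq_nsmul ℚ] at h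
  have hf : ((r * s).factorial : ℚ) ≠ 0 := by exact_mod_cast Nat.factorial_ne_zero _
  rw [← inv_smul_smul₀ hf (∑ σ, _), ← h, inv_smul_smul₀ hf]

end YoungSymmetrizer

/-! ### Supertraces on direct summands of tensor powers -/

section SuperTrace

variable {R : Type u} [Ring R] [Algebra ℚ R] {𝒜 : ZMod 2 → Submodule ℚ R} [GradedAlgebra 𝒜]

/-- The conditions on the even and odd parts of a right `R`-module under which coordinates of
homogeneous elements in homogeneous bases are homogeneous. -/
structure IsSuperModule (𝒜 : ZMod 2 → Submodule ℚ R) {M : Type*} [AddCommGroup M] [Module Rᵐᵒᵖ M]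
    (ℳ : ZMod 2 → AddSubgroup M) : Prop where
  smul_mem : ∀ i j x a, x ∈ ℳ i → a ∈ 𝒜 j → MulOpposite.op a • x ∈ ℳ (i + j)
  eq_zero : ∀ i x, x ∈ ℳ i → x ∈ ℳ (i + 1) → x = 0

theorem zmod2_eq_or (i j : ZMod 2) : j = i ∨ j = i + 1 := by revert i j; decide

theorem exists_add_of_zmod2 (i : ZMod 2) (x : R) : ∃ y ∈ 𝒜 i, ∃ z ∈ 𝒜 (i + 1), x = y + z := by
  classical
  refine ⟨_, (DirectSum.decompose 𝒜 x i).2, _, (DirectSum.decompose 𝒜 x (i + 1)).2, ?_⟩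
  conv_lhs => rw [← DirectSum.sum_support_decompose 𝒜 x]
  have hne : ∀ i : ZMod 2, i ≠ i + 1 := by decide
  have h : ∀ f : ZMod 2 → R, ∑ j, f j = f i + f (i + 1) := by
    intro f
    have : (Finset.univ : Finset (ZMod 2)) = {i, i + 1} := by
      ext j; simpa using zmod2_eq_or i j
    rw [this, Finset.sum_pair (hne i)]
  rw [← h fun j => ((DirectSum.decompose 𝒜 x j : 𝒜 j) : R)]
  refine Finset.sum_subset (Finset.subset_univ _) fun j _ hj => ?_
  simpa using hj

theorem eq_zero_of_mem_of_mem (i : ZMod 2) {x : R} (h1 : x ∈ 𝒜 i) (h2 : x ∈ 𝒜 (i + 1)) :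
    x = 0 := by
  have hne : ∀ i : ZMod 2, i + 1 ≠ i := by decide
  have e1 := DirectSum.decompose_of_mem_same 𝒜 h1
  have e2 := DirectSum.decompose_of_mem_ne 𝒜 h2 (j := i) (hne i)
  rw [← e1, e2]

variable {M : Type u} [AddCommGroup M] [Module Rᵐᵒᵖ M] {ℳ : ZMod 2 → AddSubgroup M}

/-- The coordinates of a homogeneous element in a homogeneous basis are homogeneous: the components
of the wrong parity form an element that is both even and odd. -/
theorem IsSuperModule.repr_mem (hℳ : IsSuperModule 𝒜 ℳ) {n : ℕ} {π : Fin n → ZMod 2}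
    (b : Module.Basis (Fin n) Rᵐᵒᵖ M) (hb : ∀ k, b k ∈ ℳ (π k)) {i : ZMod 2} {x : M}
    (hx : x ∈ ℳ i) (k : Fin n) : MulOpposite.unop (b.repr x k) ∈ 𝒜 (i + π k) := by
  choose y hy z hz hyz using fun k => exists_add_of_zmod2 (𝒜 := 𝒜) (i + π k)
    (MulOpposite.unop (b.repr x k))
  have hz2 : ∀ a j : ZMod 2, a + (j + a) = j := by decide
  have hmem : ∀ (j : ZMod 2) (c : Fin n → R), (∀ k, c k ∈ 𝒜 (j + π k)) →
      ∑ k, MulOpposite.op (c k) • b k ∈ ℳ j := by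
    intro j c hc
    refine AddSubgroup.sum_mem _ fun k _ => ?_
    have := hℳ.smul_mem _ _ _ _ (hb k) (hc k)
    rwa [show π k + (j + π k) = j from hz2 _ _] at this
  have hsum : x = ∑ k, MulOpposite.op (y k) • b k + ∑ k, MulOpposite.op (z k) • b k := by
    rw [← Finset.sum_add_distrib]
    conv_lhs => rw [← b.sum_repr x]
    refine Finset.sum_congr rfl fun k _ => ?_
    rw [← add_smul, ← MulOpposite.op_add, ← hyz, MulOpposite.op_unop]
  have h1 : ∑ k, MulOpposite.op (z k) • b k ∈ ℳ (i + 1) := hmem _ _ fun k => by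
    have := hz k
    rwa [show i + π k + 1 = i + 1 + π k by ring] at this
  have h2 : ∑ k, MulOpposite.op (z k) • b k ∈ ℳ i := by
    have : ∑ k, MulOpposite.op (z k) • b k = x - ∑ k, MulOpposite.op (y k) • b k := by
      rw [hsum]; abel
    rw [this]
    exact AddSubgroup.sub_mem _ hx (hmem _ _ hy)
  have h3 := hℳ.eq_zero _ _ h2 h1
  have h4 := Fintype.linearIndependent_iff.1 b.linearIndependent _ h3 k
  have h5 : z k = 0 := by simpa using h4
  rw [hyz, h5, add_zero]
  exact hy k

/-- The supertrace of an even operator does not depend on the homogeneous basis. -/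
theorem IsSuperModule.hasSuperTrace_unique [SuperCommutative 𝒜] (hℳ : IsSuperModule 𝒜 ℳ)
    {f : M →ₗ[Rᵐᵒᵖ] M} (hf : ∀ i x, x ∈ ℳ i → f x ∈ ℳ i) {t t' : R}
    (h : HasSuperTrace ℳ f t) (h' : HasSuperTrace ℳ f t') : t = t' := by
  obtain ⟨n, π, b, hb, rfl⟩ := h
  obtain ⟨n', π', b', hb', rfl⟩ := h'
  have e1 : ∀ k, MulOpposite.unop (b.repr (f (b k)) k) = ∑ l,
      MulOpposite.unop (b.repr (b' l) k) * MulOpposite.unop (b'.repr (f (b k)) l) := by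
    intro k
    conv_lhs => rw [← b'.sum_repr (f (b k))]
    rw [map_sum, Finsupp.finsetSum_apply, Finset.unop_sum]
    refine Finset.sum_congr rfl fun l _ => ?_
    rw [map_smul, Finsupp.smul_apply, smul_eq_mul, MulOpposite.unop_mul]
  have e2 : ∀ l, MulOpposite.unop (b'.repr (f (b' l)) l) = ∑ k,
      MulOpposite.unop (b'.repr (f (b k)) l) * MulOpposite.unop (b.repr (b' l) k) := by
    intro l
    conv_lhs => rw [← b.sum_repr (b' l)]
    rw [map_sum, map_sum, Finsupp.finsetSum_apply, Finset.unop_sum]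
    refine Finset.sum_congr rfl fun k _ => ?_
    rw [map_smul, map_smul, Finsupp.smul_apply, smul_eq_mul, MulOpposite.unop_mul]
  simp only [e1, e2, Finset.smul_sum]
  rw [Finset.sum_comm]
  refine Finset.sum_congr rfl fun l _ => Finset.sum_congr rfl fun k _ => ?_
  have h1 := hℳ.repr_mem b hb (hb' l) k
  have h2 := hℳ.repr_mem b' hb' (hf _ _ (hb k)) l
  rw [SuperCommutative.mul_comm' _ _ _ _ h1 h2, smul_smul, ← uzpow_add]
  congr 2
  generalize π k = x
  generalize π' l = y
  revert x y
  decide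

/-- The action of a rational matrix on the vectors with coordinates in `R`. -/
def matAct (R : Type*) [Ring R] [Algebra ℚ R] {m n : Type*} [Fintype n] (K : Matrix m n ℚ) :
    (n → R) →ₗ[Rᵐᵒᵖ] (m → R) where
  toFun x := fun w => ∑ w', K w w' • x w'
  map_add' x y := by ext w; simp [Finset.sum_add_distrib]
  map_smul' r x := by ext w; simp [Finset.sum_mul]

theorem matAct_apply {m n : Type*} [Fintype n] (K : Matrix m n ℚ) (x : n → R) (w : m) :
    matAct R K x w = ∑ w', K w w' • x w' := rfl

theorem matAct_mul {l m n : Type*} [Fintype m] [Fintype n] (K : Matrix l m ℚ) (L : Matrix m n ℚ)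
    (x : n → R) : matAct R (K * L) x = matAct R K (matAct R L x) := by
  ext w
  simp only [matAct_apply, Matrix.mul_apply, Finset.sum_smul, Finset.smul_sum, mul_smul]
  exact Finset.sum_comm

theorem matAct_one {n : Type*} [Fintype n] [DecidableEq n] (x : n → R) :
    matAct R (1 : Matrix n n ℚ) x = x := by
  ext w
  simp [matAct_apply, Matrix.one_apply]

theorem matAct_single {m n : Type*} [Fintype n] [DecidableEq n] (K : Matrix m n ℚ) (j : n) (w : m) :
    matAct R K (Pi.single j 1) w = K w j • (1 : R) := by
  rw [matAct_apply, Finset.sum_eq_single j]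
  · simp
  · intro i _ hi
    simp [hi]
  · simp

/-- The rank factorization of an idempotent matrix. -/
theorem exists_rank_factorization {W : Type*} [Fintype W] [DecidableEq W] (K : Matrix W W ℚ)
    (hK : K * K = K) : ∃ (n : ℕ) (B : Matrix W (Fin n) ℚ) (C : Matrix (Fin n) W ℚ),
      C * B = 1 ∧ B * C = K := by
  let f := K.toLin'
  let b := Module.finBasis ℚ (LinearMap.range f)
  let B := (LinearMap.range f).subtype ∘ₗ b.equivFun.symm.toLinearMap
  let C := b.equivFun.toLinearMap ∘ₗ f.rangeRestrict
  have hf : ∀ y : LinearMap.range f, f y = y := by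
    rintro ⟨_, x, rfl⟩
    have h := Matrix.toLin'_mul K K
    rw [hK] at h
    exact (LinearMap.congr_fun h x).symm
  refine ⟨_, LinearMap.toMatrix' B, LinearMap.toMatrix' C, ?_, ?_⟩
  · rw [← LinearMap.toMatrix'_comp, ← LinearMap.toMatrix'_id]
    congr 1
    refine LinearMap.ext fun x => ?_
    have : f.rangeRestrict (b.equivFun.symm x : LinearMap.range f) = b.equivFun.symm x :=
      Subtype.ext (hf _)
    simp only [B, C, LinearMap.comp_apply, LinearEquiv.coe_coe, Submodule.subtype_apply, this,
      LinearEquiv.apply_symm_apply, LinearMap.id_apply]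
  · rw [← LinearMap.toMatrix'_comp]
    have : B ∘ₗ C = f := by
      refine LinearMap.ext fun x => ?_
      simp [B, C]
    rw [this]
    exact LinearMap.toMatrix'_toLin' K

/-- The rank factorization of an idempotent matrix that preserves parity. -/
theorem exists_graded_rank_factorization {W : Type*} [Fintype W] [DecidableEq W] (wp : W → ZMod 2)
    (K : Matrix W W ℚ) (hK : K * K = K) (hp : ∀ w w', wp w ≠ wp w' → K w w' = 0) :
    ∃ (n : ℕ) (π : Fin n → ZMod 2) (B : Matrix W (Fin n) ℚ) (C : Matrix (Fin n) W ℚ),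
      C * B = 1 ∧ B * C = K ∧ (∀ w k, wp w ≠ π k → B w k = 0) ∧
      ∀ k w, wp w ≠ π k → C k w = 0 := by
  let D : ZMod 2 → Matrix W W ℚ := fun i => Matrix.diagonal fun w => if wp w = i then 1 else 0
  have hDD : ∀ i, D i * D i = D i := by
    intro i
    simp only [D, Matrix.diagonal_mul_diagonal]
    congr 1; funext w; split_ifs <;> simp
  have hDne : D 0 * D 1 = 0 ∧ D 1 * D 0 = 0 := by
    constructor <;>
    · simp only [D, Matrix.diagonal_mul_diagonal]
      rw [← Matrix.diagonal_zero]
      congr 1; funext w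
      rcases (by decide : ∀ a : ZMod 2, a = 0 ∨ a = 1) (wp w) with h | h <;> simp [h]
  have hcomm : ∀ i, D i * K = K * D i := by
    intro i
    ext w w'
    simp only [D, Matrix.diagonal_mul, Matrix.mul_diagonal]
    by_cases h : wp w = wp w'
    · rw [h, mul_comm]
    · rw [hp w w' h]; simp
  have hsum : D 0 + D 1 = 1 := by
    simp only [D, Matrix.diagonal_add]
    rw [← Matrix.diagonal_one]
    congr 1; funext w
    rcases (by decide : ∀ a : ZMod 2, a = 0 ∨ a = 1) (wp w) with h | h <;> simp [h]
  have hid : ∀ i, (D i * K) * (D i * K) = D i * K := by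
    intro i
    calc D i * K * (D i * K) = D i * (K * D i) * K := by simp only [mul_assoc]
      _ = (D i * D i) * (K * K) := by rw [← hcomm]; simp only [mul_assoc]
      _ = D i * K := by rw [hDD, hK]
  obtain ⟨n0, B0, C0, hCB0, hBC0⟩ := exists_rank_factorization _ (hid 0)
  obtain ⟨n1, B1, C1, hCB1, hBC1⟩ := exists_rank_factorization _ (hid 1)
  have hB : ∀ (i : ZMod 2) (n : ℕ) (B : Matrix W (Fin n) ℚ) (C : Matrix (Fin n) W ℚ),
      C * B = 1 → B * C = D i * K → D i * B = B ∧ C * D i = C := by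
    intro i n B C h1 h2
    constructor
    · calc D i * B = D i * (B * (C * B)) := by rw [h1, Matrix.mul_one]
        _ = D i * (D i * K) * B := by rw [← h2]; simp only [Matrix.mul_assoc]
        _ = B * (C * B) := by rw [← Matrix.mul_assoc (D i), hDD, ← h2, Matrix.mul_assoc]
        _ = B := by rw [h1, Matrix.mul_one]
    · calc C * D i = C * B * C * D i := by rw [h1, Matrix.one_mul]
        _ = C * (D i * K * D i) := by rw [← h2]; simp only [Matrix.mul_assoc]
        _ = C * (D i * K) := by rw [hcomm, Matrix.mul_assoc K, hDD]
        _ = C * B * C := by rw [← h2, Matrix.mul_assoc]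
        _ = C := by rw [h1, Matrix.one_mul]
  obtain ⟨hB0, hC0⟩ := hB 0 _ _ _ hCB0 hBC0
  obtain ⟨hB1, hC1⟩ := hB 1 _ _ _ hCB1 hBC1
  have h01 : C0 * B1 = 0 := by
    rw [← hC0, ← hB1, Matrix.mul_assoc, ← Matrix.mul_assoc (D 0), hDne.1, Matrix.zero_mul,
      Matrix.mul_zero]
  have h10 : C1 * B0 = 0 := by
    rw [← hC1, ← hB0, Matrix.mul_assoc, ← Matrix.mul_assoc (D 1), hDne.2, Matrix.zero_mul,
      Matrix.mul_zero]
  have hBz : ∀ (i : ZMod 2) (n : ℕ) (B : Matrix W (Fin n) ℚ), D i * B = B →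
      ∀ w k, wp w ≠ i → B w k = 0 := by
    intro i n B h w k hw
    rw [← h, Matrix.diagonal_mul, if_neg hw, zero_mul]
  have hCz : ∀ (i : ZMod 2) (n : ℕ) (C : Matrix (Fin n) W ℚ), C * D i = C →
      ∀ k w, wp w ≠ i → C k w = 0 := by
    intro i n C h k w hw
    rw [← h, Matrix.mul_diagonal, if_neg hw, mul_zero]
  let e := (finSumFinEquiv (m := n0) (n := n1)).symm
  refine ⟨n0 + n1, fun k => Sum.elim (fun _ => 0) (fun _ => 1) (e k),
    (Matrix.fromCols B0 B1).submatrix id e, (Matrix.fromRows C0 C1).submatrix e id, ?_, ?_, ?_, ?_⟩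
  · rw [← Matrix.submatrix_mul _ _ e id e Function.bijective_id, Matrix.fromRows_mul_fromCols, hCB0,
      hCB1, h01, h10, Matrix.fromBlocks_one, Matrix.submatrix_one_equiv]
  · rw [Matrix.submatrix_mul_equiv, Matrix.fromCols_mul_fromRows, hBC0, hBC1, ← add_mul, hsum,
      one_mul, Matrix.submatrix_id_id]
  · intro w k
    simp only [Matrix.submatrix_apply, id]
    rcases e k with k | k
    · exact hBz 0 _ _ hB0 w k
    · exact hBz 1 _ _ hB1 w k
  · intro k w
    simp only [Matrix.submatrix_apply, id]
    rcases e k with k | k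
    · exact hCz 0 _ _ hC0 k w
    · exact hCz 1 _ _ hC1 k w

variable {p q k : ℕ}

/-- The supertrace of an operator on a tensor power, computed in the standard basis. -/
def wordTrace (f : TensorPow R p q k →ₗ[Rᵐᵒᵖ] TensorPow R p q k) : R :=
  ∑ w, ((-1 : ℤˣ) ^ wordPar w) • f (Pi.single w 1) w

theorem tensorGrading_op_smul {i j : ZMod 2} {x : TensorPow R p q k} {a : R}
    (hx : x ∈ tensorGrading 𝒜 p q k i) (ha : a ∈ 𝒜 j) :
    MulOpposite.op a • x ∈ tensorGrading 𝒜 p q k (i + j) := by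
  intro w
  have := SetLike.GradedMul.mul_mem (hx w) ha
  rw [show i + wordPar w + j = i + j + wordPar w by ring] at this
  exact this

/-- The supertrace on a direct summand of a tensor power cut out by a rational idempotent matrix
`K` that preserves parity: a homogeneous basis exists already over `ℚ`. -/
theorem superTrace_of_retract [SuperCommutative 𝒜]
    (K : Matrix (Fin k → Fin p ⊕ Fin q) (Fin k → Fin p ⊕ Fin q) ℚ) (hK : K * K = K)
    (hp : ∀ w w', wordPar w ≠ wordPar w' → K w w' = 0)
    (ι : M →ₗ[Rᵐᵒᵖ] TensorPow R p q k) (ρ : TensorPow R p q k →ₗ[Rᵐᵒᵖ] M)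
    (hρι : ∀ x, ρ (ι x) = x) (hιρ : ∀ x, ι (ρ x) = matAct R K x)
    (hι : ∀ i x, x ∈ ℳ i → ι x ∈ tensorGrading 𝒜 p q k i)
    (hρ : ∀ i x, x ∈ tensorGrading 𝒜 p q k i → ρ x ∈ ℳ i)
    (T : TensorPow R p q k →ₗ[Rᵐᵒᵖ] TensorPow R p q k)
    (hT : ∀ i x, x ∈ tensorGrading 𝒜 p q k i → T x ∈ tensorGrading 𝒜 p q k i)
    (f : M →ₗ[Rᵐᵒᵖ] M) (hf : ∀ x, f x = ρ (T (ι x))) :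
    superTrace ℳ f = wordTrace (T ∘ₗ matAct R K) := by
  obtain ⟨n, π, B, C, hCB, hBC, hB, hC⟩ := exists_graded_rank_factorization wordPar K hK hp
  have hℳ : IsSuperModule 𝒜 ℳ := by
    constructor
    · intro i j x a hx ha
      rw [← hρι (MulOpposite.op a • x), map_smul]
      exact hρ _ _ (tensorGrading_op_smul (hι _ _ hx) ha)
    · intro i x h1 h2
      have : ι x = 0 := by
        funext w
        refine eq_zero_of_mem_of_mem (𝒜 := 𝒜) (i + wordPar w) (hι _ _ h1 w) ?_
        rw [show i + wordPar w + 1 = i + 1 + wordPar w by ring]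
        exact hι _ _ h2 w
      rw [← hρι x, this, map_zero]
  have hfe : ∀ i x, x ∈ ℳ i → f x ∈ ℳ i := by
    intro i x hx
    rw [hf]
    exact hρ _ _ (hT _ _ (hι _ _ hx))
  -- the columns of `B` give a homogeneous basis, with coordinates given by `C`
  let e : M ≃ₗ[Rᵐᵒᵖ] (Fin n → Rᵐᵒᵖ) :=
    { toFun := fun x => fun j => MulOpposite.op (matAct R C (ι x) j)
      invFun := fun y => ρ (matAct R B fun j => MulOpposite.unop (y j))
      map_add' := fun x y => by ext j; simp
      map_smul' := fun a x => by ext j; simp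
      left_inv := fun x => by
        simp only [MulOpposite.unop_op]
        rw [← matAct_mul, hBC, ← hιρ, hρι, hρι]
      right_inv := fun y => by
        funext j
        change MulOpposite.op (matAct R C (ι (ρ _)) j) = _
        rw [hιρ, ← hBC, ← matAct_mul, ← matAct_mul, ← Matrix.mul_assoc, hCB, Matrix.one_mul, hCB,
          matAct_one, MulOpposite.op_unop] }
  let b := Module.Basis.ofEquivFun e
  have hbk : ∀ j, b j = ρ (matAct R B (Pi.single j 1)) := by
    intro j
    rw [Module.Basis.coe_ofEquivFun]
    change ρ (matAct R B _) = _
    congr 2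
    funext l
    by_cases h : l = j
    · subst h; simp
    · simp [h]
  have hrepr : ∀ x j, MulOpposite.unop (b.repr x j) = matAct R C (ι x) j := fun x j => rfl
  have hb : ∀ j, b j ∈ ℳ (π j) := by
    intro j
    rw [hbk]
    refine hρ _ _ fun w => ?_
    rw [matAct_single]
    by_cases h : wordPar w = π j
    · rw [h, zmod2_add_self]
      exact (𝒜 0).smul_mem _ SetLike.GradedOne.one_mem
    · rw [hB w j h, zero_smul]
      exact (𝒜 _).zero_mem
  have htr : HasSuperTrace ℳ f (wordTrace (T ∘ₗ matAct R K)) := by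
    refine ⟨n, π, b, hb, ?_⟩
    have h1 : ∀ j, MulOpposite.unop (b.repr (f (b j)) j) =
        ∑ w, ∑ w', C j w • B w' j • T (Pi.single w' 1) w := by
      intro j
      have h2 : (matAct R B (Pi.single j 1) : TensorPow R p q k) =
          ∑ w', B w' j • (Pi.single w' (1 : R) : TensorPow R p q k) := by
        funext w
        rw [matAct_single, Finset.sum_apply, Finset.sum_eq_single w]
        · simp
        · intro w' _ h
          simp [Ne.symm h]
        · simp
      rw [hrepr, hf, hbk, hιρ, hιρ, ← hBC, ← matAct_mul, ← matAct_mul,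
        Matrix.mul_assoc, hCB, Matrix.mul_one, ← Matrix.mul_assoc, hCB, Matrix.one_mul, h2, map_sum,
        matAct_apply]
      refine Finset.sum_congr rfl fun w _ => ?_
      rw [Finset.sum_apply, Finset.smul_sum]
      refine Finset.sum_congr rfl fun w' _ => ?_
      rw [map_rat_smul, Pi.smul_apply]
    have h3 : ∀ w, T (matAct R K (Pi.single w 1)) w =
        ∑ w', K w' w • T (Pi.single w' 1) w := by
      intro w
      have h2 : (matAct R K (Pi.single w 1) : TensorPow R p q k) =
          ∑ w', K w' w • (Pi.single w' (1 : R) : TensorPow R p q k) := by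
        funext v
        rw [matAct_single, Finset.sum_apply, Finset.sum_eq_single v]
        · simp
        · intro w' _ h
          simp [Ne.symm h]
        · simp
      rw [h2, map_sum, Finset.sum_apply]
      refine Finset.sum_congr rfl fun w' _ => ?_
      rw [map_rat_smul, Pi.smul_apply]
    simp only [wordTrace, LinearMap.comp_apply, h1, h3, Finset.smul_sum]
    symm
    rw [Finset.sum_comm]
    refine Finset.sum_congr rfl fun w _ => ?_
    rw [Finset.sum_comm]
    refine Finset.sum_congr rfl fun w' _ => ?_
    rw [← hBC, Matrix.mul_apply, Finset.sum_smul, Finset.smul_sum]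
    refine Finset.sum_congr rfl fun j _ => ?_
    by_cases h : wordPar w = π j
    · rw [h, smul_smul (C j w), mul_comm]
    · rw [hC j w h, zero_smul, mul_zero, zero_smul, smul_zero, smul_zero]
  have hex : ∃ t, HasSuperTrace ℳ f t := ⟨_, htr⟩
  rw [superTrace, dif_pos hex]
  exact hℳ.hasSuperTrace_unique hfe hex.choose_spec htr

end SuperTrace

/-! ### Traces of permutations composed with the tensor powers of an operator -/

section PermTrace

open Equiv

variable {R : Type u} [Ring R] [Algebra ℚ R] {𝒜 : ZMod 2 → Submodule ℚ R} [GradedAlgebra 𝒜]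
  [SuperCommutative 𝒜] {p q : ℕ}

omit [GradedAlgebra 𝒜] [SuperCommutative 𝒜] in
theorem uzpow_smul_mem {i j : ZMod 2} {x : R} (hx : x ∈ 𝒜 i) : ((-1 : ℤˣ) ^ j) • x ∈ 𝒜 i := by
  rcases Int.units_eq_one_or ((-1 : ℤˣ) ^ j) with h | h <;> rw [h]
  · rwa [one_smul]
  · rw [Units.neg_smul, one_smul]
    exact (𝒜 i).neg_mem hx

/-- The rational matrix of a permutation acting on words by the sign rule. -/
def permMat (p q : ℕ) {k : ℕ} (σ : Perm (Fin k)) :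
    Matrix (Fin k → Fin p ⊕ Fin q) (Fin k → Fin p ⊕ Fin q) ℚ :=
  Matrix.of fun w w' => if w' = w ∘ σ then
    ((((-1 : ℤˣ) ^ koszulExp σ (fun s => par (w (σ s))) : ℤˣ) : ℤ) : ℚ) else 0

theorem intUnits_cast_smul {M : Type*} [AddCommGroup M] [Module ℚ M] (z : ℤˣ) (x : M) :
    (((z : ℤ) : ℚ)) • x = z • x := by
  rw [Int.cast_smul_eq_zsmul, Units.smul_def]

theorem matAct_permMat {k : ℕ} (σ : Perm (Fin k)) (x : TensorPow R p q k) :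
    matAct R (permMat p q σ) x = permAct R p q σ x := by
  funext w
  rw [matAct_apply, Finset.sum_eq_single (w ∘ σ)]
  · simp only [permMat, Matrix.of_apply, if_true, intUnits_cast_smul]
    rfl
  · intro w' _ h
    simp [permMat, h]
  · simp

theorem permMat_mul {k : ℕ} (σ τ : Perm (Fin k)) :
    permMat p q (σ * τ) = permMat p q σ * permMat p q τ := by
  ext w w'
  rw [Matrix.mul_apply, Finset.sum_eq_single (w ∘ σ)]
  · have := koszulExp_mul σ τ fun s => par (w s)
    simp only [permMat, Matrix.of_apply, if_true]
    by_cases h : w' = w ∘ ⇑(σ * τ)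
    · have h' : w' = (w ∘ σ) ∘ τ := h
      rw [if_pos h, if_pos h', show (koszulExp (σ * τ) fun s => par (w ((σ * τ) s))) = _ from this,
        add_comm, uzpow_add]
      push_cast
      rfl
    · have h' : ¬w' = (w ∘ σ) ∘ τ := h
      rw [if_neg h, if_neg h', mul_zero]
  · intro v _ h
    simp [permMat, h]
  · simp

theorem permMat_one (k : ℕ) : permMat p q (1 : Perm (Fin k)) = 1 := by
  ext w w'
  simp [permMat, koszulExp_one, Matrix.one_apply, eq_comm]

/-- The representation of the group algebra of the symmetric group by rational matrices. -/
def permRep (p q k : ℕ) : MonoidAlgebra ℚ (Perm (Fin k)) →ₐ[ℚ]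
    Matrix (Fin k → Fin p ⊕ Fin q) (Fin k → Fin p ⊕ Fin q) ℚ :=
  MonoidAlgebra.lift ℚ _ _
    { toFun := permMat p q, map_one' := permMat_one k, map_mul' := permMat_mul }

theorem permRep_of {k : ℕ} (σ : Perm (Fin k)) :
    permRep p q k (MonoidAlgebra.of ℚ _ σ) = permMat p q σ := by
  simp [permRep]

theorem permRep_apply {k : ℕ} (y : MonoidAlgebra ℚ (Perm (Fin k))) :
    permRep p q k y = ∑ σ, y.coeff σ • permMat p q σ := by
  conv_lhs => rw [← sum_coeff_smul_of y]
  rw [map_sum]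
  refine Finset.sum_congr rfl fun σ _ => ?_
  rw [map_smul, permRep_of]

theorem wordPar_comp {k : ℕ} (w : Fin k → Fin p ⊕ Fin q) (σ : Perm (Fin k)) :
    wordPar (w ∘ σ) = wordPar w := Equiv.sum_comp σ fun s => par (w s)

theorem permRep_parity {k : ℕ} (y : MonoidAlgebra ℚ (Perm (Fin k)))
    (w w' : Fin k → Fin p ⊕ Fin q) (h : wordPar w ≠ wordPar w') : permRep p q k y w w' = 0 := by
  rw [permRep_apply, Matrix.sum_apply]
  refine Finset.sum_eq_zero fun σ _ => ?_
  have : w' ≠ w ∘ σ := fun e => h (by rw [e, wordPar_comp])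
  simp [permMat, this]

theorem matAct_permRep {k : ℕ} (y : MonoidAlgebra ℚ (Perm (Fin k))) (x : TensorPow R p q k) :
    matAct R (permRep p q k y) x = ∑ σ, y.coeff σ • permAct R p q σ x := by
  funext w
  rw [Finset.sum_apply, permRep_apply]
  simp only [← matAct_permMat, matAct_apply, Matrix.sum_apply, Matrix.smul_apply, Finset.sum_smul,
    Pi.smul_apply, Finset.smul_sum, smul_assoc]
  exact Finset.sum_comm

omit [GradedAlgebra 𝒜] [SuperCommutative 𝒜] in
theorem permAct_mem_tensorGrading {k : ℕ} (σ : Perm (Fin k)) {i : ZMod 2} {x : TensorPow R p q k}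
    (hx : x ∈ tensorGrading 𝒜 p q k i) : permAct R p q σ x ∈ tensorGrading 𝒜 p q k i := by
  intro w
  have := hx (w ∘ σ)
  rw [wordPar_comp] at this
  exact uzpow_smul_mem this

omit [GradedAlgebra 𝒜] [SuperCommutative 𝒜] in
theorem matAct_permRep_mem_tensorGrading {k : ℕ} (y : MonoidAlgebra ℚ (Perm (Fin k))) {i : ZMod 2}
    {x : TensorPow R p q k} (hx : x ∈ tensorGrading 𝒜 p q k i) :
    matAct R (permRep p q k y) x ∈ tensorGrading 𝒜 p q k i := by
  rw [matAct_permRep]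
  intro w
  rw [Finset.sum_apply]
  exact (𝒜 _).sum_mem fun σ _ => (𝒜 _).smul_mem _ (permAct_mem_tensorGrading σ hx w)

theorem wordPar_add {k : ℕ} (w w' : Fin k → Fin p ⊕ Fin q) :
    ∑ s, (par (w s) + par (w' s)) = wordPar w + wordPar w' := Finset.sum_add_distrib

omit [SuperCommutative 𝒜] in
theorem prod_entries_mem (A : EvenOperator 𝒜 p q) {k : ℕ} (w w' : Fin k → Fin p ⊕ Fin q) :
    (List.ofFn fun s => A.mat (w s) (w' s)).prod ∈ 𝒜 (wordPar w + wordPar w') := by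
  have := SetLike.list_prod_ofFn_mem_graded (A := 𝒜) (fun s => par (w s) + par (w' s))
    (fun s => A.mat (w s) (w' s)) fun s => A.mem _ _
  rwa [List.sum_ofFn, wordPar_add] at this

omit [SuperCommutative 𝒜] in
theorem tensorMap_mem_tensorGrading (A : EvenOperator 𝒜 p q) {k : ℕ} (i : ZMod 2)
    (x : TensorPow R p q k) (hx : x ∈ tensorGrading 𝒜 p q k i) :
    tensorMap A k x ∈ tensorGrading 𝒜 p q k i := by
  intro w
  refine (𝒜 _).sum_mem fun j _ => ?_
  have h := SetLike.GradedMul.mul_mem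
    (uzpow_smul_mem (j := tensorExp w j) (prod_entries_mem A w j)) (hx j)
  have e : ∀ a b c : ZMod 2, a + b + (c + b) = c + a := by decide
  rwa [e] at h

omit [Algebra ℚ R] in
theorem permAct_single {k : ℕ} (σ : Perm (Fin k)) (w : Fin k → Fin p ⊕ Fin q) :
    permAct R p q σ (Pi.single w 1) = ((-1 : ℤˣ) ^ koszulExp σ (fun s => par (w s))) •
      (Pi.single (w ∘ ⇑σ⁻¹) (1 : R) : TensorPow R p q k) := by
  funext v
  change ((-1 : ℤˣ) ^ koszulExp σ (fun s => par (v (σ s)))) •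
    (Pi.single w 1 : TensorPow R p q k) (v ∘ σ) = _
  by_cases h : v ∘ σ = w
  · subst h
    have : (v ∘ ⇑σ) ∘ ⇑σ⁻¹ = v := by ext1 i; simp
    rw [Pi.single_eq_same, this, Pi.smul_apply, Pi.single_eq_same]
    rfl
  · have : v ≠ w ∘ ⇑σ⁻¹ := fun e => h (by rw [e]; ext1 i; simp)
    rw [Pi.single_eq_of_ne h, Pi.smul_apply, Pi.single_eq_of_ne this, smul_zero, smul_zero]

omit [Algebra ℚ R] in
theorem map_uzpow_smul {M N : Type*} [AddCommGroup M] [AddCommGroup N] [Module Rᵐᵒᵖ M]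
    [Module Rᵐᵒᵖ N] (f : M →ₗ[Rᵐᵒᵖ] N) (z : ℤˣ) (x : M) : f (z • x) = z • f x := by
  rw [Units.smul_def, Units.smul_def, map_zsmul]

omit [Algebra ℚ R] in
theorem wordTrace_comp_permAct {k : ℕ} (f : TensorPow R p q k →ₗ[Rᵐᵒᵖ] TensorPow R p q k)
    (τ : Perm (Fin k)) : wordTrace (f ∘ₗ permAct R p q τ) = wordTrace (permAct R p q τ ∘ₗ f) := by
  unfold wordTrace
  refine Fintype.sum_equiv (Equiv.arrowCongr τ (Equiv.refl _)) _ _ fun w => ?_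
  have hw : Equiv.arrowCongr τ (Equiv.refl (Fin p ⊕ Fin q)) w = w ∘ ⇑τ⁻¹ := rfl
  have hw2 : (w ∘ ⇑τ⁻¹) ∘ ⇑τ = w := by ext1 i; simp
  rw [hw, wordPar_comp, LinearMap.comp_apply, permAct_single, map_uzpow_smul, Pi.smul_apply]
  congr 1
  change _ = ((-1 : ℤˣ) ^ koszulExp τ (fun s => par ((w ∘ ⇑τ⁻¹) (τ s)))) •
    f (Pi.single (w ∘ ⇑τ⁻¹) 1) ((w ∘ ⇑τ⁻¹) ∘ τ)
  rw [hw2]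
  simp

theorem permAct_mul {k : ℕ} (σ τ : Perm (Fin k)) (x : TensorPow R p q k) :
    permAct R p q (σ * τ) x = permAct R p q σ (permAct R p q τ x) := by
  rw [← matAct_permMat, permMat_mul, matAct_mul, matAct_permMat, matAct_permMat]

/-- The exponent of the sign with which the product of the entries `A_{w s, w (σ⁻¹ s)}` occurs in
the supertrace of `A^{⊗k} σ`. -/
def traceExp {k : ℕ} (σ : Perm (Fin k)) (w : Fin k → Fin p ⊕ Fin q) : ZMod 2 :=
  wordPar w + (koszulExp σ (fun s => par (w s)) + tensorExp w (w ∘ ⇑σ⁻¹))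

omit [GradedAlgebra 𝒜] [SuperCommutative 𝒜] in
theorem wordTrace_tensorMap_permAct (A : EvenOperator 𝒜 p q) {k : ℕ} (σ : Perm (Fin k)) :
    wordTrace (tensorMap A k ∘ₗ permAct R p q σ) = ∑ w : Fin k → Fin p ⊕ Fin q,
      ((-1 : ℤˣ) ^ traceExp σ w) • (List.ofFn fun s => A.mat (w s) (w (σ⁻¹ s))).prod := by
  refine Finset.sum_congr rfl fun w _ => ?_
  rw [LinearMap.comp_apply, permAct_single, map_uzpow_smul, Pi.smul_apply, traceExp, uzpow_add,
    uzpow_add, mul_smul, mul_smul]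
  congr 2
  change ∑ j : Fin k → Fin p ⊕ Fin q, _ = _
  rw [Finset.sum_eq_single (w ∘ ⇑σ⁻¹)]
  · rw [Pi.single_eq_same, mul_one]
    rfl
  · intro j _ h
    rw [Pi.single_eq_of_ne h, mul_zero]
  · simp

/-- The supertrace of `A^{⊗k} σ`, an element of the even part of `R`. -/
def permTrace (A : EvenOperator 𝒜 p q) (k : ℕ) (σ : Perm (Fin k)) : 𝒜 0 :=
  ⟨wordTrace (tensorMap A k ∘ₗ permAct R p q σ), by
    rw [wordTrace_tensorMap_permAct]
    refine (𝒜 0).sum_mem fun w _ => uzpow_smul_mem ?_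
    have := prod_entries_mem A w (w ∘ ⇑σ⁻¹)
    rwa [wordPar_comp, zmod2_add_self] at this⟩

/-- `A^{⊗k}` commutes with permutations, and permutations are cyclic under the supertrace. -/
theorem permTrace_conj (A : EvenOperator 𝒜 p q) (k : ℕ) (σ τ : Perm (Fin k)) :
    permTrace A k (τ * σ * τ⁻¹) = permTrace A k σ := by
  apply Subtype.ext
  change wordTrace _ = wordTrace _
  have h1 : tensorMap A k ∘ₗ permAct R p q (τ * σ * τ⁻¹) =
      (tensorMap A k ∘ₗ permAct R p q (τ * σ)) ∘ₗ permAct R p q τ⁻¹ := by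
    refine LinearMap.ext fun x => ?_
    simp only [LinearMap.comp_apply, permAct_mul]
  have h2 : permAct R p q τ⁻¹ ∘ₗ (tensorMap A k ∘ₗ permAct R p q (τ * σ)) =
      tensorMap A k ∘ₗ permAct R p q σ := by
    rw [← LinearMap.comp_assoc, ← tensorMap_comp_permAct, LinearMap.comp_assoc]
    congr 1
    refine LinearMap.ext fun x => ?_
    rw [LinearMap.comp_apply, ← permAct_mul, inv_mul_cancel_left]
  rw [h1, wordTrace_comp_permAct, h2]

theorem blockSum_inv {m n : ℕ} (σ : Perm (Fin m)) (τ : Perm (Fin n)) :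
    (blockSum σ τ)⁻¹ = blockSum σ⁻¹ τ⁻¹ := by
  rw [inv_eq_iff_mul_eq_one]
  ext1 i
  refine Fin.addCases (fun i => ?_) (fun i => ?_) i <;> simp

theorem koszulExp_blockSum {m n : ℕ} (σ : Perm (Fin m)) (τ : Perm (Fin n)) (π : Fin m → ZMod 2)
    (π' : Fin n → ZMod 2) : koszulExp (blockSum σ τ) (Fin.append π π') =
      koszulExp σ π + koszulExp τ π' := by
  unfold koszulExp
  simp only [Fin.sum_univ_add, blockSum_castAdd, blockSum_natAdd, Fin.append_left,
    Fin.append_right]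
  have h1 : ∀ (i : Fin m) (j : Fin n), ¬(Fin.castAdd n i < Fin.natAdd m j ∧
      Fin.natAdd m (τ j) < Fin.castAdd n (σ i)) := by
    rintro i j ⟨-, h⟩
    simp only [Fin.lt_def, Fin.val_natAdd, Fin.val_castAdd] at h
    omega
  have h2 : ∀ (i : Fin m) (j : Fin n), ¬(Fin.natAdd m j < Fin.castAdd n i ∧
      Fin.castAdd n (σ i) < Fin.natAdd m (τ j)) := by
    rintro i j ⟨h, -⟩
    simp only [Fin.lt_def, Fin.val_natAdd, Fin.val_castAdd] at h
    omega
  simp only [h1, h2, if_false, Finset.sum_const_zero, add_zero, zero_add]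
  simp only [Fin.natAdd_lt_natAdd_iff]
  rfl

theorem tensorExp_append {m n : ℕ} (u u' : Fin m → Fin p ⊕ Fin q) (v v' : Fin n → Fin p ⊕ Fin q)
    (h : wordPar u = wordPar u') : tensorExp (Fin.append u v) (Fin.append u' v') =
      tensorExp u u' + tensorExp v v' := by
  unfold tensorExp
  simp only [Fin.sum_univ_add, Fin.append_left, Fin.append_right]
  have h1 : ∀ (i : Fin m) (j : Fin n), Fin.castAdd n i < Fin.natAdd m j := by
    intro i j
    simp only [Fin.lt_def, Fin.val_natAdd, Fin.val_castAdd]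
    omega
  have h2 : ∀ (i : Fin m) (j : Fin n), ¬Fin.natAdd m j < Fin.castAdd n i := fun i j =>
    (h1 i j).le.not_gt
  have h3 : ∑ i : Fin m, ∑ j : Fin n, (par (u i) + par (u' i)) * par (v j) = 0 := by
    rw [← Finset.sum_mul_sum, wordPar_add, h, zmod2_add_self, zero_mul]
  simp only [h1, h2, if_true, if_false, Finset.sum_const_zero, Finset.sum_add_distrib, h3,
    add_zero, zero_add]
  simp only [Fin.natAdd_lt_natAdd_iff]
  rfl

theorem append_comp_blockSum {ι : Type*} {m n : ℕ} (u : Fin m → ι) (v : Fin n → ι)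
    (σ : Perm (Fin m)) (τ : Perm (Fin n)) :
    Fin.append u v ∘ ⇑(blockSum σ τ) = Fin.append (u ∘ σ) (v ∘ τ) := by
  ext1 i
  refine Fin.addCases (fun i => ?_) (fun i => ?_) i <;> simp

theorem wordPar_append {m n : ℕ} (u : Fin m → Fin p ⊕ Fin q) (v : Fin n → Fin p ⊕ Fin q) :
    wordPar (Fin.append u v) = wordPar u + wordPar v := by
  simp [wordPar, Fin.sum_univ_add]

omit [SuperCommutative 𝒜] in
/-- The signs are compatible with concatenation of words, since a permutation does not change the
parity of a word. -/
theorem permTrace_blockSum (A : EvenOperator 𝒜 p q) (m n : ℕ) (σ : Perm (Fin m))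
    (τ : Perm (Fin n)) :
    permTrace A (m + n) (blockSum σ τ) = permTrace A m σ * permTrace A n τ := by
  apply Subtype.ext
  change wordTrace _ = wordTrace _ * wordTrace _
  simp only [wordTrace_tensorMap_permAct]
  rw [Fintype.sum_mul_sum, ← Fintype.sum_prod_type']
  refine (Fintype.sum_equiv (Fin.appendEquiv m n) _ _ fun f => ?_).symm
  obtain ⟨u, v⟩ := f
  change _ = ((-1 : ℤˣ) ^ traceExp (blockSum σ τ) (Fin.append u v)) •
    (List.ofFn fun s => A.mat (Fin.append u v s) (Fin.append u v ((blockSum σ τ)⁻¹ s))).prod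
  have hexp : traceExp (blockSum σ τ) (Fin.append u v) = traceExp σ u + traceExp τ v := by
    have e : (fun s => par (Fin.append u v s)) =
        Fin.append (fun s => par (u s)) (fun s => par (v s)) := by
      ext1 i
      refine Fin.addCases (fun i => ?_) (fun i => ?_) i <;> simp
    rw [traceExp, e, koszulExp_blockSum, blockSum_inv, append_comp_blockSum,
      tensorExp_append _ _ _ _ (wordPar_comp u σ⁻¹).symm, wordPar_append, traceExp, traceExp]
    ring
  have hlist : (List.ofFn fun s => A.mat (Fin.append u v s)
      (Fin.append u v ((blockSum σ τ)⁻¹ s))) =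
      (List.ofFn fun s => A.mat (u s) (u (σ⁻¹ s))) ++
        (List.ofFn fun s => A.mat (v s) (v (τ⁻¹ s))) := by
    rw [← List.ofFn_fin_append]
    congr 1
    ext1 i
    rw [blockSum_inv]
    refine Fin.addCases (fun i => ?_) (fun i => ?_) i <;> simp
  rw [hexp, hlist, List.prod_append, uzpow_add, mul_smul, smul_mul_assoc, mul_smul_comm]

omit [SuperCommutative 𝒜] in
theorem permTrace_zero (A : EvenOperator 𝒜 p q) : permTrace A 0 1 = 1 := by
  apply Subtype.ext
  change wordTrace (tensorMap A 0 ∘ₗ permAct R p q 1) = (1 : R)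
  rw [wordTrace_tensorMap_permAct]
  simp [traceExp, wordPar, koszulExp, tensorExp]

/-- The supertrace of the power `A^k`, an element of the even part of `R`. -/
def strPow (A : EvenOperator 𝒜 p q) (k : ℕ) : 𝒜 0 :=
  ⟨∑ i, ((-1 : ℤˣ) ^ par i) • (A.mat ^ k) i i, by
    refine (𝒜 0).sum_mem fun i _ => uzpow_smul_mem ?_
    have h : ∀ (k : ℕ) (i j : Fin p ⊕ Fin q), (A.mat ^ k) i j ∈ 𝒜 (par i + par j) := by
      intro k
      induction k with
      | zero =>
        intro i j
        rw [pow_zero]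
        by_cases h : i = j
        · rw [h, Matrix.one_apply_eq, zmod2_add_self]
          exact SetLike.GradedOne.one_mem
        · rw [Matrix.one_apply_ne h]
          exact (𝒜 _).zero_mem
      | succ k ih =>
        intro i j
        rw [pow_succ, Matrix.mul_apply]
        refine (𝒜 _).sum_mem fun l _ => ?_
        have := SetLike.GradedMul.mul_mem (ih i l) (A.mem l j)
        have e : ∀ a b c : ZMod 2, a + b + (b + c) = a + c := by decide
        rwa [e] at this
    have := h k i i
    rwa [zmod2_add_self] at this⟩

/-- Around a cycle the signs from the permutation, from the tensor power of the operator and from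
the parity of the word cancel, except for the sign of the supertrace of a matrix power. -/
theorem traceExp_finRotate {n : ℕ} (w : Fin (n + 1) → Fin p ⊕ Fin q) :
    traceExp (finRotate (n + 1))⁻¹ w = par (w 0) := by
  set x : Fin (n + 1) → ZMod 2 := fun s => par (w s) with hx
  have hk : koszulExp (finRotate (n + 1))⁻¹ x = ∑ t : Fin n, x 0 * x t.succ := by
    have hr0 : (finRotate (n + 1))⁻¹ 0 = Fin.last n := by
      rw [Perm.inv_eq_iff_eq, finRotate_last]
    have hrs : ∀ t : Fin n, (finRotate (n + 1))⁻¹ t.succ = t.castSucc := by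
      intro t
      rw [Perm.inv_eq_iff_eq, finRotate_apply, Fin.coeSucc_eq_succ]
    unfold koszulExp
    simp only [Fin.sum_univ_succ, hr0, hrs]
    have h1 : ∀ s t : Fin n, ¬(s.succ < t.succ ∧ t.castSucc < s.castSucc) := by
      rintro s t ⟨h, h'⟩
      exact absurd (Fin.succ_lt_succ_iff.1 h) (Fin.castSucc_lt_castSucc_iff.1 h').le.not_gt
    simp only [h1, if_false, Finset.sum_const_zero, add_zero]
    simp [Fin.castSucc_lt_last]
  have ht : tensorExp w (w ∘ ⇑(finRotate (n + 1))⁻¹⁻¹) =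
      ∑ t : Fin n, (x 0 * x t.succ + x t.succ) := by
    have hpre : ∀ t : Fin (n + 1), (∑ s : Fin (n + 1), if s < t then
        x s + x (finRotate (n + 1) s) else 0) = x 0 + x t := by
      intro t
      induction t using Fin.induction with
      | zero => simp [zmod2_add_self]
      | succ t ih =>
        have e : ∀ s : Fin (n + 1), (if s < t.succ then x s + x (finRotate (n + 1) s) else 0) =
            (if s < t.castSucc then x s + x (finRotate (n + 1) s) else 0) +
              if s = t.castSucc then x s + x (finRotate (n + 1) s) else 0 := by
          intro s
          rcases lt_trichotomy s t.castSucc with h | h | h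
          · rw [if_pos (h.trans (Fin.castSucc_lt_succ)), if_pos h, if_neg h.ne, add_zero]
          · rw [if_pos (h ▸ Fin.castSucc_lt_succ), if_neg h.not_lt, if_pos h, zero_add]
          · rw [if_neg, if_neg h.not_gt, if_neg h.ne', add_zero]
            rw [not_lt, ← Fin.castSucc_lt_iff_succ_le]
            exact h
        rw [Finset.sum_congr rfl fun s _ => e s, Finset.sum_add_distrib, ih,
          Finset.sum_ite_eq' Finset.univ, if_pos (Finset.mem_univ _), finRotate_apply,
          Fin.coeSucc_eq_succ]
        have : ∀ a b c : ZMod 2, a + b + (b + c) = a + c := by decide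
        exact this _ _ _
    have e : tensorExp w (w ∘ ⇑(finRotate (n + 1))⁻¹⁻¹) =
        ∑ t : Fin (n + 1), (x 0 + x t) * x t := by
      unfold tensorExp
      rw [Finset.sum_comm]
      refine Finset.sum_congr rfl fun t _ => ?_
      rw [← hpre t, Finset.sum_mul]
      refine Finset.sum_congr rfl fun s _ => ?_
      rw [inv_inv]
      split_ifs <;> simp [hx]
    rw [e, Fin.sum_univ_succ, zmod2_add_self, zero_mul, zero_add]
    refine Finset.sum_congr rfl fun t _ => ?_
    have : ∀ a b : ZMod 2, (a + b) * b = a * b + b := by decide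
    exact this _ _
  have hw : wordPar w = x 0 + ∑ t : Fin n, x t.succ := by
    rw [wordPar, Fin.sum_univ_succ]
  rw [traceExp, ht, hw]
  rw [show koszulExp (finRotate (n + 1))⁻¹ (fun s => par (w s)) = _ from hk,
    Finset.sum_add_distrib]
  have : ∀ a b c : ZMod 2, a + b + (c + (c + b)) = a := by decide
  exact this _ _ _

omit [Algebra ℚ R] in
theorem pow_apply_eq_sum {ι : Type*} [Fintype ι] [DecidableEq ι] (B : Matrix ι ι R) (n : ℕ)
    (i j : ι) : (B ^ (n + 1)) i j = ∑ v : Fin n → ι,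
      (List.ofFn fun s : Fin (n + 1) => B ((Fin.cons i v : Fin (n + 1) → ι) s)
        ((Fin.snoc v j : Fin (n + 1) → ι) s)).prod := by
  induction n generalizing i with
  | zero => simp [Fin.snoc]
  | succ n ih =>
    rw [pow_succ', Matrix.mul_apply]
    rw [← Equiv.sum_comp (Fin.consEquiv fun _ => ι), Fintype.sum_prod_type]
    refine Finset.sum_congr rfl fun l _ => ?_
    rw [ih, Finset.mul_sum]
    refine Finset.sum_congr rfl fun v _ => ?_
    change _ = (List.ofFn fun s : Fin (n + 1 + 1) => B ((Fin.cons i (Fin.cons l v) :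
      Fin (n + 2) → ι) s) ((Fin.snoc (Fin.cons l v : Fin (n + 1) → ι) j : Fin (n + 2) → ι) s)).prod
    have h : (Fin.snoc (Fin.cons l v : Fin (n + 1) → ι) j : Fin (n + 2) → ι) =
        Fin.cons l (Fin.snoc v j : Fin (n + 1) → ι) := (Fin.cons_snoc_eq_snoc_cons _ _ _).symm
    rw [h, List.ofFn_succ (n := n + 1), List.prod_cons]
    simp only [Fin.cons_zero, Fin.cons_succ]

omit [SuperCommutative 𝒜] in
/-- On a rotation the supertrace of `A^{⊗k} σ` is that of the power `A^k`. -/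
theorem permTrace_finRotate (A : EvenOperator 𝒜 p q) (n : ℕ) :
    permTrace A (n + 1) (finRotate (n + 1))⁻¹ = strPow A (n + 1) := by
  apply Subtype.ext
  change wordTrace _ = ∑ i, ((-1 : ℤˣ) ^ par i) • (A.mat ^ (n + 1)) i i
  rw [wordTrace_tensorMap_permAct, ← Equiv.sum_comp (Fin.consEquiv fun _ => Fin p ⊕ Fin q),
    Fintype.sum_prod_type]
  refine Finset.sum_congr rfl fun i _ => ?_
  rw [pow_apply_eq_sum, Finset.smul_sum]
  refine Finset.sum_congr rfl fun v _ => ?_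
  rw [traceExp_finRotate]
  simp only [Fin.consEquiv_apply, Fin.cons_zero, inv_inv]
  congr 4
  ext1 s
  congr 1
  refine Fin.lastCases ?_ (fun s => ?_) s
  · rw [finRotate_last, Fin.cons_zero, Fin.snoc_last]
  · rw [finRotate_apply, Fin.coeSucc_eq_succ, Fin.cons_succ, Fin.snoc_castSucc]

/-- The supertrace of `A^{⊗k} σ` is the product over the cycles of `σ` of the supertraces of
powers of `A`. -/
theorem permTrace_eq_cyc (A : EvenOperator 𝒜 p q) {k : ℕ} (σ : Perm (Fin k)) :
    permTrace A k σ = cyc (strPow A) σ := by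
  rw [eq_cyc (permTrace A) (permTrace_conj A) (permTrace_blockSum A) (permTrace_zero A)]
  refine cyc_congr σ fun m hm _ => ?_
  obtain ⟨m, rfl⟩ : ∃ l, m = l + 1 := ⟨m - 1, by omega⟩
  exact permTrace_finRotate A m

/-- The supertrace of `A^{⊗k}` composed with an element of the group algebra of the symmetric group.
-/
theorem wordTrace_tensorMap_matAct (A : EvenOperator 𝒜 p q) {k : ℕ}
    (y : MonoidAlgebra ℚ (Perm (Fin k))) :
    wordTrace (tensorMap A k ∘ₗ matAct R (permRep p q k y)) =
      ((∑ σ, y.coeff σ • cyc (strPow A) σ : 𝒜 0) : R) := by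
  have h : ((∑ σ, y.coeff σ • cyc (strPow A) σ : 𝒜 0) : R) =
      ∑ σ, y.coeff σ • ((cyc (strPow A) σ : 𝒜 0) : R) := by
    rw [← Submodule.subtype_apply, map_sum]
    rfl
  rw [h]
  have h2 : ∀ σ : Perm (Fin k), ((cyc (strPow A) σ : 𝒜 0) : R) =
      wordTrace (tensorMap A k ∘ₗ permAct R p q σ) := fun σ => by
    rw [← permTrace_eq_cyc]; rfl
  simp only [h2, wordTrace, LinearMap.comp_apply, matAct_permRep, map_sum, Finset.sum_apply,
    Finset.smul_sum]
  rw [Finset.sum_comm]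
  refine Finset.sum_congr rfl fun σ _ => Finset.sum_congr rfl fun w _ => ?_
  rw [map_rat_smul, Pi.smul_apply, smul_comm]

end PermTrace

/-! ### Supertraces on exterior powers and on rectangular Young modules -/

section Antisymmetrizer

open Equiv

/-- The idempotent `(1/k!) ∑ sgn(σ) σ` of the group algebra of the symmetric group. -/
def antisymElt (k : ℕ) : MonoidAlgebra ℚ (Perm (Fin k)) :=
  (k.factorial : ℚ)⁻¹ • ∑ σ, ((Perm.sign σ : ℤ) : ℚ) • MonoidAlgebra.of ℚ _ σ

theorem coeff_antisymElt {k : ℕ} (σ : Perm (Fin k)) :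
    (antisymElt k).coeff σ = (k.factorial : ℚ)⁻¹ * ((Perm.sign σ : ℤ) : ℚ) := by
  classical
  rw [antisymElt, MonoidAlgebra.coeff_smul, Finsupp.smul_apply, smul_eq_mul,
    MonoidAlgebra.coeff_sum, Finsupp.finsetSum_apply, Finset.sum_eq_single σ]
  · simp
  · intro τ _ h
    simp [h]
  · simp

theorem intUnits_cast_mul_self (z : ℤˣ) : ((z : ℤ) : ℚ) * ((z : ℤ) : ℚ) = 1 := by
  rcases Int.units_eq_one_or z with rfl | rfl <;> simp

theorem of_mul_antisymElt {k : ℕ} (τ : Perm (Fin k)) : MonoidAlgebra.of ℚ _ τ * antisymElt k =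
    ((Perm.sign τ : ℤ) : ℚ) • antisymElt k := by
  rw [antisymElt, mul_smul_comm, smul_comm]
  congr 1
  rw [Finset.mul_sum, Finset.smul_sum]
  refine Fintype.sum_equiv (Equiv.mulLeft τ) _ _ fun σ => ?_
  rw [mul_smul_comm, ← map_mul, smul_smul, Equiv.coe_mulLeft, Perm.sign_mul]
  congr 1
  push_cast
  rw [← mul_assoc, intUnits_cast_mul_self, one_mul]

theorem antisymElt_mul_of {k : ℕ} (τ : Perm (Fin k)) : antisymElt k * MonoidAlgebra.of ℚ _ τ =
    ((Perm.sign τ : ℤ) : ℚ) • antisymElt k := by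
  rw [antisymElt, smul_mul_assoc, smul_comm]
  congr 1
  rw [Finset.sum_mul, Finset.smul_sum]
  refine Fintype.sum_equiv (Equiv.mulRight τ) _ _ fun σ => ?_
  rw [smul_mul_assoc, ← map_mul, smul_smul, Equiv.coe_mulRight, Perm.sign_mul]
  congr 1
  push_cast
  rw [mul_comm, mul_assoc, intUnits_cast_mul_self, mul_one]

theorem antisymElt_mul_self (k : ℕ) : antisymElt k * antisymElt k = antisymElt k := by
  conv_lhs => enter [1]; rw [antisymElt]
  rw [smul_mul_assoc, Finset.sum_mul]
  simp only [smul_mul_assoc, of_mul_antisymElt, smul_smul, intUnits_cast_mul_self, one_smul]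
  rw [Finset.sum_const, Finset.card_univ, Fintype.card_perm, Fintype.card_fin,
    ← Nat.cast_smul_eq_nsmul ℚ, smul_smul,
    inv_mul_cancel₀ (Nat.cast_ne_zero.2 k.factorial_ne_zero), one_smul]

end Antisymmetrizer

section TraceFormulas

open Equiv

variable {R : Type u} [Ring R] [Algebra ℚ R] {𝒜 : ZMod 2 → Submodule ℚ R} [GradedAlgebra 𝒜]
  [SuperCommutative 𝒜] {p q : ℕ}

theorem matAct_permRep_permAct {k : ℕ} (y : MonoidAlgebra ℚ (Perm (Fin k))) (τ : Perm (Fin k))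
    (x : TensorPow R p q k) : matAct R (permRep p q k y) (permAct R p q τ x) =
      matAct R (permRep p q k (y * MonoidAlgebra.of ℚ _ τ)) x := by
  rw [map_mul, matAct_mul, permRep_of, matAct_permMat]

theorem matAct_smul {m n : Type*} [Fintype n] (c : ℚ) (K : Matrix m n ℚ) (x : n → R) :
    matAct R (c • K) x = c • matAct R K x := by
  funext w
  simp only [matAct_apply, Pi.smul_apply, Matrix.smul_apply, Finset.smul_sum, smul_assoc]

theorem rat_smul_mem {k : ℕ} (N : Submodule Rᵐᵒᵖ (TensorPow R p q k)) (c : ℚ)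
    {x : TensorPow R p q k} (hx : x ∈ N) : c • x ∈ N := by
  have : c • x = MulOpposite.op (algebraMap ℚ R c) • x := by
    funext w
    change c • x w = x w * algebraMap ℚ R c
    rw [Algebra.smul_def, Algebra.commutes]
  rw [this]
  exact N.smul_mem _ hx

/-- Modulo the defining relations of the exterior power, every permutation acts by its sign:
adjacent transpositions do so by definition, and they generate the symmetric group. -/
theorem sub_permAct_mem_extRel {k : ℕ} (σ : Perm (Fin k)) (x : TensorPow R p q k) :
    x - ((Perm.sign σ : ℤ) : ℚ) • permAct R p q σ x ∈ extRel R p q k := by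
  cases k with
  | zero =>
    have : σ = 1 := Subsingleton.elim _ _
    subst this
    have h : permAct R p q 1 x = x := by
      rw [← matAct_permMat, permMat_one, matAct_one]
    rw [h]
    simp
  | succ n =>
    have hσ : σ ∈ Submonoid.closure
        (Set.range fun i : Fin n => Equiv.swap i.castSucc i.succ) := by
      rw [Equiv.Perm.mclosure_swap_castSucc_succ]; trivial
    revert x
    induction hσ using Submonoid.closure_induction with
    | mem τ hτ =>
      intro x
      obtain ⟨i, rfl⟩ := hτ
      have hle : LinearMap.range (LinearMap.id + permAct R p q (Equiv.swap i.castSucc i.succ)) ≤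
          extRel R p q (n + 1) :=
        le_iSup_of_le i.castSucc (le_iSup_of_le i.succ (le_iSup_of_le (by simp) le_rfl))
      refine hle ⟨x, ?_⟩
      rw [Perm.sign_swap (Fin.castSucc_lt_succ).ne]
      simp
    | one =>
      intro x
      have h : permAct R p q 1 x = x := by
        rw [← matAct_permMat, permMat_one, matAct_one]
      rw [h]
      simp
    | mul σ τ _ _ ihσ ihτ =>
      intro x
      have h := add_mem (ihτ x) (ihσ (((Perm.sign τ : ℤ) : ℚ) • permAct R p q τ x))
      rw [map_rat_smul, ← permAct_mul, smul_smul] at h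
      rw [Perm.sign_mul]
      push_cast
      convert h using 1
      abel

/-- Together with `sub_antisymElt_mem_extRel` this shows that the relations of the exterior power
are the kernel of the antisymmetrizer, so that the exterior power is a direct summand of the tensor
power. -/
theorem extRel_le_ker (k : ℕ) :
    extRel R p q k ≤ LinearMap.ker (matAct R (permRep p q k (antisymElt k))) := by
  refine iSup_le fun s => iSup_le fun t => iSup_le fun h => ?_
  rintro _ ⟨x, rfl⟩
  have hst : s ≠ t := by
    rintro rfl
    omega
  rw [LinearMap.mem_ker, LinearMap.add_apply, LinearMap.id_apply, map_add, matAct_permRep_permAct,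
    antisymElt_mul_of, Perm.sign_swap hst, map_smul, matAct_smul]
  simp

theorem sub_antisymElt_mem_extRel {k : ℕ} (x : TensorPow R p q k) :
    x - matAct R (permRep p q k (antisymElt k)) x ∈ extRel R p q k := by
  have h0 : (k.factorial : ℚ) ≠ 0 := Nat.cast_ne_zero.2 k.factorial_ne_zero
  have h : x - matAct R (permRep p q k (antisymElt k)) x = (k.factorial : ℚ)⁻¹ •
      ∑ σ : Perm (Fin k), (x - ((Perm.sign σ : ℤ) : ℚ) • permAct R p q σ x) := by
    rw [matAct_permRep, Finset.sum_sub_distrib, smul_sub, Finset.sum_const, Finset.card_univ,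
      Fintype.card_perm, Fintype.card_fin, ← Nat.cast_smul_eq_nsmul ℚ, smul_smul,
      inv_mul_cancel₀ h0, one_smul, Finset.smul_sum]
    simp only [coeff_antisymElt, mul_smul]
  rw [h]
  exact rat_smul_mem _ _ (Submodule.sum_mem _ fun σ _ => sub_permAct_mem_extRel σ x)

omit [SuperCommutative 𝒜] in
theorem evenPart_coe (x : 𝒜 0) : evenPart 𝒜 (x : R) = x := by
  rw [evenPart, DirectSum.decompose_coe, DirectSum.of_eq_same]

/-- The supertrace of the exterior power is that of `A^{⊗k}` composed with the antisymmetrizer, and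
the latter is a sum over permutations evaluated by `sum_sign_cyc`. -/
theorem superTrace_extMap (A : EvenOperator 𝒜 p q) (k : ℕ) :
    superTrace (extGrading 𝒜 p q k) (extMap A k) = ((newtonE (strPow A) k : 𝒜 0) : R) := by
  rw [superTrace_of_retract (𝒜 := 𝒜) (permRep p q k (antisymElt k))
    (by rw [← map_mul, antisymElt_mul_self]) (permRep_parity _)
    ((extRel R p q k).liftQ (matAct R (permRep p q k (antisymElt k))) (extRel_le_ker k))
    (extRel R p q k).mkQ ?_ (fun x => rfl) ?_ ?_ (tensorMap A k)
    (tensorMap_mem_tensorGrading A) (extMap A k) ?_, wordTrace_tensorMap_matAct]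
  · congr 1
    have h := sum_sign_cyc (strPow A) k
    simp only [coeff_antisymElt, mul_smul, ← Finset.smul_sum, Int.cast_smul_eq_zsmul]
    rw [h, ← Nat.cast_smul_eq_nsmul ℚ, smul_smul,
      inv_mul_cancel₀ (Nat.cast_ne_zero.2 k.factorial_ne_zero), one_smul]
  · intro x
    obtain ⟨x, rfl⟩ := (extRel R p q k).mkQ_surjective x
    refine ((Submodule.Quotient.eq _).2 ?_).symm
    exact sub_antisymElt_mem_extRel x
  · rintro i _ ⟨x, hx, rfl⟩
    exact matAct_permRep_mem_tensorGrading _ hx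
  · intro i x hx
    exact ⟨x, hx, rfl⟩
  · intro x
    obtain ⟨x, rfl⟩ := (extRel R p q k).mkQ_surjective x
    refine (Submodule.Quotient.eq _).2 ?_
    have := extRel_le_comap A k (sub_antisymElt_mem_extRel x)
    rwa [Submodule.mem_comap, map_sub] at this

/-- The supertraces of the exterior powers and those of the powers satisfy Newton's identities. -/
theorem trExt_eq (A : EvenOperator 𝒜 p q) : trExt A = zeroExtend (newtonE (strPow A)) := by
  funext k
  cases k with
  | ofNat k =>
    change evenPart 𝒜 (superTrace (extGrading 𝒜 p q k) (extMap A k)) = _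
    rw [superTrace_extMap, evenPart_coe]
    rfl
  | negSucc k => rfl

theorem matAct_permRep_youngElt {r s : ℕ} (x : TensorPow R p q (r * s)) :
    matAct R (permRep p q (r * s) (youngElt r s)) x =
      (rowSymm R p q r s ∘ₗ colAntisymm R p q r s) x := by
  classical
  rw [matAct_permRep, sum_coeff_youngElt_smul, LinearMap.comp_apply, rowSymm, colAntisymm]
  simp only [LinearMap.sum_apply, LinearMap.smul_apply, map_sum, map_zsmul, permAct_mul,
    Int.cast_smul_eq_zsmul, mem_rowGroup, mem_colGroup, Finset.smul_sum]
  rw [Finset.sum_comm]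

/-- The Young symmetrizer divided by `hookProd` is an idempotent, so the supertrace of `A^{⊗rs}` on
its image is a sum over permutations evaluated by `sum_coeff_youngElt_cyc`. -/
theorem superTrace_youngMap (A : EvenOperator 𝒜 p q) (r s : ℕ) :
    superTrace (youngGrading 𝒜 p q r s) (youngMap A r s) =
      (((jacobiTrudi (newtonE (strPow A)) r s).det : 𝒜 0) : R) := by
  set K := permRep p q (r * s) ((hookProd r s)⁻¹ • youngElt r s) with hK
  have h0 := hookProd_ne_zero r s
  have hmem : ∀ x : TensorPow R p q (r * s), matAct R K x ∈ youngSub R p q r s := by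
    intro x
    rw [hK, map_smul, matAct_smul, matAct_permRep_youngElt]
    exact rat_smul_mem _ _ ⟨x, rfl⟩
  have hid : ∀ x ∈ youngSub R p q r s, matAct R K x = x := by
    rintro _ ⟨x, rfl⟩
    rw [← matAct_permRep_youngElt, ← matAct_mul, hK, ← map_mul, smul_mul_assoc, youngElt_mul_self,
      smul_smul, inv_mul_cancel₀ h0, one_smul]
  rw [superTrace_of_retract (𝒜 := 𝒜) K ?_ (permRep_parity _) (youngSub R p q r s).subtype
    ((matAct R K).codRestrict _ hmem) ?_ (fun x => rfl) ?_ ?_ (tensorMap A (r * s))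
    (tensorMap_mem_tensorGrading A) (youngMap A r s) ?_, hK, wordTrace_tensorMap_matAct]
  · congr 1
    have h := sum_coeff_youngElt_cyc (strPow A) r s
    simp only [MonoidAlgebra.coeff_smul, Finsupp.smul_apply, smul_assoc, ← Finset.smul_sum]
    rw [h, smul_smul, inv_mul_cancel₀ h0, one_smul]
  · rw [hK, ← map_mul, smul_mul_smul_comm, youngElt_mul_self, smul_smul, mul_assoc,
      inv_mul_cancel₀ h0, mul_one]
  · intro x
    exact Subtype.ext (hid x x.2)
  · intro i x hx
    exact hx
  · intro i x hx
    exact matAct_permRep_mem_tensorGrading _ hx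
  · intro x
    exact Subtype.ext (hid _ (tensorMap_mem_youngSub A r s x x.2)).symm

/-- The Jacobi–Trudi formula for the supertrace on a rectangular Young module. -/
theorem trYoung_eq (A : EvenOperator 𝒜 p q) (r s : ℕ) :
    trYoung A r s = (jacobiTrudi (newtonE (strPow A)) r s).det := by
  rw [trYoung, superTrace_youngMap, evenPart_coe]

end TraceFormulas

section Hankel

open Equiv

theorem sign_revPerm_succ (n : ℕ) :
    Perm.sign (Fin.revPerm : Perm (Fin (n + 1))) = (-1) ^ n * Perm.sign (Fin.revPerm (n := n)) := by
  have h : finRotate (n + 1) * Fin.revPerm = Perm.decomposeFin.symm (0, Fin.revPerm) := by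
    ext1 j
    refine Fin.cases ?_ (fun j => ?_) j
    · rw [Perm.mul_apply, Perm.decomposeFin_symm_apply_zero, Fin.revPerm_apply, Fin.rev_zero,
        finRotate_last]
    · rw [Perm.mul_apply, Perm.decomposeFin_symm_apply_succ, Fin.revPerm_apply, Fin.rev_succ,
        finRotate_apply, Fin.coeSucc_eq_succ, swap_self, refl_apply, Fin.revPerm_apply]
  have h2 := congrArg Perm.sign h
  rw [Perm.sign_mul, sign_finRotate, Perm.decomposeFin.symm_sign, if_pos rfl, one_mul,
    Nat.succ_sub_one] at h2
  rw [← h2, ← mul_assoc, ← pow_add, Even.neg_one_pow ⟨n, rfl⟩, one_mul]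

/-- The sign `(-1)^{s(s-1)/2}` of the reversal of `s` columns. -/
def revSign (s : ℕ) : ℤˣ := Perm.sign (Fin.revPerm (n := s))

theorem revSign_succ (s : ℕ) : revSign (s + 1) = (-1) ^ s * revSign s := sign_revPerm_succ s

/-- Up to sign, the Jacobi–Trudi determinant of a rectangle is a Hankel determinant. -/
theorem det_jacobiTrudi {S : Type u} [CommRing S] (e : ℕ → S) (r s : ℕ) :
    (jacobiTrudi e r s).det = ((revSign s : ℤ) : S) *
      hankel (zeroExtend e) ((r : ℤ) - s + 1) s := by
  have h := Matrix.det_permute' (Fin.revPerm (n := s)) (jacobiTrudi e r s)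
  have h2 : hankel (zeroExtend e) ((r : ℤ) - s + 1) s =
      ((jacobiTrudi e r s).submatrix id Fin.revPerm).det := by
    rw [hankel]
    congr 1
    ext1 i j
    simp only [jacobiTrudi, Matrix.submatrix_apply, Matrix.of_apply, id, Fin.revPerm_apply]
    congr 1
    rw [Fin.val_rev]
    have := j.2
    omega
  rw [h2, h, ← mul_assoc, revSign]
  rcases Int.units_eq_one_or (Perm.sign (Fin.revPerm (n := s))) with e | e <;> rw [e] <;> simp

end Hankel

/-! ### Hankel determinants of the coefficients of a rational function -/

section Rational

open Polynomial

variable {S : Type u} [CommRing S]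

/-- The recurrence satisfied by the coefficients of `a / b`, written with the entries of row `i` of
the Hankel matrix. -/
theorem sum_coeff_mul_zeroExtend (e : ℕ → S) (b : S[X]) (p q : ℕ) (hb : b.natDegree ≤ q) (i : ℕ) :
    ∑ j : Fin (q + 1), b.coeff (q - j) * zeroExtend e ((p : ℤ) - q + i + (j : ℕ)) =
      PowerSeries.coeff (p + i) (PowerSeries.mk e * (b : PowerSeries S)) := by
  rw [mul_comm, PowerSeries.coeff_mul, Finset.Nat.sum_antidiagonal_eq_sum_range_succ_mk]
  simp only [Polynomial.coeff_coe, PowerSeries.coeff_mk]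
  rw [Fin.sum_univ_eq_sum_range
    fun j => b.coeff (q - j) * zeroExtend e ((p : ℤ) - q + i + (j : ℕ)),
    ← Finset.sum_range_reflect]
  have h2 : ∀ m, ∑ l ∈ Finset.range (m + 1), b.coeff l * zeroExtend e ((p : ℤ) + i - l) =
      ∑ l ∈ Finset.range (max q (p + i) + 1), b.coeff l * zeroExtend e ((p : ℤ) + i - l) ∨
      ¬(m = q ∨ m = p + i) := by
    intro m
    by_cases hm : m = q ∨ m = p + i
    · left
      refine Finset.sum_subset (fun l hl => ?_) fun l _ hl => ?_
      · rw [Finset.mem_range] at *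
        rcases hm with rfl | rfl
        · exact lt_of_lt_of_le hl (by omega)
        · exact lt_of_lt_of_le hl (by omega)
      · rw [Finset.mem_range, not_lt] at hl
        rcases hm with rfl | rfl
        · rw [Polynomial.coeff_eq_zero_of_natDegree_lt (by omega), zero_mul]
        · rw [zeroExtend_of_neg _ (by omega), mul_zero]
    · exact Or.inr hm
  have h3 := (h2 q).resolve_right (by simp)
  have h4 := (h2 (p + i)).resolve_right (by simp)
  calc _ = ∑ l ∈ Finset.range (q + 1), b.coeff l * zeroExtend e ((p : ℤ) + i - l) := by
        refine Finset.sum_congr rfl fun l hl => ?_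
        rw [Finset.mem_range] at hl
        rw [show q - (q + 1 - 1 - l) = l by omega]
        congr 2
        omega
    _ = ∑ l ∈ Finset.range (p + i + 1), b.coeff l * zeroExtend e ((p : ℤ) + i - l) := by
        rw [h3, h4]
    _ = _ := by
        refine Finset.sum_congr rfl fun l hl => ?_
        rw [Finset.mem_range] at hl
        rw [← zeroExtend_natCast e]
        congr 2
        omega

/-- Cramer's rule for the linear recurrence satisfied by the coefficients of a rational function
`a / b`. -/
theorem coeff_mul_hankel (e : ℕ → S) (a b : S[X]) (p q : ℕ) (ha : a.natDegree ≤ p)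
    (hb : b.natDegree ≤ q) (h : PowerSeries.mk e * (b : PowerSeries S) = a) :
    b.coeff q * hankel (zeroExtend e) ((p : ℤ) - q) (q + 1) =
      a.coeff p * hankel (zeroExtend e) ((p : ℤ) - q + 2) q := by
  set M : Matrix (Fin (q + 1)) (Fin (q + 1)) S :=
    Matrix.of fun i j => zeroExtend e ((p : ℤ) - q + (i : ℕ) + (j : ℕ)) with hM
  -- the combination of the columns with the coefficients of `b` replaces the first column
  have h1 := Matrix.det_updateCol_sum M 0 fun j => b.coeff (q - j)
  have h2 : (fun k => ∑ j : Fin (q + 1), b.coeff (q - j) • M k j) =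
      Pi.single 0 (a.coeff p) := by
    funext i
    have := sum_coeff_mul_zeroExtend e b p q hb i
    rw [h, Polynomial.coeff_coe] at this
    simp only [hM, Matrix.of_apply, smul_eq_mul]
    rw [this]
    refine Fin.cases ?_ (fun i => ?_) i
    · simp
    · rw [Pi.single_eq_of_ne (Fin.succ_ne_zero i)]
      exact Polynomial.coeff_eq_zero_of_natDegree_lt (by simp; omega)
  rw [h2, Matrix.det_succ_column_zero, Fin.sum_univ_succ] at h1
  simp only [Fin.val_zero, Nat.sub_zero, smul_eq_mul] at h1
  change b.coeff q * M.det = _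
  rw [← h1, Finset.sum_eq_zero, add_zero]
  · simp only [pow_zero, one_mul, Matrix.updateCol_self, Pi.single_eq_same]
    congr 1
    rw [hankel]
    congr 1
    ext1 i j
    rw [Matrix.submatrix_apply, Fin.succAbove_zero, Matrix.updateCol_ne (Fin.succ_ne_zero j), hM,
      Matrix.of_apply, Matrix.of_apply]
    congr 1
    simp only [Fin.val_succ]
    push_cast
    ring
  · intro i _
    simp [Fin.succ_ne_zero]

/-- The characteristic polynomial in the form `det (1 + X M)`. -/
def detPoly {m : Type*} [Fintype m] [DecidableEq m] (M : Matrix m m S) : S[X] :=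
  ((X : S[X]) • M.map C + (1 : Matrix m m S).map C).det

variable {m : Type*} [Fintype m] [DecidableEq m]

theorem coe_detPoly (M : Matrix m m S) : (detPoly M : PowerSeries S) = detSeries M := by
  change Polynomial.coeToPowerSeries.ringHom (detPoly M) = _
  rw [detPoly, detSeries, RingHom.map_det]
  congr 1
  ext1 i j
  by_cases h : i = j
  · subst h
    simp [add_comm, PowerSeries.X_mul]
  · simp [h, PowerSeries.X_mul]

theorem eval_neg_one_detPoly (M : Matrix m m S) : (detPoly M).eval (-1) = (1 - M).det := by
  rw [← Polynomial.coe_evalRingHom, detPoly, RingHom.map_det]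
  congr 1
  ext1 i j
  by_cases h : i = j
  · subst h
    simp; ring
  · simp [h]

theorem natDegree_detPoly_le {n : ℕ} (M : Matrix (Fin n) (Fin n) S) :
    (detPoly M).natDegree ≤ n := by
  simpa [detPoly] using Polynomial.natDegree_det_X_add_C_le M 1

theorem coeff_detPoly {n : ℕ} (M : Matrix (Fin n) (Fin n) S) : (detPoly M).coeff n = M.det := by
  simpa [detPoly] using Polynomial.coeff_det_X_add_C_card M 1

end Rational

/-! ### Block triangularization of even operators -/

section Triangular

variable {R : Type u} [Ring R] [Algebra ℚ R] {𝒜 : ZMod 2 → Submodule ℚ R} [GradedAlgebra 𝒜]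
  [SuperCommutative 𝒜] {p q : ℕ}

theorem even_mul_comm (a : 𝒜 0) (x : R) : (a : R) * x = x * a := by
  obtain ⟨y, hy, z, hz, rfl⟩ := exists_add_of_zmod2 (𝒜 := 𝒜) 0 x
  rw [mul_add, add_mul, SuperCommutative.mul_comm' 0 0 _ _ a.2 hy,
    SuperCommutative.mul_comm' 0 (0 + 1) _ _ a.2 hz]
  simp

/-- A supercommutative ring is an algebra over its even part. -/
abbrev evenAlgebra : Algebra (𝒜 0) R :=
  RingHom.toAlgebra'
    { toFun := fun x => (x : R), map_one' := rfl, map_mul' := fun _ _ => rfl, map_zero' := rfl,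
      map_add' := fun _ _ => rfl } even_mul_comm

attribute [local instance] evenAlgebra

theorem even_smul_def (a : 𝒜 0) (x : R) : a • x = (a : R) * x := rfl

theorem even_map_injective {m n : Type*} {M N : Matrix m n (𝒜 0)}
    (h : M.map (algebraMap (𝒜 0) R) = N.map (algebraMap (𝒜 0) R)) : M = N :=
  Matrix.map_injective Subtype.val_injective h

/-- A matrix with even entries as a matrix over the even part. -/
def evenMat {m n : Type*} (M : Matrix m n R) (h : ∀ i j, M i j ∈ 𝒜 0) : Matrix m n (𝒜 0) :=
  Matrix.of fun i j => ⟨M i j, h i j⟩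

omit [SuperCommutative 𝒜] in
theorem matrix_mul_mem {l m n : Type*} [Fintype m] {a b c : ZMod 2} {M : Matrix l m R}
    {N : Matrix m n R} (hM : ∀ i j, M i j ∈ 𝒜 a) (hN : ∀ i j, N i j ∈ 𝒜 b) (hc : a + b = c)
    (i : l) (j : n) : (M * N) i j ∈ 𝒜 c := by
  rw [Matrix.mul_apply]
  refine (𝒜 c).sum_mem fun k _ => ?_
  have := SetLike.GradedMul.mul_mem (hM i k) (hN k j)
  rwa [hc] at this

omit [GradedAlgebra 𝒜] in
/-- Odd elements anticommute, whence the sign. -/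
theorem trace_mul_odd {m n : Type*} [Fintype m] [Fintype n] {X : Matrix m n R} {Z : Matrix n m R}
    (hX : ∀ i j, X i j ∈ 𝒜 1) (hZ : ∀ i j, Z i j ∈ 𝒜 1) : (X * Z).trace = -(Z * X).trace := by
  simp only [Matrix.trace, Matrix.diag_apply, Matrix.mul_apply]
  rw [Finset.sum_comm, ← Finset.sum_neg_distrib]
  refine Finset.sum_congr rfl fun j _ => ?_
  rw [← Finset.sum_neg_distrib]
  refine Finset.sum_congr rfl fun i _ => ?_
  rw [SuperCommutative.mul_comm' 1 1 _ _ (hX i j) (hZ j i)]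
  simp

theorem map_even_pow {m : Type*} [Fintype m] [DecidableEq m] (M : Matrix m m (𝒜 0)) (k : ℕ) :
    (M ^ k).map (algebraMap (𝒜 0) R) = M.map (algebraMap (𝒜 0) R) ^ k :=
  map_pow (algebraMap (𝒜 0) R).mapMatrix M k

/-- For odd matrices `X` and `Z`, the determinants of `1 - XZ` and `1 - ZX` are inverse to each
other, because the powers of `XZ` and `ZX` have opposite traces. -/
theorem det_one_sub_mul_det_one_sub {m n : Type*} [Fintype m] [Fintype n] [DecidableEq m]
    [DecidableEq n] {X : Matrix m n R} {Z : Matrix n m R} (hX : ∀ i j, X i j ∈ 𝒜 1)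
    (hZ : ∀ i j, Z i j ∈ 𝒜 1) (K : Matrix m m (𝒜 0)) (L : Matrix n n (𝒜 0))
    (hK : K.map (algebraMap (𝒜 0) R) = X * Z) (hL : L.map (algebraMap (𝒜 0) R) = Z * X) :
    (1 - K).det * (1 - L).det = 1 := by
  have htr : ∀ k, (K ^ (k + 1)).trace + (L ^ (k + 1)).trace = 0 := by
    intro k
    apply Subtype.ext
    have hcomm : ∀ k, Z * (X * Z) ^ k = (Z * X) ^ k * Z := by
      intro k
      induction k with
      | zero => simp
      | succ k ih => rw [pow_succ, ← Matrix.mul_assoc, ih, pow_succ]; simp only [Matrix.mul_assoc]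
    have h1 : (((K ^ (k + 1)).trace : 𝒜 0) : R) = ((X * Z) ^ (k + 1)).trace := by
      rw [← hK, ← map_even_pow]
      exact AddMonoidHom.map_trace (algebraMap (𝒜 0) R) (K ^ (k + 1))
    have h2 : (((L ^ (k + 1)).trace : 𝒜 0) : R) = ((Z * X) ^ (k + 1)).trace := by
      rw [← hL, ← map_even_pow]
      exact AddMonoidHom.map_trace (algebraMap (𝒜 0) R) (L ^ (k + 1))
    have hodd : ∀ i j, (Z * (X * Z) ^ k) i j ∈ 𝒜 1 := by
      refine matrix_mul_mem hZ (b := 0) (fun i j => ?_) (by decide)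
      rw [← hK, ← map_even_pow]
      exact ((K ^ k) i j).2
    change (((K ^ (k + 1)).trace : 𝒜 0) : R) + (((L ^ (k + 1)).trace : 𝒜 0) : R) = 0
    rw [h1, h2, pow_succ', pow_succ, Matrix.mul_assoc, trace_mul_odd hX hodd, hcomm,
      Matrix.mul_assoc, neg_add_cancel]
  have h : newtonSeries (fun k => (K ^ k).trace) * newtonSeries (fun k => (L ^ k).trace) = 1 := by
    rw [← newtonSeries_add, ← newtonSeries_zero]
    ext1 n
    rw [newtonSeries, newtonSeries, PowerSeries.coeff_mk, PowerSeries.coeff_mk]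
    refine newtonE_congr n fun k hk _ => ?_
    obtain ⟨k, rfl⟩ : ∃ l, k = l + 1 := ⟨k - 1, by omega⟩
    exact htr k
  rw [newtonSeries_trace, newtonSeries_trace, ← coe_detPoly, ← coe_detPoly, ← Polynomial.coe_mul,
    ← Polynomial.coe_one, Polynomial.coe_inj] at h
  have h2 := congrArg (Polynomial.eval (-1)) h
  rwa [Polynomial.eval_mul, eval_neg_one_detPoly, eval_neg_one_detPoly, Polynomial.eval_one] at h2

/-- The entries of the matrix have the parities of those of an even operator. -/
def IsEvenMatrix (𝒜 : ZMod 2 → Submodule ℚ R) (K : Matrix (Fin p ⊕ Fin q) (Fin p ⊕ Fin q) R) :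
    Prop := ∀ i j, K i j ∈ 𝒜 (par i + par j)

omit [SuperCommutative 𝒜] in
theorem IsEvenMatrix.mul {K L : Matrix (Fin p ⊕ Fin q) (Fin p ⊕ Fin q) R}
    (hK : IsEvenMatrix 𝒜 K) (hL : IsEvenMatrix 𝒜 L) : IsEvenMatrix 𝒜 (K * L) := by
  intro i j
  rw [Matrix.mul_apply]
  refine (𝒜 _).sum_mem fun k _ => ?_
  have h := SetLike.GradedMul.mul_mem (hK i k) (hL k j)
  have e : ∀ a b c : ZMod 2, a + b + (b + c) = a + c := by decide
  rwa [e] at h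

/-- The supertrace of a matrix. -/
def strMat (K : Matrix (Fin p ⊕ Fin q) (Fin p ⊕ Fin q) R) : R := ∑ i, ((-1 : ℤˣ) ^ par i) • K i i

omit [GradedAlgebra 𝒜] in
/-- The supertrace is cyclic. -/
theorem strMat_mul_comm {K L : Matrix (Fin p ⊕ Fin q) (Fin p ⊕ Fin q) R}
    (hK : IsEvenMatrix 𝒜 K) (hL : IsEvenMatrix 𝒜 L) : strMat (K * L) = strMat (L * K) := by
  simp only [strMat, Matrix.mul_apply, Finset.smul_sum]
  rw [Finset.sum_comm]
  refine Finset.sum_congr rfl fun j _ => Finset.sum_congr rfl fun i _ => ?_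
  rw [SuperCommutative.mul_comm' _ _ _ _ (hK i j) (hL j i), smul_smul, ← uzpow_add]
  congr 2
  generalize par i = x
  generalize par j = y
  revert x y
  decide

omit [Algebra ℚ R] in
theorem strMat_fromBlocks (a : Matrix (Fin p) (Fin p) R) (b : Matrix (Fin p) (Fin q) R)
    (c : Matrix (Fin q) (Fin p) R) (d : Matrix (Fin q) (Fin q) R) :
    strMat (Matrix.fromBlocks a b c d) = a.trace - d.trace := by
  simp [strMat, Fintype.sum_sum_type, par, Matrix.trace, sub_eq_add_neg]

omit [GradedAlgebra 𝒜] [SuperCommutative 𝒜] in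
theorem toBlocks₁₂_mem (A : EvenOperator 𝒜 p q) (i : Fin p) (j : Fin q) :
    A.mat.toBlocks₁₂ i j ∈ 𝒜 1 := by
  have h := A.mem (Sum.inl i) (Sum.inr j)
  rwa [show par (Sum.inl i : Fin p ⊕ Fin q) + par (Sum.inr j : Fin p ⊕ Fin q) = 1 by
    simp [par]] at h

omit [GradedAlgebra 𝒜] [SuperCommutative 𝒜] in
theorem toBlocks₂₁_mem (A : EvenOperator 𝒜 p q) (i : Fin q) (j : Fin p) :
    A.mat.toBlocks₂₁ i j ∈ 𝒜 1 := by
  have h := A.mem (Sum.inr i) (Sum.inl j)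
  rwa [show par (Sum.inr i : Fin p ⊕ Fin q) + par (Sum.inl j : Fin p ⊕ Fin q) = 1 by
    simp [par]] at h

/-- Conjugation by `1 + Y` makes an even operator block triangular if `Y` solves the Riccati
equation `B₁₀ + B₁₁ Y = Y (B₀₀ + B₀₁ Y)`; here `1 + Y` stands for the unipotent block matrix with
lower left block `Y`. -/
theorem strPow_eq_of_riccati (B : EvenOperator 𝒜 p q) {Y : Matrix (Fin q) (Fin p) R}
    (hY : ∀ i j, Y i j ∈ 𝒜 1) (hric : B.mat.toBlocks₂₁ + B.mat.toBlocks₂₂ * Y =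
      Y * (B.mat.toBlocks₁₁ + B.mat.toBlocks₁₂ * Y))
    (M₀ : Matrix (Fin p) (Fin p) (𝒜 0)) (M₁ : Matrix (Fin q) (Fin q) (𝒜 0))
    (h₀ : M₀.map (algebraMap (𝒜 0) R) = B.mat.toBlocks₁₁ + B.mat.toBlocks₁₂ * Y)
    (h₁ : M₁.map (algebraMap (𝒜 0) R) = B.mat.toBlocks₂₂ - Y * B.mat.toBlocks₁₂) (k : ℕ) :
    strPow B k = (M₀ ^ k).trace - (M₁ ^ k).trace := by
  set G : Matrix (Fin p ⊕ Fin q) (Fin p ⊕ Fin q) R := Matrix.fromBlocks 1 0 Y 1 with hG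
  set G' : Matrix (Fin p ⊕ Fin q) (Fin p ⊕ Fin q) R := Matrix.fromBlocks 1 0 (-Y) 1 with hG'
  set U : Matrix (Fin p ⊕ Fin q) (Fin p ⊕ Fin q) R := Matrix.fromBlocks
    (M₀.map (algebraMap (𝒜 0) R)) B.mat.toBlocks₁₂ 0 (M₁.map (algebraMap (𝒜 0) R)) with hU
  have hone : ∀ {n : ℕ} (i j : Fin n), (1 : Matrix (Fin n) (Fin n) R) i j ∈ 𝒜 0 := by
    intro n i j
    rw [Matrix.one_apply]
    split_ifs
    · exact SetLike.GradedOne.one_mem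
    · exact (𝒜 0).zero_mem
  have hpar : ∀ (a : Matrix (Fin p) (Fin p) R) (b : Matrix (Fin p) (Fin q) R)
      (c : Matrix (Fin q) (Fin p) R) (d : Matrix (Fin q) (Fin q) R), (∀ i j, a i j ∈ 𝒜 0) →
      (∀ i j, b i j ∈ 𝒜 1) → (∀ i j, c i j ∈ 𝒜 1) → (∀ i j, d i j ∈ 𝒜 0) →
      IsEvenMatrix 𝒜 (Matrix.fromBlocks a b c d) := by
    intro a b c d ha hb hc hd i j
    rcases i with i | i <;> rcases j with j | j
    · exact ha i j
    · exact hb i j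
    · exact hc i j
    · exact hd i j
  have hGe : IsEvenMatrix 𝒜 G := hpar _ _ _ _ hone (fun _ _ => (𝒜 1).zero_mem) hY hone
  have hGe' : IsEvenMatrix 𝒜 G' := hpar _ _ _ _ hone (fun _ _ => (𝒜 1).zero_mem)
    (fun i j => (𝒜 1).neg_mem (hY i j)) hone
  have hUe : IsEvenMatrix 𝒜 U := hpar _ _ _ _ (fun i j => (M₀ i j).2) (toBlocks₁₂_mem B)
    (fun _ _ => (𝒜 1).zero_mem) fun i j => (M₁ i j).2
  have hGG' : G' * G = 1 := by
    rw [hG, hG', Matrix.fromBlocks_multiply, ← Matrix.fromBlocks_one]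
    congr 1 <;> simp
  have hGG : G * G' = 1 := by
    rw [hG, hG', Matrix.fromBlocks_multiply, ← Matrix.fromBlocks_one]
    congr 1 <;> simp
  have hB : B.mat * G = G * U := by
    rw [hG, hU, h₀, h₁]
    conv_lhs => rw [← Matrix.fromBlocks_toBlocks B.mat]
    rw [Matrix.fromBlocks_multiply, Matrix.fromBlocks_multiply]
    congr 1
    · simp
    · simp
    · simp [hric]
    · simp
  have hBU : B.mat ^ k = G * (U ^ k * G') := by
    induction k with
    | zero => rw [pow_zero, pow_zero, Matrix.one_mul, hGG]
    | succ k ih =>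
      rw [pow_succ', ih, ← Matrix.mul_assoc, hB, pow_succ']
      simp only [Matrix.mul_assoc]
  have hUk : ∃ W, U ^ k = Matrix.fromBlocks ((M₀ ^ k).map (algebraMap (𝒜 0) R)) W 0
      ((M₁ ^ k).map (algebraMap (𝒜 0) R)) := by
    clear hBU
    induction k with
    | zero =>
      refine ⟨0, ?_⟩
      rw [map_even_pow, map_even_pow, pow_zero, pow_zero, pow_zero, Matrix.fromBlocks_one]
    | succ k ih =>
      obtain ⟨W, hW⟩ := ih
      refine ⟨(M₀ ^ k).map (algebraMap (𝒜 0) R) * B.mat.toBlocks₁₂ +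
        W * M₁.map (algebraMap (𝒜 0) R), ?_⟩
      rw [pow_succ, hW, hU, Matrix.fromBlocks_multiply]
      simp only [map_even_pow, Matrix.zero_mul, Matrix.mul_zero, add_zero, zero_add, ← pow_succ]
  have hUke : IsEvenMatrix 𝒜 (U ^ k * G') := by
    refine IsEvenMatrix.mul ?_ hGe'
    clear hBU hUk
    induction k with
    | zero =>
      rw [pow_zero, ← Matrix.fromBlocks_one]
      exact hpar _ _ _ _ hone (fun _ _ => (𝒜 1).zero_mem) (fun _ _ => (𝒜 1).zero_mem) hone
    | succ k ih =>
      rw [pow_succ]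
      exact ih.mul hUe
  apply Subtype.ext
  change strMat (B.mat ^ k) = (((M₀ ^ k).trace : 𝒜 0) : R) - (((M₁ ^ k).trace : 𝒜 0) : R)
  obtain ⟨W, hW⟩ := hUk
  rw [hBU, strMat_mul_comm hGe hUke, Matrix.mul_assoc, hGG', Matrix.mul_one, hW, strMat_fromBlocks]
  congr 1
  · exact (AddMonoidHom.map_trace (algebraMap (𝒜 0) R) (M₀ ^ k)).symm
  · exact (AddMonoidHom.map_trace (algebraMap (𝒜 0) R) (M₁ ^ k)).symm

/-- The Hankel identity for an operator that can be made block triangular: the generating function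
of its exterior powers is `det (1 + X M₀) / det (1 + X M₁)`. -/
theorem det_mul_hankel_of_strPow (P : ℕ → 𝒜 0) (M₀ : Matrix (Fin p) (Fin p) (𝒜 0))
    (M₁ : Matrix (Fin q) (Fin q) (𝒜 0)) (h : ∀ k, P k = (M₀ ^ k).trace - (M₁ ^ k).trace) :
    M₁.det * hankel (zeroExtend (newtonE P)) ((p : ℤ) - q) (q + 1) =
      M₀.det * hankel (zeroExtend (newtonE P)) ((p : ℤ) - q + 2) q := by
  have h1 : newtonSeries P * (detPoly M₁ : PowerSeries (𝒜 0)) = detPoly M₀ := by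
    rw [coe_detPoly, coe_detPoly, ← newtonSeries_trace, ← newtonSeries_trace, ← newtonSeries_add]
    congr 1
    funext k
    rw [h, sub_add_cancel]
  have h2 := coeff_mul_hankel (newtonE P) _ _ p q (natDegree_detPoly_le M₀)
    (natDegree_detPoly_le M₁) h1
  rwa [coeff_detPoly, coeff_detPoly] at h2

end Triangular

section Riccati

variable {R : Type u} [Ring R] [Algebra ℚ R] {𝒜 : ZMod 2 → Submodule ℚ R} [GradedAlgebra 𝒜]
  [SuperCommutative 𝒜] {p q : ℕ}

attribute [local instance] evenAlgebra

theorem map_block00 (A : EvenOperator 𝒜 p q) :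
    A.block00.map (algebraMap (𝒜 0) R) = A.mat.toBlocks₁₁ := rfl

theorem map_block11 (A : EvenOperator 𝒜 p q) :
    A.block11.map (algebraMap (𝒜 0) R) = A.mat.toBlocks₂₂ := rfl

theorem map_schurTerm (A : EvenOperator 𝒜 p q) :
    A.schurTerm.map (algebraMap (𝒜 0) R) = A.mat.toBlocks₁₂ *
      (A.block11⁻¹.map (algebraMap (𝒜 0) R) * A.mat.toBlocks₂₁) := by
  ext1 i j
  simp only [Matrix.mul_apply, Finset.mul_sum, ← mul_assoc]
  rfl

/-- The Hankel identity for the perturbation `D + u A` of the projector `D` onto the even part of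
the superspace, given a solution `Y` of the Riccati equation. The diagonal blocks after
triangularization are `M₀ = 1 + u (A₀₀ + A₀₁ Y)` and `M₁ = u A₁₁ (1 - V Y A₀₁)` with `V = A₁₁⁻¹`,
and `det (1 - V Y A₀₁)` is inverse to `det (1 - A₀₁ V Y)`. -/
theorem pow_mul_det_mul_hankel (A B : EvenOperator 𝒜 p q) (u : 𝒜 0)
    (hB : B.mat = Matrix.fromBlocks 1 0 0 0 + u • A.mat) (hA : IsUnit A.block11)
    {Y : Matrix (Fin q) (Fin p) R} (hYodd : ∀ i j, Y i j ∈ 𝒜 1)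
    (hY : Y = u • (A.mat.toBlocks₂₁ + A.mat.toBlocks₂₂ * Y - Y * A.mat.toBlocks₁₁ -
      Y * (A.mat.toBlocks₁₂ * Y))) :
    u ^ q * A.block11.det * hankel (zeroExtend (newtonE (strPow B))) ((p : ℤ) - q) (q + 1) =
      (1 + u • (A.block00 - A.schurTerm)).det *
        hankel (zeroExtend (newtonE (strPow B))) ((p : ℤ) - q + 2) q := by
  set A₀₀ := A.mat.toBlocks₁₁ with hA₀₀
  set A₀₁ := A.mat.toBlocks₁₂ with hA₀₁
  set A₁₀ := A.mat.toBlocks₂₁ with hA₁₀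
  set A₁₁ := A.mat.toBlocks₂₂ with hA₁₁
  set V := A.block11⁻¹.map (algebraMap (𝒜 0) R) with hV
  have hdet : IsUnit A.block11.det := (Matrix.isUnit_iff_isUnit_det _).1 hA
  have hone : (1 : Matrix (Fin q) (Fin q) (𝒜 0)).map (algebraMap (𝒜 0) R) = 1 :=
    Matrix.map_one _ rfl rfl
  have hone' : (1 : Matrix (Fin p) (Fin p) (𝒜 0)).map (algebraMap (𝒜 0) R) = 1 :=
    Matrix.map_one _ rfl rfl
  have hVA : V * A₁₁ = 1 := by
    rw [hV, hA₁₁, ← map_block11, ← Matrix.map_mul, Matrix.nonsing_inv_mul _ hdet, hone]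
  have hAV : A₁₁ * V = 1 := by
    rw [hV, hA₁₁, ← map_block11, ← Matrix.map_mul, Matrix.mul_nonsing_inv _ hdet, hone]
  have h01 : ∀ i j, A₀₁ i j ∈ 𝒜 1 := toBlocks₁₂_mem A
  have hZ : ∀ i j, (V * Y) i j ∈ 𝒜 1 :=
    matrix_mul_mem (fun i j => (A.block11⁻¹ i j).2) hYodd (by decide)
  let K : Matrix (Fin p) (Fin p) (𝒜 0) :=
    evenMat (A₀₁ * (V * Y)) (matrix_mul_mem h01 hZ (by decide))
  let L : Matrix (Fin q) (Fin q) (𝒜 0) :=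
    evenMat (V * Y * A₀₁) (matrix_mul_mem hZ h01 (by decide))
  let N : Matrix (Fin p) (Fin p) (𝒜 0) :=
    evenMat (A₀₁ * Y) (matrix_mul_mem h01 hYodd (by decide))
  let N' : Matrix (Fin q) (Fin q) (𝒜 0) :=
    evenMat (Y * A₀₁) (matrix_mul_mem hYodd h01 (by decide))
  have hK : K.map (algebraMap (𝒜 0) R) = A₀₁ * (V * Y) := rfl
  have hL : L.map (algebraMap (𝒜 0) R) = V * Y * A₀₁ := rfl
  have hN : N.map (algebraMap (𝒜 0) R) = A₀₁ * Y := rfl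
  have hN' : N'.map (algebraMap (𝒜 0) R) = Y * A₀₁ := rfl
  have hsmul : ∀ {m n : Type} (M : Matrix m n (𝒜 0)),
      (u • M).map (algebraMap (𝒜 0) R) = u • M.map (algebraMap (𝒜 0) R) := fun M => rfl
  have hadd : ∀ {m n : Type} (M M' : Matrix m n (𝒜 0)), (M + M').map (algebraMap (𝒜 0) R) =
      M.map (algebraMap (𝒜 0) R) + M'.map (algebraMap (𝒜 0) R) := fun M M' => rfl
  have hsub : ∀ {m n : Type} (M M' : Matrix m n (𝒜 0)), (M - M').map (algebraMap (𝒜 0) R) =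
      M.map (algebraMap (𝒜 0) R) - M'.map (algebraMap (𝒜 0) R) := fun M M' => rfl
  have hblocks : B.mat = Matrix.fromBlocks (1 + u • A₀₀) (u • A₀₁) (u • A₁₀) (u • A₁₁) := by
    rw [hB]
    conv_lhs => rw [← Matrix.fromBlocks_toBlocks A.mat]
    rw [Matrix.fromBlocks_smul, Matrix.fromBlocks_add, zero_add, zero_add, zero_add]
  have h11 : B.mat.toBlocks₁₁ = 1 + u • A₀₀ := by rw [hblocks, Matrix.toBlocks_fromBlocks₁₁]
  have h12 : B.mat.toBlocks₁₂ = u • A₀₁ := by rw [hblocks, Matrix.toBlocks_fromBlocks₁₂]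
  have h21 : B.mat.toBlocks₂₁ = u • A₁₀ := by rw [hblocks, Matrix.toBlocks_fromBlocks₂₁]
  have h22 : B.mat.toBlocks₂₂ = u • A₁₁ := by rw [hblocks, Matrix.toBlocks_fromBlocks₂₂]
  have hric : B.mat.toBlocks₂₁ + B.mat.toBlocks₂₂ * Y =
      Y * (B.mat.toBlocks₁₁ + B.mat.toBlocks₁₂ * Y) := by
    rw [h11, h12, h21, h22]
    simp only [Matrix.mul_add, Matrix.mul_one, Matrix.smul_mul, Matrix.mul_smul]
    nth_rewrite 2 [hY]
    simp only [smul_add, smul_sub]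
    abel
  have hH := det_mul_hankel_of_strPow (strPow B) (1 + u • A.block00 + u • N)
    (u • (A.block11 * (1 - L))) (strPow_eq_of_riccati B hYodd hric _ _
      (by rw [hadd, hadd, hsmul, hsmul, hone', hN, map_block00, h11, h12, Matrix.smul_mul])
      (by
        rw [hsmul, Matrix.map_mul, hsub, hone, hL, map_block11, h22, h12, Matrix.mul_sub,
          Matrix.mul_one, Matrix.mul_smul, ← Matrix.mul_assoc, ← Matrix.mul_assoc, hAV,
          Matrix.one_mul, smul_sub]))
  -- the Riccati equation multiplied by `A₀₁ V` removes `Y` from `(1 - A₀₁ V Y) M₀`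
  have hKN : (1 - K) * (1 + u • A.block00 + u • N) = 1 + u • (A.block00 - A.schurTerm) := by
    apply even_map_injective
    rw [Matrix.map_mul, hsub, hadd, hadd, hadd, hsmul, hsmul, hsmul, hsub, hone', hK, hN,
      map_block00, map_schurTerm]
    have hVY : V * Y = u • (V * A₁₀ + Y - V * (Y * A₀₀) - V * (Y * (A₀₁ * Y))) := by
      conv_lhs => rw [hY]
      rw [Matrix.mul_smul, Matrix.mul_sub, Matrix.mul_sub, Matrix.mul_add, ← Matrix.mul_assoc V A₁₁,
        hVA, Matrix.one_mul]
    have hXVY : A₀₁ * (V * Y) = u • (A₀₁ * (V * A₁₀)) + u • (A₀₁ * Y) -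
        u • (A₀₁ * (V * (Y * A₀₀))) - u • (A₀₁ * (V * (Y * (A₀₁ * Y)))) := by
      conv_lhs => rw [hVY]
      simp only [Matrix.mul_smul, Matrix.mul_sub, Matrix.mul_add, smul_add, smul_sub]
    simp only [Matrix.sub_mul, Matrix.one_mul, Matrix.mul_add, Matrix.mul_one, Matrix.mul_smul,
      Matrix.mul_assoc, smul_sub]
    nth_rewrite 1 [hXVY]
    abel
  have h1 := det_one_sub_mul_det_one_sub h01 hZ K L hK hL
  rw [Matrix.det_smul, Matrix.det_mul, Fintype.card_fin] at hH
  rw [← hKN, Matrix.det_mul]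
  linear_combination (1 - K).det * hH - u ^ q * A.block11.det *
    hankel (zeroExtend (newtonE (strPow B))) ((p : ℤ) - q) (q + 1) * h1

end Riccati

/-! ### Power series over a supercommutative ring -/

section Series

open PowerSeries

variable {R : Type u} [Ring R] [Algebra ℚ R] (𝒜 : ZMod 2 → Submodule ℚ R)

/-- The grading of the ring of power series in an even variable. -/
def seriesGrading (i : ZMod 2) : Submodule ℚ R⟦X⟧ where
  carrier := {f | ∀ n, coeff n f ∈ 𝒜 i}
  add_mem' hf hg n := by
    rw [map_add]
    exact (𝒜 i).add_mem (hf n) (hg n)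
  zero_mem' n := by
    rw [map_zero]
    exact (𝒜 i).zero_mem
  smul_mem' c f hf n := (𝒜 i).smul_mem c (hf n)

variable [GradedAlgebra 𝒜]

theorem isInternal_seriesGrading : DirectSum.IsInternal (seriesGrading 𝒜) := by
  rw [DirectSum.isInternal_submodule_iff_isCompl (seriesGrading 𝒜) (i := 0) (j := 1) (by decide)
    (by ext i; revert i; decide)]
  constructor
  · rw [Submodule.disjoint_def]
    intro f h0 h1
    ext n
    exact eq_zero_of_mem_of_mem (𝒜 := 𝒜) 0 (h0 n) (h1 n)
  · rw [codisjoint_iff, eq_top_iff]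
    intro f _
    choose y hy z hz hyz using fun n => exists_add_of_zmod2 (𝒜 := 𝒜) 0 (coeff n f)
    refine Submodule.mem_sup.2 ⟨mk y, fun n => ?_, mk z, fun n => ?_, ?_⟩
    · rw [coeff_mk]; exact hy n
    · rw [coeff_mk]; exact hz n
    · ext n
      rw [map_add, coeff_mk, coeff_mk, ← hyz]

instance seriesGradedAlgebra : GradedAlgebra (seriesGrading 𝒜) where
  toDecomposition := (isInternal_seriesGrading 𝒜).chooseDecomposition
  one_mem n := by
    rw [coeff_one]
    split_ifs
    · exact SetLike.GradedOne.one_mem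
    · exact (𝒜 0).zero_mem
  mul_mem i j f g hf hg n := by
    rw [coeff_mul]
    exact (𝒜 _).sum_mem fun x _ => SetLike.GradedMul.mul_mem (hf _) (hg _)

instance seriesSuperCommutative [SuperCommutative 𝒜] : SuperCommutative (seriesGrading 𝒜) where
  mul_comm' i j f g hf hg := by
    ext n
    have h : ∀ (z : ℤˣ) (f : R⟦X⟧), coeff n (z • f) = z • coeff n f := by
      intro z f
      rw [Units.smul_def, Units.smul_def, map_zsmul]
    rw [h, coeff_mul, coeff_mul, ← Finset.Nat.sum_antidiagonal_swap, Finset.smul_sum]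
    exact Finset.sum_congr rfl fun x _ => SuperCommutative.mul_comm' _ _ _ _ (hf _) (hg _)

end Series

/-! ### Top coefficients in the deformation parameter -/

section TopCoeff

open PowerSeries

/-- The power series `f` is a polynomial of degree at most `n` with coefficient `a` at `Xⁿ`. -/
def HasTopCoeff {R : Type*} [Semiring R] (f : R⟦X⟧) (n : ℕ) (a : R) : Prop :=
  coeff n f = a ∧ ∀ m, n < m → coeff m f = 0

namespace HasTopCoeff

variable {R : Type*} [Ring R] {f g : R⟦X⟧} {m n : ℕ} {a b : R}

theorem zero (n : ℕ) : HasTopCoeff (0 : R⟦X⟧) n 0 := ⟨map_zero _, fun _ _ => map_zero _⟩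

theorem const (a : R) : HasTopCoeff (C a) 0 a :=
  ⟨by simp, fun m hm => by rw [coeff_C, if_neg hm.ne']⟩

theorem var : HasTopCoeff (X : R⟦X⟧) 1 1 :=
  ⟨coeff_one_X, fun m hm => by rw [coeff_X, if_neg hm.ne']⟩

theorem const_succ (a : R) (n : ℕ) : HasTopCoeff (C a) (n + 1) 0 :=
  ⟨by rw [coeff_C, if_neg (Nat.succ_ne_zero n)], fun m hm => by rw [coeff_C, if_neg (by omega)]⟩

theorem add (hf : HasTopCoeff f n a) (hg : HasTopCoeff g n b) : HasTopCoeff (f + g) n (a + b) :=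
  ⟨by rw [map_add, hf.1, hg.1], fun m hm => by rw [map_add, hf.2 m hm, hg.2 m hm, add_zero]⟩

theorem neg (hf : HasTopCoeff f n a) : HasTopCoeff (-f) n (-a) :=
  ⟨by rw [map_neg, hf.1], fun m hm => by rw [map_neg, hf.2 m hm, neg_zero]⟩

theorem units_smul (z : ℤˣ) (hf : HasTopCoeff f n a) : HasTopCoeff (z • f) n (z • a) := by
  rcases Int.units_eq_one_or z with rfl | rfl
  · simpa using hf
  · simpa [Units.neg_smul] using hf.neg

theorem rat_smul [Algebra ℚ R] (c : ℚ) (hf : HasTopCoeff f n a) :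
    HasTopCoeff (c • f) n (c • a) :=
  ⟨by rw [coeff_smul, hf.1], fun m hm => by rw [coeff_smul, hf.2 m hm, smul_zero]⟩

theorem mul (hf : HasTopCoeff f m a) (hg : HasTopCoeff g n b) :
    HasTopCoeff (f * g) (m + n) (a * b) := by
  have h : ∀ k, m + n ≤ k → ∀ x ∈ Finset.HasAntidiagonal.antidiagonal k, x ≠ (m, n) →
      coeff x.1 f * coeff x.2 g = 0 := by
    intro k hk x hx hne
    rw [Finset.HasAntidiagonal.mem_antidiagonal] at hx
    rcases lt_trichotomy x.1 m with h | h | h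
    · rw [hg.2 x.2 (by omega), mul_zero]
    · have : x.2 ≠ n := fun e => hne (Prod.ext h e)
      rw [hg.2 x.2 (by omega), mul_zero]
    · rw [hf.2 _ h, zero_mul]
  constructor
  · rw [coeff_mul, Finset.sum_eq_single (m, n) (h _ le_rfl) (by simp), hf.1, hg.1]
  · intro k hk
    rw [coeff_mul]
    refine Finset.sum_eq_zero fun x hx => h k hk.le x hx ?_
    rintro rfl
    rw [Finset.HasAntidiagonal.mem_antidiagonal] at hx
    exact hk.ne hx

theorem sum {ι : Type*} (s : Finset ι) {f : ι → R⟦X⟧} {a : ι → R}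
    (h : ∀ i ∈ s, HasTopCoeff (f i) n (a i)) : HasTopCoeff (∑ i ∈ s, f i) n (∑ i ∈ s, a i) :=
  ⟨by rw [map_sum]; exact Finset.sum_congr rfl fun i hi => (h i hi).1, fun m hm => by
    rw [map_sum]; exact Finset.sum_eq_zero fun i hi => (h i hi).2 m hm⟩

end HasTopCoeff

variable {R : Type u} [Ring R] [Algebra ℚ R] {𝒜 : ZMod 2 → Submodule ℚ R} [GradedAlgebra 𝒜]
  [SuperCommutative 𝒜]

/-- `HasTopCoeff` for elements of the even parts. -/
def EvenTopCoeff (f : seriesGrading 𝒜 0) (n : ℕ) (a : 𝒜 0) : Prop :=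
  HasTopCoeff (f : R⟦X⟧) n (a : R)

namespace EvenTopCoeff

variable {f g : seriesGrading 𝒜 0} {m n : ℕ} {a b : 𝒜 0}

omit [GradedAlgebra 𝒜] [SuperCommutative 𝒜] in
theorem unique (h : EvenTopCoeff f n a) (h' : EvenTopCoeff f n b) : a = b :=
  Subtype.ext (h.1.symm.trans h'.1)

omit [GradedAlgebra 𝒜] [SuperCommutative 𝒜] in
theorem zero (n : ℕ) : EvenTopCoeff (0 : seriesGrading 𝒜 0) n 0 := HasTopCoeff.zero n

omit [SuperCommutative 𝒜] in
theorem one : EvenTopCoeff (1 : seriesGrading 𝒜 0) 0 1 := by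
  have := HasTopCoeff.const (1 : R)
  rwa [map_one] at this

omit [GradedAlgebra 𝒜] [SuperCommutative 𝒜] in
theorem add (hf : EvenTopCoeff f n a) (hg : EvenTopCoeff g n b) : EvenTopCoeff (f + g) n (a + b) :=
  HasTopCoeff.add hf hg

omit [SuperCommutative 𝒜] in
theorem mul (hf : EvenTopCoeff f m a) (hg : EvenTopCoeff g n b) :
    EvenTopCoeff (f * g) (m + n) (a * b) := HasTopCoeff.mul hf hg

theorem units_smul (z : ℤˣ) (hf : EvenTopCoeff f n a) : EvenTopCoeff (z • f) n (z • a) := by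
  rcases Int.units_eq_one_or z with rfl | rfl
  · simpa using hf
  · simp only [Units.neg_smul, one_smul]
    exact HasTopCoeff.neg hf

omit [GradedAlgebra 𝒜] [SuperCommutative 𝒜] in
theorem rat_smul (c : ℚ) (hf : EvenTopCoeff f n a) : EvenTopCoeff (c • f) n (c • a) :=
  HasTopCoeff.rat_smul c hf

omit [GradedAlgebra 𝒜] [SuperCommutative 𝒜] in
theorem sum {ι : Type*} (s : Finset ι) {f : ι → seriesGrading 𝒜 0} {a : ι → 𝒜 0}
    (h : ∀ i ∈ s, EvenTopCoeff (f i) n (a i)) : EvenTopCoeff (∑ i ∈ s, f i) n (∑ i ∈ s, a i) := by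
  classical
  induction s using Finset.induction_on with
  | empty => exact zero n
  | insert i s hi ih =>
    rw [Finset.sum_insert hi, Finset.sum_insert hi]
    exact (h i (Finset.mem_insert_self i s)).add
      (ih fun j hj => h j (Finset.mem_insert_of_mem hj))

theorem prod {ι : Type*} (s : Finset ι) {f : ι → seriesGrading 𝒜 0} {n : ι → ℕ} {a : ι → 𝒜 0}
    (h : ∀ i ∈ s, EvenTopCoeff (f i) (n i) (a i)) :
    EvenTopCoeff (∏ i ∈ s, f i) (∑ i ∈ s, n i) (∏ i ∈ s, a i) := by
  classical
  induction s using Finset.induction_on with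
  | empty => exact one
  | insert i s hi ih =>
    rw [Finset.prod_insert hi, Finset.prod_insert hi, Finset.sum_insert hi]
    exact (h i (Finset.mem_insert_self i s)).mul
      (ih fun j hj => h j (Finset.mem_insert_of_mem hj))

theorem pow (hf : EvenTopCoeff f n a) (k : ℕ) : EvenTopCoeff (f ^ k) (k * n) (a ^ k) := by
  have := prod (Finset.range k) (f := fun _ => f) (n := fun _ => n) (a := fun _ => a)
    fun _ _ => hf
  simpa using this

theorem det {k N : ℕ} (M : Matrix (Fin k) (Fin k) (seriesGrading 𝒜 0))
    (L : Matrix (Fin k) (Fin k) (𝒜 0))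
    (h : ∀ σ : Equiv.Perm (Fin k), EvenTopCoeff (∏ i, M (σ i) i) N (∏ i, L (σ i) i)) :
    EvenTopCoeff M.det N L.det := by
  rw [Matrix.det_apply, Matrix.det_apply]
  exact sum _ fun σ _ => (h σ).units_smul _

/-- The Hankel determinant of a sequence in which the `k`-th term has degree at most `k`: every term
of the expansion of the determinant has the same total degree. -/
theorem hankel {c : ℤ → seriesGrading 𝒜 0} {d : ℤ → 𝒜 0}
    (h : ∀ k : ℕ, EvenTopCoeff (c k) k (d k)) (hneg : ∀ k : ℤ, k < 0 → c k = 0 ∧ d k = 0)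
    (x : ℤ) (k N : ℕ) (hN : (N : ℤ) = k * (x + k - 1)) :
    EvenTopCoeff (hankel c x k) N (SuperLin.hankel d x k) := by
  refine det _ _ fun σ => ?_
  simp only [Matrix.of_apply]
  by_cases hσ : ∀ i : Fin k, 0 ≤ x + (σ i : ℕ) + (i : ℕ)
  · have h1 : ∀ i ∈ Finset.univ, EvenTopCoeff (c (x + (σ i : ℕ) + (i : ℕ)))
        (x + (σ i : ℕ) + (i : ℕ)).toNat (d (x + (σ i : ℕ) + (i : ℕ))) := by
      intro i _
      have := h (x + (σ i : ℕ) + (i : ℕ)).toNat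
      rwa [Int.toNat_of_nonneg (hσ i)] at this
    have h2 := prod Finset.univ h1
    have h3 : ∑ i : Fin k, (x + (σ i : ℕ) + (i : ℕ)).toNat = N := by
      have h4 : ∀ k : ℕ, 2 * ∑ i : Fin k, ((i : ℕ) : ℤ) = k * (k - 1) := by
        intro k
        induction k with
        | zero => simp
        | succ k ih =>
          rw [Fin.sum_univ_castSucc, mul_add]
          simp only [Fin.val_castSucc, Fin.val_last]
          rw [ih]
          push_cast
          ring
      zify
      simp only [Int.toNat_of_nonneg (hσ _), Finset.sum_add_distrib, Finset.sum_const,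
        Finset.card_univ, Fintype.card_fin, nsmul_eq_mul]
      rw [Equiv.sum_comp σ fun i : Fin k => ((i : ℕ) : ℤ), hN]
      linear_combination h4 k
    rwa [h3] at h2
  · push Not at hσ
    obtain ⟨i, hi⟩ := hσ
    rw [Finset.prod_eq_zero (Finset.mem_univ i) (hneg _ hi).1,
      Finset.prod_eq_zero (Finset.mem_univ i) (hneg _ hi).2]
    exact zero N

theorem newtonE {P : ℕ → seriesGrading 𝒜 0} {Q : ℕ → 𝒜 0}
    (h : ∀ k, EvenTopCoeff (P k) k (Q k)) (k : ℕ) :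
    EvenTopCoeff (newtonE P k) k (SuperLin.newtonE Q k) := by
  induction k using Nat.strong_induction_on with
  | _ k ih =>
    cases k with
    | zero =>
      rw [newtonE_zero, newtonE_zero]
      exact one
    | succ k =>
      rw [newtonE_succ, newtonE_succ]
      refine (sum _ fun i _ => ?_).rat_smul _
      have h1 := ((h (i + 1)).mul (ih (k - i) (by omega))).units_smul ((-1) ^ (i : ℕ))
      have h2 : ∀ {S : Type u} [CommRing S] (x y : S), ((-1 : ℤˣ) ^ (i : ℕ)) • (x * y) =
          (-1) ^ (i : ℕ) * x * y := by
        intro S _ x y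
        rw [Units.smul_def, mul_assoc, zsmul_eq_mul]
        push_cast
        rfl
      rw [h2, h2] at h1
      have h3 : (i : ℕ) + 1 + (k - i) = k + 1 := by omega
      rwa [h3] at h1

end EvenTopCoeff

end TopCoeff

/-! ### The Hankel determinants and the Berezinian -/

section Berezinian

open PowerSeries

attribute [local instance] evenAlgebra

variable {R : Type u} [Ring R] [Algebra ℚ R] {𝒜 : ZMod 2 → Submodule ℚ R} [GradedAlgebra 𝒜]
  [SuperCommutative 𝒜] {p q : ℕ}

/-- The coefficients of the solution of the Riccati equation `Y = X (c + d Y - Y a - Y b Y)`. -/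
def riccati (a : Matrix (Fin p) (Fin p) R) (b : Matrix (Fin p) (Fin q) R)
    (c : Matrix (Fin q) (Fin p) R) (d : Matrix (Fin q) (Fin q) R) : ℕ → Matrix (Fin q) (Fin p) R
  | 0 => 0
  | n + 1 => (if n = 0 then c else 0) + d * riccati a b c d n - riccati a b c d n * a -
      ∑ i : Fin (n + 1), riccati a b c d i * (b * riccati a b c d (n - i))
decreasing_by all_goals omega

omit [Algebra ℚ R] in
theorem riccati_zero (a : Matrix (Fin p) (Fin p) R) (b : Matrix (Fin p) (Fin q) R)
    (c : Matrix (Fin q) (Fin p) R) (d : Matrix (Fin q) (Fin q) R) : riccati a b c d 0 = 0 := by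
  rw [riccati]

omit [Algebra ℚ R] in
theorem riccati_succ (a : Matrix (Fin p) (Fin p) R) (b : Matrix (Fin p) (Fin q) R)
    (c : Matrix (Fin q) (Fin p) R) (d : Matrix (Fin q) (Fin q) R) (n : ℕ) :
    riccati a b c d (n + 1) = (if n = 0 then c else 0) + d * riccati a b c d n -
      riccati a b c d n * a -
        ∑ i : Fin (n + 1), riccati a b c d i * (b * riccati a b c d (n - i)) := by
  rw [riccati]

omit [Algebra ℚ R] in
theorem coeff_map_C_mul {l m n : Type*} [Fintype m] (M : Matrix l m R) (N : Matrix m n R⟦X⟧)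
    (k : ℕ) :
    (M.map (C (R := R)) * N).map (coeff k) = M * N.map (coeff k) := by
  ext1 i j
  simp [Matrix.mul_apply, coeff_C_mul]

omit [Algebra ℚ R] in
theorem coeff_mul_map_C {l m n : Type*} [Fintype m] (M : Matrix l m R⟦X⟧) (N : Matrix m n R)
    (k : ℕ) :
    (M * N.map (C (R := R))).map (coeff k) = M.map (coeff k) * N := by
  ext1 i j
  simp [Matrix.mul_apply, coeff_mul_C]

omit [Algebra ℚ R] in
theorem coeff_matrix_mul {l m n : Type*} [Fintype m] (M : Matrix l m R⟦X⟧) (N : Matrix m n R⟦X⟧)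
    (k : ℕ) : (M * N).map (coeff k) =
      ∑ i : Fin (k + 1), M.map (coeff (i : ℕ)) * N.map (coeff (k - i)) := by
  ext1 i j
  rw [Matrix.map_apply, Matrix.mul_apply, map_sum, Matrix.sum_apply]
  simp only [Matrix.mul_apply, Matrix.map_apply, coeff_mul,
    Finset.Nat.sum_antidiagonal_eq_sum_range_succ_mk]
  rw [Finset.sum_comm, Fin.sum_univ_eq_sum_range
    fun x => ∑ l, coeff x (M i l) * coeff (k - x) (N l j)]

/-- The operator over the ring of power series with the same matrix. -/
def EvenOperator.series (A : EvenOperator 𝒜 p q) : EvenOperator (seriesGrading 𝒜) p q where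
  mat := A.mat.map (C (R := R))
  mem i j n := by
    rw [Matrix.map_apply, coeff_C]
    split_ifs
    · exact A.mem i j
    · exact Submodule.zero_mem _

/-- The variable as an element of the even part. -/
def evenX (𝒜 : ZMod 2 → Submodule ℚ R) [GradedAlgebra 𝒜] : seriesGrading 𝒜 0 :=
  ⟨X, fun n => by
    rw [coeff_X]
    split_ifs
    · exact SetLike.GradedOne.one_mem
    · exact Submodule.zero_mem _⟩

/-- The constant power series with even coefficients. -/
def evenC (𝒜 : ZMod 2 → Submodule ℚ R) [GradedAlgebra 𝒜] [SuperCommutative 𝒜] :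
    𝒜 0 →+* seriesGrading 𝒜 0 where
  toFun a := ⟨C (a : R), fun n => by
    rw [coeff_C]
    split_ifs
    · exact a.2
    · exact Submodule.zero_mem _⟩
  map_one' := Subtype.ext (map_one (C (R := R)))
  map_mul' _ _ := Subtype.ext (map_mul (C (R := R)) _ _)
  map_zero' := Subtype.ext (map_zero (C (R := R)))
  map_add' _ _ := Subtype.ext (map_add (C (R := R)) _ _)

theorem coe_evenC (a : 𝒜 0) : ((evenC 𝒜 a : seriesGrading 𝒜 0) : R⟦X⟧) = C (a : R) := rfl

/-- The Riccati equation has an odd solution in formal power series: the factor `X` on the right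
makes it a recursion for the coefficients. -/
theorem exists_riccati (A : EvenOperator 𝒜 p q) : ∃ Y : Matrix (Fin q) (Fin p) R⟦X⟧,
    (∀ i j, Y i j ∈ seriesGrading 𝒜 1) ∧
    Y = evenX 𝒜 • (A.series.mat.toBlocks₂₁ + A.series.mat.toBlocks₂₂ * Y -
      Y * A.series.mat.toBlocks₁₁ - Y * (A.series.mat.toBlocks₁₂ * Y)) := by
  set a := A.mat.toBlocks₁₁ with ha
  set b := A.mat.toBlocks₁₂ with hb
  set c := A.mat.toBlocks₂₁ with hc
  set d := A.mat.toBlocks₂₂ with hd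
  have ha' : ∀ i j, a i j ∈ 𝒜 0 := fun i j => (A.block00 i j).2
  have hb' : ∀ i j, b i j ∈ 𝒜 1 := toBlocks₁₂_mem A
  have hc' : ∀ i j, c i j ∈ 𝒜 1 := toBlocks₂₁_mem A
  have hd' : ∀ i j, d i j ∈ 𝒜 0 := fun i j => (A.block11 i j).2
  have hodd : ∀ n i j, riccati a b c d n i j ∈ 𝒜 1 := by
    intro n
    induction n using Nat.strong_induction_on with
    | _ n ih =>
      intro i j
      cases n with
      | zero =>
        rw [riccati_zero]
        exact (𝒜 1).zero_mem
      | succ n =>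
        rw [riccati_succ]
        refine (𝒜 1).sub_mem ((𝒜 1).sub_mem ((𝒜 1).add_mem ?_ ?_) ?_) ?_
        · split_ifs
          · exact hc' i j
          · exact (𝒜 1).zero_mem
        · exact matrix_mul_mem hd' (ih n (by omega)) (by decide) i j
        · exact matrix_mul_mem (ih n (by omega)) ha' (by decide) i j
        · rw [Matrix.sum_apply]
          refine (𝒜 1).sum_mem fun k _ => ?_
          exact matrix_mul_mem (ih k (by omega))
            (matrix_mul_mem hb' (ih (n - k) (by omega)) (by decide : (1 : ZMod 2) + 1 = 0))
            (by decide) i j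
  refine ⟨Matrix.of fun i j => mk fun n => riccati a b c d n i j, fun i j n => ?_, ?_⟩
  · rw [Matrix.of_apply, coeff_mk]
    exact hodd n i j
  set Y : Matrix (Fin q) (Fin p) R⟦X⟧ :=
    Matrix.of fun i j => mk fun n => riccati a b c d n i j with hY
  have hYn : ∀ n, Y.map (coeff n) = riccati a b c d n := by
    intro n
    ext1 i j
    simp [hY]
  have hcn : ∀ n, (c.map (C (R := R))).map (coeff n) = if n = 0 then c else 0 := by
    intro n
    ext1 i j
    rw [Matrix.map_apply, Matrix.map_apply, coeff_C]
    split_ifs <;> rfl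
  change Y = evenX 𝒜 • (c.map (C (R := R)) + d.map (C (R := R)) * Y - Y * a.map (C (R := R)) -
    Y * (b.map (C (R := R)) * Y))
  ext i j n
  rw [Matrix.smul_apply, even_smul_def]
  change coeff n (Y i j) = coeff n (X * _)
  cases n with
  | zero =>
    rw [coeff_zero_X_mul, hY, Matrix.of_apply, coeff_mk, riccati_zero]
    rfl
  | succ n =>
    rw [coeff_succ_X_mul]
    have h : ∀ M : Matrix (Fin q) (Fin p) R⟦X⟧, coeff n (M i j) = M.map (coeff n) i j :=
      fun M => rfl
    rw [Matrix.sub_apply, Matrix.sub_apply, Matrix.add_apply, map_sub, map_sub, map_add, h, h, h, h,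
      hcn, coeff_map_C_mul, coeff_mul_map_C, coeff_matrix_mul]
    simp only [coeff_map_C_mul, hYn]
    rw [← Matrix.add_apply, ← Matrix.sub_apply, ← Matrix.sub_apply, ← riccati_succ, ← hYn]
    rfl

/-- The deformation `D + X A` of an even operator `A`, where `D` is the projector onto the even
part of the superspace. -/
def EvenOperator.deform (A : EvenOperator 𝒜 p q) : EvenOperator (seriesGrading 𝒜) p q where
  mat := Matrix.fromBlocks 1 0 0 0 + evenX 𝒜 • A.series.mat
  mem i j := by
    refine Submodule.add_mem _ ?_ ?_
    · rcases i with i | i <;> rcases j with j | j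
      · rw [Matrix.fromBlocks_apply₁₁, Matrix.one_apply]
        split_ifs
        · rw [show par (Sum.inl i : Fin p ⊕ Fin q) + par (Sum.inl j : Fin p ⊕ Fin q) = 0 by
            simp [par]]
          exact SetLike.GradedOne.one_mem
        · exact Submodule.zero_mem _
      all_goals exact Submodule.zero_mem _
    · have := SetLike.GradedMul.mul_mem (evenX 𝒜).2 (A.series.mem i j)
      rwa [zero_add] at this

/-- As a polynomial in `X`, the power `(D + X A)^k` has leading coefficient `A^k`. -/
theorem hasTopCoeff_deform_pow (A : EvenOperator 𝒜 p q) (k : ℕ) (i j : Fin p ⊕ Fin q) :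
    HasTopCoeff ((A.deform.mat ^ k) i j) k ((A.mat ^ k) i j) := by
  have h1 : ∀ i j, HasTopCoeff (A.deform.mat i j) 1 (A.mat i j) := by
    intro i j
    have h2 := HasTopCoeff.var.mul (HasTopCoeff.const (A.mat i j))
    rw [one_mul, add_zero] at h2
    have h3 : HasTopCoeff ((Matrix.fromBlocks 1 0 0 0 : Matrix (Fin p ⊕ Fin q) (Fin p ⊕ Fin q)
        R⟦X⟧) i j) 1 0 := by
      rcases i with i | i <;> rcases j with j | j
      · rw [Matrix.fromBlocks_apply₁₁, Matrix.one_apply]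
        split_ifs
        · rw [← map_one (C (R := R))]
          exact HasTopCoeff.const_succ 1 0
        · exact HasTopCoeff.zero 1
      all_goals exact HasTopCoeff.zero 1
    have h4 := h3.add h2
    rwa [zero_add] at h4
  induction k generalizing i j with
  | zero =>
    rw [pow_zero, pow_zero, Matrix.one_apply, Matrix.one_apply]
    split_ifs
    · have := HasTopCoeff.const (1 : R)
      rwa [map_one] at this
    · exact HasTopCoeff.zero 0
  | succ k ih =>
    rw [pow_succ, pow_succ, Matrix.mul_apply, Matrix.mul_apply]
    exact HasTopCoeff.sum _ fun l _ => (ih i l).mul (h1 l j)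

theorem evenTopCoeff_strPow_deform (A : EvenOperator 𝒜 p q) (k : ℕ) :
    EvenTopCoeff (strPow A.deform k) k (strPow A k) := by
  change HasTopCoeff (∑ i, ((-1 : ℤˣ) ^ par i) • (A.deform.mat ^ k) i i) k
    (∑ i, ((-1 : ℤˣ) ^ par i) • (A.mat ^ k) i i)
  exact HasTopCoeff.sum _ fun i _ => (hasTopCoeff_deform_pow A k i i).units_smul _

/-- The leading coefficient in `X` of a Hankel determinant of the deformation is that of `A` itself.
-/
theorem evenTopCoeff_hankel_deform (A : EvenOperator 𝒜 p q) (x : ℤ) (k N : ℕ)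
    (hN : (N : ℤ) = k * (x + k - 1)) :
    EvenTopCoeff (hankel (zeroExtend (newtonE (strPow A.deform))) x k) N
      (hankel (zeroExtend (newtonE (strPow A))) x k) :=
  EvenTopCoeff.hankel (fun k => EvenTopCoeff.newtonE (evenTopCoeff_strPow_deform A) k)
    (fun _ hk => ⟨zeroExtend_of_neg _ hk, zeroExtend_of_neg _ hk⟩) x k N hN

theorem block00_series (A : EvenOperator 𝒜 p q) :
    A.series.block00 = A.block00.map (evenC 𝒜) := rfl

theorem block11_series (A : EvenOperator 𝒜 p q) :
    A.series.block11 = A.block11.map (evenC 𝒜) := rfl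

theorem schurTerm_series (A : EvenOperator 𝒜 p q) (hA : IsUnit A.block11) :
    A.series.schurTerm = A.schurTerm.map (evenC 𝒜) := by
  have hdet : IsUnit A.block11.det := (Matrix.isUnit_iff_isUnit_det _).1 hA
  have hinv : A.series.block11⁻¹ = A.block11⁻¹.map (evenC 𝒜) := by
    refine Matrix.inv_eq_right_inv ?_
    rw [block11_series, ← Matrix.map_mul, Matrix.mul_nonsing_inv _ hdet,
      Matrix.map_one _ (map_zero _) (map_one _)]
  ext1 i j
  apply Subtype.ext
  change ∑ k : Fin q, ∑ l : Fin q, C (A.mat (Sum.inl i) (Sum.inr k)) *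
    ((A.series.block11⁻¹ k l : seriesGrading 𝒜 0) : R⟦X⟧) * C (A.mat (Sum.inr l) (Sum.inl j)) =
    C (∑ k : Fin q, ∑ l : Fin q, A.mat (Sum.inl i) (Sum.inr k) * ((A.block11⁻¹ k l : 𝒜 0) : R) *
        A.mat (Sum.inr l) (Sum.inl j))
  simp only [map_sum, map_mul, hinv, Matrix.map_apply, coe_evenC]

/-- The comparison of the coefficients of the highest power `X^{p+q(p+1)}` in the identity
`pow_mul_det_mul_hankel` for the deformation `D + X A`. On both sides the degrees are at most `p + q
(p + 1)`. -/
theorem det_block11_mul_hankel (A : EvenOperator 𝒜 p q) (hA : IsUnit A.block11) :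
    A.block11.det * hankel (zeroExtend (newtonE (strPow A))) ((p : ℤ) - q) (q + 1) =
      (A.block00 - A.schurTerm).det *
        hankel (zeroExtend (newtonE (strPow A))) ((p : ℤ) - q + 2) q := by
  obtain ⟨Y, hYodd, hY⟩ := exists_riccati A
  have hA' : IsUnit A.series.block11 := hA.map (evenC 𝒜).mapMatrix
  have h := pow_mul_det_mul_hankel A.series A.deform (evenX 𝒜) rfl hA' hYodd hY
  have hX : EvenTopCoeff (evenX 𝒜) 1 1 := HasTopCoeff.var
  have hdet : EvenTopCoeff A.series.block11.det 0 A.block11.det := by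
    rw [block11_series, ← RingHom.mapMatrix_apply, ← RingHom.map_det]
    exact HasTopCoeff.const _
  have hN : EvenTopCoeff (1 + evenX 𝒜 • (A.series.block00 - A.series.schurTerm)).det p
      (A.block00 - A.schurTerm).det := by
    refine EvenTopCoeff.det _ _ fun σ => ?_
    have h1 : ∀ i j, EvenTopCoeff ((1 + evenX 𝒜 • (A.series.block00 - A.series.schurTerm)) i j) 1
        ((A.block00 - A.schurTerm) i j) := by
      intro i j
      have h2 : EvenTopCoeff (evenX 𝒜 * evenC 𝒜 ((A.block00 - A.schurTerm) i j)) (1 + 0)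
          (1 * (A.block00 - A.schurTerm) i j) := hX.mul (HasTopCoeff.const _)
      rw [one_mul, add_zero] at h2
      have h3 : EvenTopCoeff ((1 : Matrix (Fin p) (Fin p) (seriesGrading 𝒜 0)) i j) 1 0 := by
        rw [Matrix.one_apply]
        split_ifs
        · rw [← map_one (evenC 𝒜)]
          exact HasTopCoeff.const_succ _ 0
        · exact EvenTopCoeff.zero 1
      have h4 := h3.add h2
      rw [zero_add] at h4
      rw [Matrix.add_apply, Matrix.smul_apply, smul_eq_mul, block00_series, schurTerm_series A hA]
      rw [Matrix.sub_apply, map_sub] at h4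
      exact h4
    have h5 := EvenTopCoeff.prod Finset.univ fun i _ => h1 (σ i) i
    simpa using h5
  have hL := ((hX.pow q).mul hdet).mul (evenTopCoeff_hankel_deform A ((p : ℤ) - q) (q + 1)
    ((q + 1) * p) (by push_cast; ring))
  have hR := hN.mul (evenTopCoeff_hankel_deform A ((p : ℤ) - q + 2) q (q * (p + 1))
    (by push_cast; ring))
  rw [h, show q * 1 + 0 + (q + 1) * p = p + q * (p + 1) by ring] at hL
  have := hL.unique hR
  rwa [one_pow, one_mul] at this

/-- The Berezinian is a ratio of Hankel determinants, in the form without denominators. -/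
theorem ber_mul_hankel (A : EvenOperator 𝒜 p q) (hA : IsUnit A.block11) :
    A.ber * hankel (trExt A) ((p : ℤ) - q + 2) q = hankel (trExt A) ((p : ℤ) - q) (q + 1) := by
  have hdet : IsUnit A.block11.det := (Matrix.isUnit_iff_isUnit_det _).1 hA
  have h := det_block11_mul_hankel A hA
  have h1 := Ring.inverse_mul_cancel _ hdet
  rw [trExt_eq, EvenOperator.ber]
  linear_combination (-Ring.inverse A.block11.det) * h +
    hankel (zeroExtend (newtonE (strPow A))) ((p : ℤ) - q) (q + 1) * h1

end Berezinian

/-! ### An operator with invertible Hankel determinant -/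

section Example

open Polynomial

/-- If `a` has degree at most `p` and `b` has degree `q` and is coprime to `a`, then the
coefficients of `a / b` satisfy no linear recurrence shorter than the one given by `b`. -/
theorem hankel_ne_zero {K : Type u} [Field K] (e : ℕ → K) (a b : K[X]) (p q : ℕ)
    (ha : a.natDegree ≤ p) (hb : b.natDegree = q) (hab : IsCoprime b a)
    (h : PowerSeries.mk e * (b : PowerSeries K) = a) :
    hankel (zeroExtend e) ((p : ℤ) - q + 2) q ≠ 0 := by
  cases q with
  | zero => simp [hankel]
  | succ q =>
    intro hH
    obtain ⟨v, hv0, hv⟩ := Matrix.exists_mulVec_eq_zero_iff.2 hH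
    let V : K[X] := ∑ j : Fin (q + 1), monomial (q - j) (v j)
    have hVc : ∀ j : Fin (q + 1), V.coeff (q - j) = v j := by
      intro j
      rw [finsetSum_coeff, Finset.sum_eq_single j]
      · rw [coeff_monomial, if_pos rfl]
      · intro i _ hij
        rw [coeff_monomial, if_neg]
        intro hij'
        apply hij
        ext
        have := i.2
        have := j.2
        omega
      · simp
    have hVd : V.natDegree ≤ q := natDegree_sum_le_of_forall_le _ _ fun j _ =>
      (natDegree_monomial_le _).trans (Nat.sub_le _ _)
    set F : PowerSeries K := PowerSeries.mk e * (V : PowerSeries K) with hF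
    have hker : ∀ i : Fin (q + 1), PowerSeries.coeff (p + 1 + i) F = 0 := by
      intro i
      rw [hF, ← sum_coeff_mul_zeroExtend e V (p + 1) q hVd i]
      have := congrFun hv i
      rw [Matrix.mulVec, dotProduct] at this
      simp only [Matrix.of_apply, Pi.zero_apply] at this
      rw [← this]
      refine Finset.sum_congr rfl fun j _ => ?_
      rw [hVc, mul_comm]
      congr 2
      push_cast
      ring
    -- a vector in the kernel gives `V` with `e V = U + O(t^{p+q+2})`; by degrees, `a V = b U`
    let U : K[X] := PowerSeries.trunc (p + 1) F
    have hUd : U.natDegree ≤ p := Nat.lt_succ_iff.1 (PowerSeries.natDegree_trunc_lt F p)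
    have hFU : ∀ n ≤ p + (q + 1), PowerSeries.coeff n (F - (U : PowerSeries K)) = 0 := by
      intro n hn
      rw [map_sub, coeff_coe, PowerSeries.coeff_trunc]
      split_ifs with h1
      · rw [sub_self]
      · rw [sub_zero]
        have := hker ⟨n - (p + 1), by omega⟩
        rwa [show p + 1 + (n - (p + 1)) = n by omega] at this
    have hprod : a * V = b * U := by
      rw [← sub_eq_zero]
      ext n
      rw [coeff_zero]
      by_cases hn : n ≤ p + (q + 1)
      · rw [← coeff_coe]
        have h1 : ((a * V - b * U : K[X]) : PowerSeries K) =
            (b : PowerSeries K) * (F - (U : PowerSeries K)) := by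
          rw [coe_sub, coe_mul, coe_mul, ← h, hF]
          ring
        rw [h1, PowerSeries.coeff_mul]
        refine Finset.sum_eq_zero fun x hx => ?_
        have := Finset.HasAntidiagonal.mem_antidiagonal.1 hx
        rw [hFU _ (by omega), mul_zero]
      · rw [coeff_sub, coeff_eq_zero_of_natDegree_lt, coeff_eq_zero_of_natDegree_lt, sub_zero]
        · exact (natDegree_mul_le.trans (by omega)).trans_lt (not_le.1 hn)
        · exact (natDegree_mul_le.trans (by omega)).trans_lt (not_le.1 hn)
    have hdvd : b ∣ V := hab.dvd_of_dvd_mul_left ⟨U, hprod⟩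
    have hV0 : V = 0 := eq_zero_of_dvd_of_natDegree_lt hdvd (by omega)
    apply hv0
    funext j
    rw [← hVc, hV0, coeff_zero, Pi.zero_apply]

theorem detPoly_smul_one {S : Type u} [CommRing S] (n : ℕ) (x : S) :
    detPoly (x • (1 : Matrix (Fin n) (Fin n) S)) = (1 + C x * X) ^ n := by
  have : (X : S[X]) • (x • (1 : Matrix (Fin n) (Fin n) S)).map C +
      (1 : Matrix (Fin n) (Fin n) S).map C =
      Matrix.diagonal fun _ : Fin n => (1 + C x * X : S[X]) := by
    ext1 i j
    by_cases h : i = j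
    · subst h
      simp [X_mul_C, add_comm]
    · simp [h]
  rw [detPoly, this, Matrix.det_diagonal, Finset.prod_const, Finset.card_univ, Fintype.card_fin]

/-- For the operator `diag(1, -1)` the generating function is `(1 + X)^p / (1 - X)^q`. -/
theorem hankel_parity_ne_zero (p q : ℕ) :
    hankel (zeroExtend (newtonE fun k => (p : ℚ) - q * (-1) ^ k)) ((p : ℤ) - q + 2) q ≠ 0 := by
  refine hankel_ne_zero _ (detPoly ((1 : ℚ) • (1 : Matrix (Fin p) (Fin p) ℚ)))
    (detPoly ((-1 : ℚ) • (1 : Matrix (Fin q) (Fin q) ℚ))) p q (natDegree_detPoly_le _) ?_ ?_ ?_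
  · refine le_antisymm (natDegree_detPoly_le _) (le_natDegree_of_ne_zero ?_)
    rw [coeff_detPoly, Matrix.det_smul, Matrix.det_one, mul_one]
    exact pow_ne_zero _ (by norm_num)
  · rw [detPoly_smul_one, detPoly_smul_one]
    refine IsCoprime.pow ⟨C (1 / 2), C (1 / 2), ?_⟩
    simp only [map_neg, map_one]
    have : (C (1 / 2) : ℚ[X]) * 2 = 1 := by
      rw [← C_ofNat, ← C_mul]
      norm_num
    linear_combination this
  · change newtonSeries _ * _ = _
    rw [coe_detPoly, coe_detPoly, ← newtonSeries_trace, ← newtonSeries_trace, ← newtonSeries_add]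
    congr 1
    funext k
    simp only [_root_.smul_pow, one_pow, Matrix.trace_smul, Matrix.trace_one, Fintype.card_fin]
    simp [mul_comm]

variable {R : Type u} [Ring R] [Algebra ℚ R] (𝒜 : ZMod 2 → Submodule ℚ R) [GradedAlgebra 𝒜]

/-- The parity operator `diag(1, -1)`. -/
def parityOperator (p q : ℕ) : EvenOperator 𝒜 p q where
  mat := Matrix.diagonal (Sum.elim (fun _ => 1) fun _ => -1)
  mem i j := by
    by_cases h : i = j
    · subst h
      rw [Matrix.diagonal_apply_eq, zmod2_add_self]
      rcases i with i | i
      · exact SetLike.GradedOne.one_mem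
      · exact (𝒜 0).neg_mem SetLike.GradedOne.one_mem
    · rw [Matrix.diagonal_apply_ne _ h]
      exact (𝒜 _).zero_mem

variable [SuperCommutative 𝒜]

omit [SuperCommutative 𝒜] in
theorem strPow_parityOperator (p q k : ℕ) :
    strPow (parityOperator 𝒜 p q) k = algebraMap ℚ (𝒜 0) ((p : ℚ) - q * (-1) ^ k) := by
  apply Subtype.ext
  change ∑ i, ((-1 : ℤˣ) ^ par i) • ((parityOperator 𝒜 p q).mat ^ k) i i =
    algebraMap ℚ R ((p : ℚ) - q * (-1) ^ k)
  simp [parityOperator, Matrix.diagonal_pow, Fintype.sum_sum_type, par, sub_eq_add_neg]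

theorem isUnit_hankel_parityOperator (p q : ℕ) :
    IsUnit (hankel (trExt (parityOperator 𝒜 p q)) ((p : ℤ) - q + 2) q) := by
  have h : hankel (trExt (parityOperator 𝒜 p q)) ((p : ℤ) - q + 2) q = algebraMap ℚ (𝒜 0)
      (hankel (zeroExtend (newtonE fun k => (p : ℚ) - q * (-1) ^ k)) ((p : ℤ) - q + 2) q) := by
    rw [trExt_eq, hankel, hankel, RingHom.map_det]
    congr 1
    ext1 i j
    rw [RingHom.mapMatrix_apply, Matrix.map_apply, Matrix.of_apply, Matrix.of_apply, map_zeroExtend]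
    congr 1
    funext n
    rw [map_newtonE]
    congr 1
    funext k
    exact strPow_parityOperator 𝒜 p q k
  rw [h]
  exact (isUnit_iff_ne_zero.2 (hankel_parity_ne_zero p q)).map _

omit [SuperCommutative 𝒜] in
theorem isUnit_mat_parityOperator (p q : ℕ) : IsUnit (parityOperator 𝒜 p q).mat := by
  have h : (parityOperator 𝒜 p q).mat * (parityOperator 𝒜 p q).mat = 1 := by
    rw [parityOperator, Matrix.diagonal_mul_diagonal, ← Matrix.diagonal_one]
    congr 1
    funext i
    rcases i with i | i <;> simp
  exact ⟨⟨_, _, h, h⟩, rfl⟩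

theorem isUnit_block11_parityOperator (p q : ℕ) : IsUnit (parityOperator 𝒜 p q).block11 := by
  have h : (parityOperator 𝒜 p q).block11 = -1 := by
    ext1 i j
    apply Subtype.ext
    change Matrix.diagonal (Sum.elim (fun _ => 1) fun _ => -1) (Sum.inr i : Fin p ⊕ Fin q)
      (Sum.inr j) = ((-(1 : Matrix (Fin q) (Fin q) (𝒜 0)) i j : 𝒜 0) : R)
    by_cases h : i = j
    · subst h
      rw [Matrix.diagonal_apply_eq, Matrix.one_apply_eq]
      rfl
    · rw [Matrix.diagonal_apply_ne _ (fun e => h (Sum.inr_injective e)), Matrix.one_apply_ne h,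
        neg_zero]
      rfl
  rw [h]
  exact isUnit_one.neg

end Example

/-! ### Young modules and Hankel determinants -/

section Young

variable {R : Type u} [Ring R] [Algebra ℚ R] {𝒜 : ZMod 2 → Submodule ℚ R} [GradedAlgebra 𝒜]
  [SuperCommutative 𝒜] {p q : ℕ}

theorem trYoung_eq_hankel (A : EvenOperator 𝒜 p q) (r s : ℕ) :
    trYoung A r s = ((revSign s : ℤ) : 𝒜 0) * hankel (trExt A) ((r : ℤ) - s + 1) s := by
  rw [trYoung_eq, det_jacobiTrudi, trExt_eq]

theorem isUnit_revSign (S : Type u) [CommRing S] (s : ℕ) : IsUnit ((revSign s : ℤ) : S) :=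
  (revSign s).isUnit.map (Int.castRingHom S)

end Young

end SuperLin

end

theorem mainTheorem2 {R : Type*} [Ring R] [Algebra ℚ R] (𝒜 : ZMod 2 → Submodule ℚ R)
    [GradedAlgebra 𝒜] [SuperLin.SuperCommutative 𝒜] (p q : ℕ) :
    (∀ A : SuperLin.EvenOperator 𝒜 p q, IsUnit A.block11 →
      A.ber * SuperLin.hankel (SuperLin.trExt A) ((p : ℤ) - q + 2) q =
          SuperLin.hankel (SuperLin.trExt A) ((p : ℤ) - q) (q + 1) ∧
      A.ber * SuperLin.trYoung A (p + 1) q = (-1) ^ q * SuperLin.trYoung A p (q + 1) ∧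
      (IsUnit (SuperLin.hankel (SuperLin.trExt A) ((p : ℤ) - q + 2) q) ↔
        IsUnit (SuperLin.trYoung A (p + 1) q)) ∧
      (IsUnit (SuperLin.hankel (SuperLin.trExt A) ((p : ℤ) - q + 2) q) →
        A.ber = SuperLin.hankel (SuperLin.trExt A) ((p : ℤ) - q) (q + 1) *
            Ring.inverse (SuperLin.hankel (SuperLin.trExt A) ((p : ℤ) - q + 2) q) ∧
        A.ber = (-1) ^ q * (SuperLin.trYoung A p (q + 1) *
            Ring.inverse (SuperLin.trYoung A (p + 1) q)))) ∧
    (∃ A : SuperLin.EvenOperator 𝒜 p q, IsUnit A.mat ∧ IsUnit A.block11 ∧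
      IsUnit (SuperLin.hankel (SuperLin.trExt A) ((p : ℤ) - q + 2) q)) := by
  refine ⟨fun A hA => ?_, SuperLin.parityOperator 𝒜 p q, SuperLin.isUnit_mat_parityOperator 𝒜 p q,
    SuperLin.isUnit_block11_parityOperator 𝒜 p q, SuperLin.isUnit_hankel_parityOperator 𝒜 p q⟩
  have hber := SuperLin.ber_mul_hankel A hA
  have h1 : SuperLin.trYoung A (p + 1) q = ((SuperLin.revSign q : ℤ) : 𝒜 0) *
      SuperLin.hankel (SuperLin.trExt A) ((p : ℤ) - q + 2) q := by
    rw [SuperLin.trYoung_eq_hankel]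
    congr 2
    push_cast
    ring
  have h2 : SuperLin.trYoung A p (q + 1) = (-1) ^ q * ((SuperLin.revSign q : ℤ) : 𝒜 0) *
      SuperLin.hankel (SuperLin.trExt A) ((p : ℤ) - q) (q + 1) := by
    rw [SuperLin.trYoung_eq_hankel, SuperLin.revSign_succ]
    congr 2
    · push_cast
      rfl
    · push_cast
      ring
  have hsq : ((-1 : 𝒜 0) ^ q) * (-1) ^ q = 1 := by rw [← mul_pow, neg_one_mul, neg_neg, one_pow]
  have hyoung : A.ber * SuperLin.trYoung A (p + 1) q =
      (-1) ^ q * SuperLin.trYoung A p (q + 1) := by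
    rw [h1, h2]
    linear_combination ((SuperLin.revSign q : ℤ) : 𝒜 0) * hber -
      ((SuperLin.revSign q : ℤ) : 𝒜 0) *
        SuperLin.hankel (SuperLin.trExt A) ((p : ℤ) - q) (q + 1) * hsq
  have hiff : IsUnit (SuperLin.hankel (SuperLin.trExt A) ((p : ℤ) - q + 2) q) ↔
      IsUnit (SuperLin.trYoung A (p + 1) q) := by
    rw [h1, IsUnit.mul_iff, and_iff_right (SuperLin.isUnit_revSign _ q)]
  refine ⟨hber, hyoung, hiff, fun hu => ⟨?_, ?_⟩⟩
  · rw [← hber, mul_assoc, Ring.mul_inverse_cancel _ hu, mul_one]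
  · rw [← mul_assoc, ← hyoung, mul_assoc, Ring.mul_inverse_cancel _ (hiff.1 hu), mul_one]
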